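/- Let $N$ be a closed Riemannian manifold and $E_N\to N$ a complex Hermitian vector bundle. Let $p_1\colon M_1\to N$ and $p_2\colon M_2\to N$ be Galois covers with deck transformation groups $\Gamma_1$ and $\Gamma_2\cong\Gamma_1/H$, where $H$ is a normal subgroup of $\Gamma_1$, so that $M_2\cong M_1/H$; let $\pi\colon M_1\to M_2$ be the projection, so that $p_2\circ\pi=p_1$ and $\pi(gy)=[g]\pi(y)$ for $g\in\Gamma_1$, $y\in M_1$, where $[g]\in\Gamma_2$ is the class of $g$. Equip $M_j$ with the lifted Riemannian metric and its Riemannian distance $d_{M_j}$ and measure, and let $E_j=p_j^*E_N$ with its natural $\Gamma_j$-action; $\Gamma_j$ acts on sections by $(g\cdot s)(y)=g(s(g^{-1}y))$. For a bounded operator $T$ on $L^2(E_j)$, the support of $T$ is the complement in $M_j\times M_j$ of the set of all $(x,y)$ for which there are $f_1,f_2\in C_0(M_j)$ with $f_1(x)\ne0$, $f_2(y)\ne0$ and $f_1Tf_2=0$, and $T$ has finite propagation if $\sup\{d_{M_j}(x,y) : (x,y)\in\operatorname{supp}T\}<\infty$. Let $\mathcal B_{\mathrm{fp}}(L^2(E_j))^{\Gamma_j}$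 be the $*$-algebra of bounded, $\Gamma_j$-equivariant operators on $L^2(E_j)$ with finite propagation. Choose a finite open cover $\{U_i\}_{i\in I}$ of $N$ by sets that are evenly covered by $p_1$ and $p_2$, a partition of unity $\{\phi_i\}_{i\in I}$ subordinate to it, and, for each $i$, an open set $U_i^e\subseteq M_1$ that $p_1$ maps homeomorphically onto $U_i$. For $g\in\Gamma_1$ put $U_i^g=gU_i^e$ and $U_i^{[g]}=\pi(U_i^g)$, and let $\phi_i^g$ and $\phi_i^{[g]}$ be the functions on $M_1$ and $M_2$ that equal $\phi_i\circ p_1$ on $U_i^g$ and $\phi_i\circ p_2$ on $U_i^{[g]}$, respectively, and vanish elsewhere. Let $\pi_*$ and $\pi|_{U_i^g}^*$ denote the mutually inverse identifications between sections of $E_1$ over $U_i^g$ and sections of $E_2$ over $U_i^{[g]}$ (extended by zero). Choose also a set $S\subseteq\Gamma_1$ of representatives of $H\backslash\Gamma_1$. For $T\in\mathcal B_{\mathrm{fp}}(L^2(E_1))^{\Gamma_1}$ and $u\in L^2(E_2)$ define $$\Psi(T)u=\sum_{g\in\Gamma_1,\ s\in S}\ \sum_{i,j\in I}\pi_*\Big(\phi_i^g\cdot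 T\big(\pi|_{U_j^s}^*(\phi_j^{[s]}u)\big)\Big).$$ Then every term is a well-defined element of $L^2(E_2)$, the sum converges unconditionally in $L^2(E_2)$, and $\Psi$ is a (unital) $*$-homomorphism $$\Psi\colon\mathcal B_{\mathrm{fp}}(L^2(E_1))^{\Gamma_1}\to\mathcal B_{\mathrm{fp}}(L^2(E_2))^{\Gamma_2}.$$ Moreover $\Psi$ does not depend on the choice of the set $S$ of coset representatives, nor on the choice of the cover, the partition of unity and the lifts. -/

import Mathlib

open MeasureTheory Bundle Set Filter Topology
open scoped Manifold ContDiff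

namespace Folding

/-! ### Riemannian measure -/

section Riemannian

variable (n : ℕ) {M : Type*} [TopologicalSpace M] [ChartedSpace (EuclideanSpace ℝ (Fin n)) M]
  [RiemannianBundle (fun y : M => TangentSpace (𝓡 n) y)]

/-- The coordinate vector field `∂ᵢ` of the chart at `x`, at the point with coordinates `z`. -/
noncomputable def coordVector (x : M) (z : EuclideanSpace ℝ (Fin n)) (i : Fin n) :
    TangentSpace (𝓡 n) ((chartAt (EuclideanSpace ℝ (Fin n)) x).symm z) :=
  mfderiv (𝓡 n) (𝓡 n) (chartAt (EuclideanSpace ℝ (Fin n)) x).symm z (EuclideanSpace.single i 1)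

/-- The matrix `g_{ij} = ⟨∂ᵢ, ∂ⱼ⟩` of the Riemannian metric in the chart at `x`. -/
noncomputable def metricMatrix (x : M) (z : EuclideanSpace ℝ (Fin n)) :
    Matrix (Fin n) (Fin n) ℝ :=
  Matrix.of fun i j => inner ℝ (coordVector n x z i) (coordVector n x z j)

/-- The Riemannian measure `√(det g_{ij}) dz` on the domain of the chart at `x`, as a measure
on `M` (vanishing outside the domain of the chart). -/
noncomputable def chartVolume [MeasurableSpace M] (x : M) : Measure M :=
  ((volume.restrict (chartAt (EuclideanSpace ℝ (Fin n)) x).target).withDensity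
    (fun z => ENNReal.ofReal (Real.sqrt (metricMatrix n x z).det))).map
    (chartAt (EuclideanSpace ℝ (Fin n)) x).symm

/-- The Riemannian measure of `M`. The measures `chartVolume n x` are the restrictions of the
Riemannian measure to the chart domains, so the Riemannian measure is their supremum. -/
noncomputable def riemannianVolume (M : Type*) [TopologicalSpace M]
    [ChartedSpace (EuclideanSpace ℝ (Fin n)) M]
    [RiemannianBundle (fun y : M => TangentSpace (𝓡 n) y)] [MeasurableSpace M] : Measure M :=
  ⨆ x : M, chartVolume n x

end Riemannian

/-! ### Hermitian bundles and square-integrable sections of pulled back bundles -/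

/-- The Hermitian metric of a complex vector bundle is continuous. By polarization it is enough
that the norm be continuous on the total space. -/
class ContinuousHermitianBundle {N : Type*} [TopologicalSpace N]
    (F : Type*) [NormedAddCommGroup F] [NormedSpace ℂ F]
    (E : N → Type*) [TopologicalSpace (TotalSpace F E)] [∀ x, NormedAddCommGroup (E x)]
    [∀ x, InnerProductSpace ℂ (E x)] : Prop where
  continuous_norm : Continuous fun v : TotalSpace F E => ‖v.2‖

/-- Minkowski's inequality for series. -/
lemma eLpNorm_tsum_le {M : Type*} [MeasurableSpace M] {μ : Measure M} {a : ℕ → M → ENNReal} (ha : ∀ i, AEMeasurable (a i) μ) :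
    (∫⁻ y, (∑' i, a i y) ^ (2 : ℝ) ∂μ) ^ (1 / 2 : ℝ) ≤
      ∑' i, (∫⁻ y, (a i y) ^ (2 : ℝ) ∂μ) ^ (1 / 2 : ℝ) := by
  have hfin : ∀ k : ℕ, (∫⁻ y, (∑ i ∈ Finset.range k, a i y) ^ (2 : ℝ) ∂μ) ^ (1 / 2 : ℝ) ≤
      ∑ i ∈ Finset.range k, (∫⁻ y, (a i y) ^ (2 : ℝ) ∂μ) ^ (1 / 2 : ℝ) := by
    intro k
    induction k with
    | zero => simp
    | succ k ih =>
      simp only [Finset.sum_range_succ]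
      refine le_trans ?_ (add_le_add_left ih _)
      exact ENNReal.lintegral_Lp_add_le (Finset.aemeasurable_fun_sum _ fun i _ => ha i) (ha k)
        one_le_two
  have hsup : ∀ y, (∑' i, a i y) ^ (2 : ℝ) = ⨆ k, (∑ i ∈ Finset.range k, a i y) ^ (2 : ℝ) := by
    intro y
    rw [ENNReal.tsum_eq_iSup_nat]
    exact (ENNReal.orderIsoRpow 2 two_pos).map_iSup _
  simp only [hsup]
  rw [lintegral_iSup' (fun k => (Finset.aemeasurable_fun_sum _ fun i _ => ha i).pow_const _)
    (Eventually.of_forall fun y k l hkl => ENNReal.rpow_le_rpow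
      (Finset.sum_le_sum_of_subset (Finset.range_mono hkl)) zero_le_two)]
  have h3 := (ENNReal.orderIsoRpow (1 / 2) (by norm_num)).map_iSup
    fun k => ∫⁻ y, (∑ i ∈ Finset.range k, a i y) ^ (2 : ℝ) ∂μ
  simp only [ENNReal.orderIsoRpow_apply] at h3
  rw [h3]
  exact iSup_le fun k => (hfin k).trans (ENNReal.sum_le_tsum _)

section L2

variable {N : Type*} [TopologicalSpace N]
  (F : Type*) [NormedAddCommGroup F] [NormedSpace ℂ F]
  (E : N → Type*) [TopologicalSpace (TotalSpace F E)] [∀ x, NormedAddCommGroup (E x)]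
  [∀ x, InnerProductSpace ℂ (E x)] [FiberBundle F E] [VectorBundle ℂ F E]
  {M : Type*} [TopologicalSpace M] [MeasurableSpace M]
  (p : C(M, N)) (μ : Measure M)

/-- A section `s` of the pullback bundle `p^*E` (so `s y ∈ E (p y)`) is almost everywhere
measurable if its coordinates in each local trivialization of `E` are. (The map
`continuousLinearMapAt` is the trivialization over its base set, and `0` elsewhere.) -/
def AEMeasurableSection (s : ∀ y : M, E (p y)) : Prop :=
  ∀ x₀ : N, AEStronglyMeasurable
    (fun y => (trivializationAt F E x₀).continuousLinearMapAt ℂ (p y) (s y)) μ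

/-- Square-integrable measurable sections of `p^*E`. -/
def MemL2 (s : ∀ y : M, E (p y)) : Prop :=
  AEMeasurableSection F E p μ s ∧ ∫⁻ y, ‖s y‖ₑ ^ 2 ∂μ < ⊤

variable {F E p μ}

lemma AEMeasurableSection.add {s t : ∀ y : M, E (p y)} (hs : AEMeasurableSection F E p μ s)
    (ht : AEMeasurableSection F E p μ t) : AEMeasurableSection F E p μ (s + t) := fun x₀ => by
  exact ((hs x₀).add (ht x₀)).congr (Eventually.of_forall fun y => by simp)

lemma AEMeasurableSection.smul {s : ∀ y : M, E (p y)} (hs : AEMeasurableSection F E p μ s)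
    {f : M → ℂ} (hf : AEStronglyMeasurable f μ) :
    AEMeasurableSection F E p μ (fun y => f y • s y) := fun x₀ => by
  exact (hf.smul (hs x₀)).congr (Eventually.of_forall fun y => by simp)

lemma AEMeasurableSection.norm [FiniteDimensional ℂ F] [ContinuousHermitianBundle F E]
    [CompactSpace N] [BorelSpace M]
    {s : ∀ y : M, E (p y)} (hs : AEMeasurableSection F E p μ s) :
    AEStronglyMeasurable (fun y => ‖s y‖) μ := by
  borelize F
  have : ProperSpace F := FiniteDimensional.proper ℂ F
  obtain ⟨t, ht⟩ := CompactSpace.elim_nhds_subcover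
    (fun x : N => (trivializationAt F E x).baseSet) (fun x =>
      (trivializationAt F E x).open_baseSet.mem_nhds (FiberBundle.mem_baseSet_trivializationAt' x))
  have hcov : (⋃ x : t, p ⁻¹' (trivializationAt F E x.1).baseSet) = univ := by
    refine eq_univ_of_forall fun y => ?_
    have : p y ∈ ⋃ x ∈ t, (trivializationAt F E x).baseSet := by rw [ht]; trivial
    simpa using this
  rw [← Measure.restrict_univ (μ := μ), ← hcov, aestronglyMeasurable_iUnion_iff]
  rintro ⟨x, -⟩
  set e := trivializationAt F E x with he
  have hB : IsOpen (p ⁻¹' e.baseSet) := e.open_baseSet.preimage p.continuous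
  let G : F → M → ℝ := fun v => (p ⁻¹' e.baseSet).indicator fun y => ‖e.symmL ℂ (p y) v‖
  have hG : StronglyMeasurable (Function.uncurry G) := by
    refine stronglyMeasurable_uncurry_of_continuous_of_stronglyMeasurable ?_ ?_
    · intro y
      by_cases hy : y ∈ p ⁻¹' e.baseSet
      · simpa only [G, indicator_of_mem hy] using (e.symmL ℂ (p y)).continuous.norm
      · simpa only [G, indicator_of_notMem hy] using continuous_const
    · intro v
      have hc : ContinuousOn (fun y => ‖e.symmL ℂ (p y) v‖) (p ⁻¹' e.baseSet) := by
        have h1 : ContinuousOn (fun y => e.toOpenPartialHomeomorph.symm (p y, v))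
            (p ⁻¹' e.baseSet) := by
          refine e.continuousOn_invFun.comp (by fun_prop) ?_
          intro y hy
          exact e.mem_target.2 hy
        have h2 := (ContinuousHermitianBundle.continuous_norm (F := F) (E := E)).comp_continuousOn h1
        refine h2.congr fun y hy => ?_
        have h3 := congrArg (fun w : TotalSpace F E => ‖w.2‖) (e.mk_symm hy v)
        rw [Trivialization.symmL_apply e hy]
        exact h3
      classical
      exact ((hc.measurable_piecewise continuousOn_const hB.measurableSet).stronglyMeasurable)
  have hcomp : AEStronglyMeasurable (fun y => G (e.continuousLinearMapAt ℂ (p y) (s y)) y)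
      (μ.restrict (p ⁻¹' e.baseSet)) := by
    have h := ((hs x).mono_measure (Measure.restrict_le_self (s := p ⁻¹' e.baseSet)))
    refine ⟨fun y => G (h.mk _ y) y, hG.comp_measurable
      (h.stronglyMeasurable_mk.measurable.prodMk measurable_id), ?_⟩
    · filter_upwards [h.ae_eq_mk] with y hy
      rw [← hy]
  refine hcomp.congr ?_
  filter_upwards [ae_restrict_mem hB.measurableSet] with y hy
  simp only [G, indicator_of_mem hy]
  rw [e.symmL_continuousLinearMapAt hy]

variable [FiniteDimensional ℂ F] [ContinuousHermitianBundle F E] [CompactSpace N] [BorelSpace M]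

lemma MemL2.memLp_norm {s : ∀ y : M, E (p y)} (hs : MemL2 F E p μ s) :
    MemLp (fun y => ‖s y‖) 2 μ := by
  refine ⟨hs.1.norm, ?_⟩
  rw [eLpNorm_lt_top_iff_lintegral_rpow_enorm_lt_top (by simp) (by simp)]
  simpa using hs.2

lemma MemL2.of_norm_le {s : ∀ y : M, E (p y)} (hs : AEMeasurableSection F E p μ s) {g : M → ℝ}
    (hg : MemLp g 2 μ) (h : ∀ᵐ y ∂μ, ‖s y‖ ≤ g y) : MemL2 F E p μ s := by
  refine ⟨hs, ?_⟩
  have h1 : MemLp (fun y => ‖s y‖) 2 μ := hg.mono' hs.norm (by simpa using h)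
  have h2 := (eLpNorm_lt_top_iff_lintegral_rpow_enorm_lt_top (by simp) (by simp)).1 h1.2
  simpa using h2

lemma MemL2.add {s t : ∀ y : M, E (p y)} (hs : MemL2 F E p μ s) (ht : MemL2 F E p μ t) :
    MemL2 F E p μ (s + t) :=
  .of_norm_le (hs.1.add ht.1) (hs.memLp_norm.add ht.memLp_norm)
    (Eventually.of_forall fun _ => norm_add_le _ _)

/-- Multiplication of a square-integrable section by a bounded measurable function. -/
lemma MemL2.smul {s : ∀ y : M, E (p y)} (hs : MemL2 F E p μ s) {f : M → ℂ}
    (hf : AEStronglyMeasurable f μ) {C : ℝ} (hC : ∀ y, ‖f y‖ ≤ C) :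
    MemL2 F E p μ (fun y => f y • s y) :=
  .of_norm_le (hs.1.smul hf) (hs.memLp_norm.const_mul C) (Eventually.of_forall fun y => by
    rw [norm_smul]; exact mul_le_mul_of_nonneg_right (hC y) (norm_nonneg _))

lemma MemL2.const_smul {s : ∀ y : M, E (p y)} (hs : MemL2 F E p μ s) (c : ℂ) :
    MemL2 F E p μ (c • s) :=
  hs.smul (f := fun _ => c) aestronglyMeasurable_const (C := ‖c‖) fun _ => le_rfl

lemma MemL2.integrable_inner {s t : ∀ y : M, E (p y)} (hs : MemL2 F E p μ s)
    (ht : MemL2 F E p μ t) : Integrable (fun y => inner ℂ (s y) (t y)) μ := by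
  refine (hs.memLp_norm.integrable_mul ht.memLp_norm).mono' ?_
    (Eventually.of_forall fun y => norm_inner_le_norm _ _)
  have key : ∀ c : ℂ, AEStronglyMeasurable (fun y => ((‖s y + c • t y‖ : ℝ) : ℂ)) μ := fun c =>
    Complex.continuous_ofReal.comp_aestronglyMeasurable (hs.add (ht.const_smul c)).1.norm
  have h : (fun y => inner ℂ (s y) (t y)) = fun y =>
      ((‖s y + (1 : ℂ) • t y‖ : ℂ) ^ 2 - (‖s y + (-1 : ℂ) • t y‖ : ℂ) ^ 2
        + ((‖s y + (-Complex.I) • t y‖ : ℂ) ^ 2 - (‖s y + Complex.I • t y‖ : ℂ) ^ 2)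
          * Complex.I) / 4 := by
    funext y
    rw [inner_eq_sum_norm_sq_div_four]
    simp [sub_eq_add_neg]
  rw [h]
  simp only [div_eq_mul_inv]
  exact (((((key 1).pow 2).sub ((key (-1)).pow 2)).add
    ((((key (-Complex.I)).pow 2).sub ((key Complex.I).pow 2)).mul_const Complex.I))).mul_const 4⁻¹

variable (F E p μ)

/-- The vector space of square-integrable sections of `p^*E`. -/
def l2Submodule : Submodule ℂ (∀ y : M, E (p y)) where
  carrier := {s | MemL2 F E p μ s}
  add_mem' := MemL2.add
  zero_mem' := by
    refine ⟨fun x₀ => ?_, by simp⟩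
    simpa using aestronglyMeasurable_const
  smul_mem' c _ hs := hs.const_smul c

/-- The vector space of square-integrable sections of `p^*E`, with the seminorm of `L²`. -/
def PreL2 : Type _ := l2Submodule F E p μ

noncomputable instance : AddCommGroup (PreL2 F E p μ) :=
  inferInstanceAs (AddCommGroup (l2Submodule F E p μ))

noncomputable instance : Module ℂ (PreL2 F E p μ) :=
  inferInstanceAs (Module ℂ (l2Submodule F E p μ))

variable {F E p μ}

/-- The section underlying an element of `PreL2`. -/
def PreL2.sec (s : PreL2 F E p μ) : ∀ y : M, E (p y) := Subtype.val (p := (· ∈ l2Submodule F E p μ)) s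

lemma PreL2.mem (s : PreL2 F E p μ) : MemL2 F E p μ s.sec :=
  Subtype.property (p := (· ∈ l2Submodule F E p μ)) s

/-- The element of `PreL2` given by a square-integrable section. -/
def PreL2.mk (s : ∀ y : M, E (p y)) (hs : MemL2 F E p μ s) : PreL2 F E p μ :=
  Subtype.mk (p := (· ∈ l2Submodule F E p μ)) s hs

@[simp] lemma PreL2.sec_mk (s : ∀ y : M, E (p y)) (hs : MemL2 F E p μ s) :
    (PreL2.mk s hs).sec = s := rfl

@[simp] lemma PreL2.sec_add (s t : PreL2 F E p μ) : (s + t).sec = s.sec + t.sec := rfl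

@[simp] lemma PreL2.sec_sub (s t : PreL2 F E p μ) : (s - t).sec = s.sec - t.sec := rfl

@[simp] lemma PreL2.sec_smul (c : ℂ) (s : PreL2 F E p μ) : (c • s).sec = c • s.sec := rfl

@[simp] lemma PreL2.sec_sum (s : ℕ → PreL2 F E p μ) (t : Finset ℕ) (y : M) :
    (∑ i ∈ t, s i).sec y = ∑ i ∈ t, (s i).sec y := by
  classical
  induction t using Finset.induction_on with
  | empty => rfl
  | insert a t ha ih => rw [Finset.sum_insert ha, Finset.sum_insert ha, ← ih]; rfl

variable (F E p μ)

/-- The inner product `∫ ⟨s y, t y⟩ dμ`. -/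
@[reducible] noncomputable def preL2Core : PreInnerProductSpace.Core ℂ (PreL2 F E p μ) where
  inner s t := ∫ y, inner ℂ (s.sec y) (t.sec y) ∂μ
  conj_inner_symm s t := by
    rw [← integral_conj]
    simp
  re_inner_nonneg s := by
    have h := integral_re (s.mem.integrable_inner s.mem)
    rw [← h]
    exact integral_nonneg fun y => inner_self_nonneg
  add_left s t u := by
    rw [← integral_add (s.mem.integrable_inner u.mem) (t.mem.integrable_inner u.mem)]
    exact integral_congr_ae (Eventually.of_forall fun y => inner_add_left _ _ _)
  smul_left s t c := by
    rw [← integral_const_mul]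
    exact integral_congr_ae (Eventually.of_forall fun y => inner_smul_left _ _ _)

noncomputable instance : SeminormedAddCommGroup (PreL2 F E p μ) :=
  @InnerProductSpace.Core.toSeminormedAddCommGroup ℂ _ _ _ _ (preL2Core F E p μ)

noncomputable instance : InnerProductSpace ℂ (PreL2 F E p μ) :=
  InnerProductSpace.ofCore (preL2Core F E p μ)

/-- The Hilbert space `L²(M; p^*E)`: square-integrable sections of `p^*E` up to equality almost
everywhere, with inner product `∫ ⟨s y, t y⟩ dμ`. -/
abbrev L2 : Type _ := SeparationQuotient (PreL2 F E p μ)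

variable {F E p μ}

lemma PreL2.inner_def (s t : PreL2 F E p μ) :
    inner ℂ s t = ∫ y, inner ℂ (s.sec y) (t.sec y) ∂μ := rfl

lemma PreL2.enorm_eq (s : PreL2 F E p μ) : ‖s‖ₑ = eLpNorm (fun y => ‖s.sec y‖) 2 μ := by
  have hm : MemLp (fun y => ‖s.sec y‖) 2 μ := s.mem.memLp_norm
  have h1 : ‖s‖ ^ 2 = ∫ y, ‖s.sec y‖ ^ 2 ∂μ := by
    rw [← inner_self_eq_norm_sq (𝕜 := ℂ), PreL2.inner_def,
      ← integral_re (s.mem.integrable_inner s.mem)]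
    exact integral_congr_ae (Eventually.of_forall fun y => inner_self_eq_norm_sq _)
  have h2 : ‖s‖ = (eLpNorm (fun y => ‖s.sec y‖) 2 μ).toReal := by
    rw [hm.eLpNorm_eq_integral_rpow_norm (by simp) (by simp), ENNReal.toReal_ofReal (by positivity)]
    rw [← Real.sqrt_sq (norm_nonneg s), h1, Real.sqrt_eq_rpow]
    simp
  rw [← ofReal_norm, h2, ENNReal.ofReal_toReal hm.2.ne]

/-- The elements of `L²` are exactly the classes for equality almost everywhere. -/
lemma PreL2.inseparable_iff {s t : PreL2 F E p μ} :
    Inseparable s t ↔ ∀ᵐ y ∂μ, s.sec y = t.sec y := by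
  have hm : MemLp (fun y => ‖(s - t).sec y‖) 2 μ := (s - t).mem.memLp_norm
  have h1 : ‖s - t‖ = 0 ↔ ‖s - t‖ₑ = 0 := by
    rw [← ofReal_norm, ENNReal.ofReal_eq_zero]
    exact ⟨fun h => h.le, fun h => le_antisymm h (norm_nonneg _)⟩
  rw [Metric.inseparable_iff, dist_eq_norm, h1, PreL2.enorm_eq,
    eLpNorm_eq_zero_iff hm.1 (by simp)]
  refine eventually_congr (Eventually.of_forall fun y => ?_)
  simp [sub_eq_zero]

lemma PreL2.enorm_eq' (s : PreL2 F E p μ) :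
    ‖s‖ₑ = (∫⁻ y, ‖s.sec y‖ₑ ^ (2 : ℝ) ∂μ) ^ (1 / 2 : ℝ) := by
  rw [PreL2.enorm_eq, eLpNorm_eq_lintegral_rpow_enorm_toReal (by simp) (by simp)]
  simp

/-- The Riesz-Fischer theorem. -/
instance : CompleteSpace (L2 F E p μ) := by
  refine NormedAddCommGroup.completeSpace_of_summable_imp_tendsto fun u hu => ?_
  obtain ⟨s, rfl⟩ : ∃ s : ℕ → PreL2 F E p μ, (fun i => SeparationQuotient.mk (s i)) = u :=
    ⟨fun i => (SeparationQuotient.surjective_mk (u i)).choose,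
      funext fun i => (SeparationQuotient.surjective_mk (u i)).choose_spec⟩
  simp only [SeparationQuotient.norm_mk] at hu
  have hfd : ∀ x : N, CompleteSpace (E x) := fun x => by
    have e := (trivializationAt F E x).continuousLinearEquivAt ℂ x
      (FiberBundle.mem_baseSet_trivializationAt' x)
    have : FiniteDimensional ℂ (E x) := e.symm.toLinearEquiv.finiteDimensional
    exact FiniteDimensional.complete ℂ (E x)
  have hsum : ∑' i, ‖s i‖ₑ ≠ ⊤ := by
    have := hu.tsum_ofReal_ne_top
    simpa only [ofReal_norm] using this
  have hm : ∀ i, AEMeasurable (fun y => ‖(s i).sec y‖ₑ) μ := fun i => by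
    simpa using (s i).mem.1.norm.enorm
  have hae : ∀ᵐ y ∂μ, Summable fun i => ‖(s i).sec y‖ := by
    have h1 := eLpNorm_tsum_le (μ := μ) hm
    simp only [← PreL2.enorm_eq'] at h1
    have h2 : ∫⁻ y, (∑' i, ‖(s i).sec y‖ₑ) ^ (2 : ℝ) ∂μ ≠ ⊤ := by
      intro h
      rw [h] at h1
      exact hsum (top_le_iff.1 (by simpa using h1))
    filter_upwards [ae_lt_top' ((AEMeasurable.tsum hm).pow_const _) h2] with y hy
    have h3 : ∑' i, ‖(s i).sec y‖ₑ ≠ ⊤ := by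
      intro h
      simp [h] at hy
    have h4 := ENNReal.summable_toReal h3
    simpa using h4
  let S : ∀ y : M, E (p y) := fun y => ∑' i, (s i).sec y
  have hlim : ∀ᵐ y ∂μ, Tendsto (fun k => ∑ i ∈ Finset.range k, (s i).sec y) atTop (𝓝 (S y)) := by
    filter_upwards [hae] with y hy
    exact (Summable.of_norm hy).hasSum.tendsto_sum_nat
  have hSm : AEMeasurableSection F E p μ S := fun x₀ => by
    refine aestronglyMeasurable_of_tendsto_ae atTop
      (fun k => (∑ i ∈ Finset.range k, s i).mem.1 x₀) ?_
    filter_upwards [hlim] with y hy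
    simp only [PreL2.sec_sum]
    exact (((trivializationAt F E x₀).continuousLinearMapAt ℂ (p y)).continuous.tendsto _).comp hy
  have htail : ∀ k, (∫⁻ y, ‖S y - (∑ i ∈ Finset.range k, s i).sec y‖ₑ ^ (2 : ℝ) ∂μ) ^ (1 / 2 : ℝ)
      ≤ ∑' i, ‖s (i + k)‖ₑ := by
    intro k
    have h1 := eLpNorm_tsum_le (μ := μ) fun i => hm (i + k)
    simp only [← PreL2.enorm_eq'] at h1
    refine le_trans ?_ h1
    gcongr ?_ ^ _
    refine lintegral_mono_ae ?_
    filter_upwards [hae] with y hy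
    gcongr
    rw [PreL2.sec_sum]
    have h2 := (Summable.of_norm hy).sum_add_tsum_nat_add k
    have h3 : S y - ∑ i ∈ Finset.range k, (s i).sec y = ∑' i, (s (i + k)).sec y := by
      rw [sub_eq_iff_eq_add', h2]
    rw [h3]
    exact enorm_tsum_le_tsum_enorm
  have hS : MemL2 F E p μ S := by
    refine ⟨hSm, ?_⟩
    have h0 := htail 0
    simp only [Finset.range_zero, Finset.sum_empty, add_zero] at h0
    have h1 := h0.trans_lt hsum.lt_top
    have h2 : ∫⁻ y, ‖S y‖ₑ ^ (2 : ℝ) ∂μ < ⊤ := by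
      by_contra hcon
      rw [not_lt, top_le_iff] at hcon
      have h4 : (∫⁻ y, ‖S y - (0 : PreL2 F E p μ).sec y‖ₑ ^ (2 : ℝ) ∂μ) = ⊤ := by
        rw [← hcon]
        exact lintegral_congr fun y => by rw [show (0 : PreL2 F E p μ).sec y = 0 from rfl, sub_zero]
      rw [h4] at h1
      simp at h1
    simpa using h2
  refine ⟨SeparationQuotient.mk (PreL2.mk S hS), ?_⟩
  rw [tendsto_iff_edist_tendsto_0]
  have hz : Tendsto (fun k => ∑' i, ‖s (i + k)‖ₑ) atTop (𝓝 0) :=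
    ENNReal.tendsto_sum_nat_add _ hsum
  refine tendsto_of_tendsto_of_tendsto_of_le_of_le tendsto_const_nhds hz (fun _ => zero_le)
    fun k => ?_
  have hmk : ∑ i ∈ Finset.range k, (SeparationQuotient.mk (s i) : L2 F E p μ)
      = SeparationQuotient.mk (∑ i ∈ Finset.range k, s i) :=
    (map_sum (SeparationQuotient.mkCLM ℂ (PreL2 F E p μ)) _ _).symm
  rw [hmk, edist_comm, SeparationQuotient.edist_mk, edist_eq_enorm_sub, PreL2.enorm_eq']
  exact htail k

/-- A representative of an element of `L²(M; p^*E)`. -/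
noncomputable def L2.rep (u : L2 F E p μ) : ∀ y : M, E (p y) :=
  (SeparationQuotient.surjective_mk u).choose.sec

open Classical in
/-- The class in `L²(M; p^*E)` of a square-integrable section (and `0` for any other section). -/
noncomputable def toL2 (s : ∀ y : M, E (p y)) : L2 F E p μ :=
  if hs : MemL2 F E p μ s then SeparationQuotient.mk (PreL2.mk s hs) else 0

lemma L2.memL2_rep (u : L2 F E p μ) : MemL2 F E p μ u.rep := PreL2.mem _

lemma toL2_rep (u : L2 F E p μ) : toL2 u.rep = u := by
  rw [toL2, dif_pos u.memL2_rep]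
  exact (SeparationQuotient.surjective_mk u).choose_spec

lemma rep_toL2 {s : ∀ y : M, E (p y)} (hs : MemL2 F E p μ s) :
    ∀ᵐ y ∂μ, (toL2 s : L2 F E p μ).rep y = s y := by
  have h : SeparationQuotient.mk (SeparationQuotient.surjective_mk (toL2 s : L2 F E p μ)).choose
      = SeparationQuotient.mk (PreL2.mk s hs) := by
    rw [(SeparationQuotient.surjective_mk (toL2 s : L2 F E p μ)).choose_spec, toL2, dif_pos hs]
  exact PreL2.inseparable_iff.1 (SeparationQuotient.mk_eq_mk.1 h)

/-- Multiplication by `f ∈ C₀(M)` on square-integrable sections. -/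
noncomputable def preMulC0 (f : ZeroAtInftyContinuousMap M ℂ) : PreL2 F E p μ →L[ℂ] PreL2 F E p μ :=
  LinearMap.mkContinuous
    { toFun := fun s => PreL2.mk (fun y => f y • s.sec y)
        (s.mem.smul (map_continuous f).aestronglyMeasurable fun y => f.toBCF.norm_coe_le_norm y)
      map_add' := fun s t => Subtype.ext (funext fun y => smul_add (f y) (s.sec y) (t.sec y))
      map_smul' := fun c s => Subtype.ext (funext fun y => smul_comm (f y) c (s.sec y)) }
    ‖f‖ (fun s => by
      have h : eLpNorm (fun y => ‖f y • s.sec y‖) 2 μ ≤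
          ENNReal.ofReal ‖f‖ * eLpNorm (fun y => ‖s.sec y‖) 2 μ :=
        eLpNorm_le_mul_eLpNorm_of_ae_le_mul (Eventually.of_forall fun y => by
          rw [norm_norm, norm_norm, norm_smul]
          exact mul_le_mul_of_nonneg_right (f.toBCF.norm_coe_le_norm y) (norm_nonneg _)) 2
      have h1 := PreL2.enorm_eq s
      rw [← h1] at h
      have h2 := PreL2.enorm_eq (PreL2.mk (fun y => f y • s.sec y)
        (s.mem.smul (map_continuous f).aestronglyMeasurable fun y => f.toBCF.norm_coe_le_norm y))
      simp only [PreL2.sec_mk] at h2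
      rw [← h2, ← ofReal_norm, ← ofReal_norm, ← ENNReal.ofReal_mul (norm_nonneg _)] at h
      exact (ENNReal.ofReal_le_ofReal_iff (by positivity)).1 h)

/-- The representation of `C₀(M)` on `L²(M; p^*E)` by pointwise multiplication. -/
noncomputable def mulC0 (f : ZeroAtInftyContinuousMap M ℂ) : L2 F E p μ →L[ℂ] L2 F E p μ :=
  SeparationQuotient.liftCLM ((SeparationQuotient.mkCLM ℂ (PreL2 F E p μ)).comp (preMulC0 f))
    fun _ _ h => SeparationQuotient.mk_eq_mk.2 (h.map (preMulC0 f).continuous)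

/-- The support of a bounded operator `T` on `L²(M; p^*E)`: the complement of the set of all
`(y, y')` such that `f₁ T f₂ = 0` for some `f₁, f₂ ∈ C₀(M)` with `f₁ y ≠ 0` and `f₂ y' ≠ 0`. -/
def opSupport (T : L2 F E p μ →L[ℂ] L2 F E p μ) : Set (M × M) :=
  {z | ∃ f₁ f₂ : ZeroAtInftyContinuousMap M ℂ, f₁ z.1 ≠ 0 ∧ f₂ z.2 ≠ 0 ∧
    (mulC0 f₁).comp (T.comp (mulC0 f₂)) = 0}ᶜ

/-- The propagation of `T`: the supremum of the Riemannian distance over the support of `T`. -/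
noncomputable def propagation (n : ℕ) [ChartedSpace (EuclideanSpace ℝ (Fin n)) M]
    [RiemannianBundle (fun y : M => TangentSpace (𝓡 n) y)]
    (T : L2 F E p μ →L[ℂ] L2 F E p μ) : ENNReal :=
  ⨆ z ∈ opSupport T, Manifold.riemannianEDist (𝓡 n) z.1 z.2

end L2

/-! ### Deck transformations -/

/-- The identification `E_x = E_{x'}` for `x = x'`. -/
def fiberCast {N : Type*} {E : N → Type*} {x x' : N} (h : x = x') (v : E x) : E x' := h ▸ v

/-- The section `g • s` of `p^*E`, `(g • s)(y) = g (s (g⁻¹ y))`, where the action of `Γ` on `p^*E`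
is `g (y, e) = (g y, e)` for `e ∈ E (p y) = E (p (g y))`. -/
def translate {N M Γ : Type*} {E : N → Type*} [Group Γ] [MulAction Γ M] {p : M → N}
    (hp : ∀ (g : Γ) (y : M), p (g • y) = p y) (g : Γ) (s : ∀ y : M, E (p y)) :
    ∀ y : M, E (p y) :=
  fun y => fiberCast (hp g⁻¹ y) (s (g⁻¹ • y))

/-- `p : M → N` is a Galois covering with deck transformation group `Γ`, and the Riemannian metric
of `M` is the lift of that of `N`. -/
structure IsRiemannianGaloisCover (n : ℕ) (Γ : Type*) {M N : Type*} [Group Γ] [MulAction Γ M]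
    [TopologicalSpace M] [ChartedSpace (EuclideanSpace ℝ (Fin n)) M]
    [RiemannianBundle (fun y : M => TangentSpace (𝓡 n) y)]
    [TopologicalSpace N] [ChartedSpace (EuclideanSpace ℝ (Fin n)) N]
    [RiemannianBundle (fun x : N => TangentSpace (𝓡 n) x)] (p : C(M, N)) : Prop where
  isCoveringMap : IsCoveringMap p
  surjective : Function.Surjective p
  contMDiff : ContMDiff (𝓡 n) (𝓡 n) ∞ p
  inner_mfderiv : ∀ (y : M) (v w : TangentSpace (𝓡 n) y),
    inner ℝ (mfderiv (𝓡 n) (𝓡 n) p y v) (mfderiv (𝓡 n) (𝓡 n) p y w) = inner ℝ v w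
  continuous_smul : ∀ g : Γ, Continuous fun y : M => g • y
  /-- `Γ` acts by deck transformations. -/
  map_smul : ∀ (g : Γ) (y : M), p (g • y) = p y
  /-- `Γ` acts transitively on the fibers. -/
  exists_smul_eq : ∀ y y' : M, p y = p y' → ∃ g : Γ, g • y = y'
  /-- `Γ` acts freely. -/
  free : ∀ (g : Γ) (y : M), g • y = y → g = 1

/-- The bounded operator `T` on `L²(M; p^*E)` is `Γ`-equivariant: `T (g • u) = g • T u`. -/
def IsEquivariant {N : Type*} [TopologicalSpace N] {F : Type*} [NormedAddCommGroup F]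
    [NormedSpace ℂ F] {E : N → Type*} [TopologicalSpace (TotalSpace F E)]
    [∀ x, NormedAddCommGroup (E x)] [∀ x, InnerProductSpace ℂ (E x)] [FiberBundle F E]
    [VectorBundle ℂ F E] {M : Type*} [TopologicalSpace M] [MeasurableSpace M] {p : C(M, N)}
    {μ : Measure M} [FiniteDimensional ℂ F] [ContinuousHermitianBundle F E] [CompactSpace N]
    [BorelSpace M] {Γ : Type*} [Group Γ] [MulAction Γ M]
    (hp : ∀ (g : Γ) (y : M), p (g • y) = p y) (T : L2 F E p μ →L[ℂ] L2 F E p μ) : Prop :=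
  ∀ (g : Γ) (u v : L2 F E p μ), (∀ᵐ y ∂μ, v.rep y = translate hp g u.rep y) →
    ∀ᵐ y ∂μ, (T v).rep y = translate hp g (T u).rep y

/-! ### The folding map -/

/-- An open cover `U i` of `N` by evenly covered sets, with a subordinate partition of unity
`φ i`, and a lift `lift i` of each `U i` to `M₁`, i.e. an open set which `p₁` maps bijectively
(hence homeomorphically, `p₁` being a covering map) onto `U i`. -/
structure LiftedPartition {M₁ N : Type*} [TopologicalSpace M₁] [TopologicalSpace N]
    (p₁ : C(M₁, N)) (ι : Type) where
  U : ι → Set N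
  isOpen_U : ∀ i, IsOpen (U i)
  iUnion_U : ⋃ i, U i = univ
  φ : PartitionOfUnity ι N
  isSubordinate : φ.IsSubordinate U
  lift : ι → Set M₁
  isOpen_lift : ∀ i, IsOpen (lift i)
  bijOn : ∀ i, BijOn p₁ (lift i) (U i)

namespace LiftedPartition

variable {M₁ M₂ N Γ₁ : Type*} [TopologicalSpace M₁] [TopologicalSpace M₂] [TopologicalSpace N]
  [Group Γ₁] [MulAction Γ₁ M₁] {p₁ : C(M₁, N)} {ι : Type}
  (P : LiftedPartition p₁ ι)

/-- The translate `U_i^g` of the lift of `U i` to `M₁`. -/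
def sheet (g : Γ₁) (i : ι) : Set M₁ := (fun y => g • y) '' P.lift i

/-- The function `φ_i^g` on `M₁`: the `g`-translate of the lift of `φ i` to `lift i`. -/
noncomputable def φ₁ (g : Γ₁) (i : ι) (y : M₁) : ℝ :=
  (P.lift i).indicator (fun y => P.φ i (p₁ y)) (g⁻¹ • y)

/-- The set `U_i^[g]` in `M₂`, the image of `U_i^g`. -/
def sheet₂ (ϖ : C(M₁, M₂)) (g : Γ₁) (i : ι) : Set M₂ := ϖ '' P.sheet g i

/-- The function `φ_i^[g]` on `M₂`: the lift of `φ i` to `U_i^[g]`. -/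
noncomputable def φ₂ (p₂ : C(M₂, N)) (ϖ : C(M₁, M₂)) (g : Γ₁) (i : ι) : M₂ → ℝ :=
  (P.sheet₂ ϖ g i).indicator fun x => P.φ i (p₂ x)

end LiftedPartition

section Transfer

variable {M₁ M₂ N : Type*} {E : N → Type*} [∀ x, NormedAddCommGroup (E x)] {p₁ : M₁ → N}
  {p₂ : M₂ → N} {ϖ : M₁ → M₂} (hϖ : ∀ y, p₂ (ϖ y) = p₁ y) (V : Set M₁)

open Classical in
/-- For `V` mapped bijectively onto `ϖ(V)`, the local section over `V` of the bundle on `M₁` that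
corresponds to the section `u` over `ϖ(V)` of the bundle on `M₂`, extended by zero. -/
noncomputable def pullSection (u : ∀ x : M₂, E (p₂ x)) : ∀ y : M₁, E (p₁ y) :=
  fun y => if y ∈ V then fiberCast (hϖ y) (u (ϖ y)) else 0

open Classical in
/-- For `V` mapped bijectively onto `ϖ(V)`, the local section over `ϖ(V)` of the bundle on `M₂`
that corresponds to the section `v` over `V` of the bundle on `M₁`, extended by zero. -/
noncomputable def pushSection (v : ∀ y : M₁, E (p₁ y)) : ∀ x : M₂, E (p₂ x) :=
  fun x => if h : ∃ y ∈ V, ϖ y = x then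
    fiberCast ((hϖ h.choose).symm.trans (congrArg p₂ h.choose_spec.2)) (v h.choose) else 0

end Transfer

section FoldingMap

variable {N : Type*} [TopologicalSpace N] {F : Type*} [NormedAddCommGroup F]
  [NormedSpace ℂ F] {E : N → Type*} [TopologicalSpace (TotalSpace F E)]
  [∀ x, NormedAddCommGroup (E x)] [∀ x, InnerProductSpace ℂ (E x)] [FiberBundle F E]
  [VectorBundle ℂ F E] [FiniteDimensional ℂ F] [ContinuousHermitianBundle F E] [CompactSpace N]
  {M₁ : Type*} [TopologicalSpace M₁] [MeasurableSpace M₁] [BorelSpace M₁]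
  {M₂ : Type*} [TopologicalSpace M₂] [MeasurableSpace M₂] [BorelSpace M₂]
  {p₁ : C(M₁, N)} {p₂ : C(M₂, N)} {μ₁ : Measure M₁} {μ₂ : Measure M₂}
  {ϖ : C(M₁, M₂)} (hϖ : ∀ y, p₂ (ϖ y) = p₁ y)
  {Γ₁ : Type*} [Group Γ₁] [MulAction Γ₁ M₁] {ι : Type} (P : LiftedPartition p₁ ι)

/-- The section `(ϖ|_{U_j^s})^* (φ_j^[s] u)` of the bundle on `M₁`. -/
noncomputable def pulledPiece (s : Γ₁) (j : ι) (u : ∀ x : M₂, E (p₂ x)) : ∀ y : M₁, E (p₁ y) :=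
  pullSection hϖ (P.sheet s j) fun x => (P.φ₂ p₂ ϖ s j x : ℂ) • u x

/-- The section `ϖ_* (φ_i^g v)` of the bundle on `M₂`. -/
noncomputable def pushedPiece (g : Γ₁) (i : ι) (v : ∀ y : M₁, E (p₁ y)) : ∀ x : M₂, E (p₂ x) :=
  pushSection hϖ (P.sheet g i) fun y => (P.φ₁ g i y : ℂ) • v y

/-- The term `ϖ_* (φ_i^g · T (ϖ|_{U_j^s}^* (φ_j^[s] u)))` of the sum defining the folding map. -/
noncomputable def foldingTerm (T : L2 F E p₁ μ₁ →L[ℂ] L2 F E p₁ μ₁) (u : L2 F E p₂ μ₂)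
    (g s : Γ₁) (i j : ι) : L2 F E p₂ μ₂ :=
  toL2 (pushedPiece hϖ P g i (T (toL2 (pulledPiece hϖ P s j u.rep))).rep)

end FoldingMap

end Folding

open Folding

set_option linter.unusedSectionVars false

/-! A bounded Borel section `τ` of `p₁` cuts `M₁` into tiles `g • τ(N)`, one for each `g` in `Γ₁`.
In the same way `ϖ ∘ τ` cuts `M₂` into tiles indexed by `Γ₂`, and `ϖ` carries the tile of `g` to the
tile of its class `q g`. The covers are local isometries, so every tile is a copy of `N` as a
measure space. Hence `L²(E₁)` and `L²(E₂)` are orthogonal sums of copies of `L²(N; E)` which the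
groups permute (`IsSectionSystem.isFrame`).

In these coordinates an operator is a matrix of bounded operators on `L²(N; E)`, and equivariance
makes the entry `(t * k, t)` depend on `k` only. As `N` is compact, the tiles are relatively compact
and bounded neighbourhoods of compact sets are relatively compact, so finite propagation forces all
but finitely many `k` to give zero (`IsLocalBy.isBanded`). Such a `T` preserves the finitely
supported vectors, on which the map `push` that identifies the summand `a` with the summand `q a`
makes sense. The operator `Ψ(T)` is the unique bounded `X` with `X ∘ push = push ∘ T`; its entries
are sums of entries of `T` over cosets of the kernel. Multiplicativity is then immediate,
compatibility with adjoints comes from inverting the summation index in the kernel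
(`IsFold.adjoint`), and finite propagation survives because `ϖ` does not increase distances
(`IsFold.isLocalBy`).

It remains to see that the formula with the partition of unity computes `X`. Multiplication by the
sum of the `φ_i^g` over `i` is diagonal for the tiling, equivariant in `g`, meets finitely many
tiles, and sums to the identity over `g` (`isCutoff_mulφ`). After the substitution `g = s * k` only
finitely many `k` contribute, and for each of them the sum over `s` is an orthogonal sum controlled
by Bessel's inequality. Its value is read off on a single summand (`IsFold.hasSum_foldPiece`). Since
`X` is defined without the cover, the partition, the lifts or `S`, independence of these choices
comes for free. -/

namespace Folding

/-! ### Orthogonal decompositions permuted by a group -/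

section Frames

variable {Γ H₀ H : Type*} [Group Γ] [NormedAddCommGroup H₀] [InnerProductSpace ℂ H₀]
  [NormedAddCommGroup H] [InnerProductSpace ℂ H]

/-- A Hilbert space `H` with a family of operators `U g`, decomposed as an orthogonal sum of copies
of `H₀` which are permuted by the `U g`; `i g` is the inclusion of the copy with index `g`,
and `κ g` is the adjoint projection. -/
structure IsFrame (U : Γ → H →L[ℂ] H) (i : Γ → H₀ →L[ℂ] H) (κ : Γ → H →L[ℂ] H₀) : Prop where
  inner_left : ∀ g f v, inner ℂ (i g f) v = inner ℂ f (κ g v)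
  proj_self : ∀ g f, κ g (i g f) = f
  proj_of_ne : ∀ g k f, g ≠ k → κ g (i k f) = 0
  total : ∀ v, (∀ g, κ g v = 0) → v = 0
  translate_incl : ∀ g k f, U g (i k f) = i (g * k) f
  proj_translate : ∀ g k v, κ (g * k) (U g v) = κ k v

namespace IsFrame

variable {U : Γ → H →L[ℂ] H} {i : Γ → H₀ →L[ℂ] H} {κ : Γ → H →L[ℂ] H₀} (h : IsFrame U i κ)
include h

lemma inner_incl (g : Γ) (f f' : H₀) : inner ℂ (i g f) (i g f') = inner ℂ f f' := by
  rw [h.inner_left, h.proj_self]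

/-- The inclusion of a summand as a linear isometry. -/
noncomputable def isometry (g : Γ) : H₀ →ₗᵢ[ℂ] H where
  toLinearMap := i g
  norm_map' f := by
    have := h.inner_incl g f f
    rw [inner_self_eq_norm_sq_to_K, inner_self_eq_norm_sq_to_K] at this
    have h2 : ‖i g f‖ ^ 2 = ‖f‖ ^ 2 := by exact_mod_cast this
    exact (sq_eq_sq₀ (norm_nonneg _) (norm_nonneg _)).1 h2

@[simp] lemma isometry_apply (g : Γ) (f : H₀) : h.isometry g f = i g f := rfl

lemma orthogonalFamily : OrthogonalFamily ℂ (fun _ : Γ => H₀) h.isometry := by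
  intro g k hgk f f'
  simp only [isometry_apply]
  rw [h.inner_left, h.proj_of_ne g k f' hgk, inner_zero_right]

/-- The partial sum `w` of the components of `v` satisfies `‖w‖ ^ 2 = ⟨w, v⟩`, and both equal the
left-hand side; Cauchy-Schwarz then gives `‖w‖ ≤ ‖v‖`. -/
lemma bessel (F : Finset Γ) (v : H) : ∑ g ∈ F, ‖κ g v‖ ^ 2 ≤ ‖v‖ ^ 2 := by
  set w := ∑ g ∈ F, i g (κ g v) with hw
  have h1 : ‖w‖ ^ 2 = ∑ g ∈ F, ‖κ g v‖ ^ 2 :=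
    h.orthogonalFamily.norm_sum (fun g => κ g v) F
  have h2 : inner ℂ w v = ((∑ g ∈ F, ‖κ g v‖ ^ 2 : ℝ) : ℂ) := by
    rw [hw, sum_inner]
    push_cast
    refine Finset.sum_congr rfl fun g _ => ?_
    rw [h.inner_left, inner_self_eq_norm_sq_to_K]
    rfl
  have h3 : ‖w‖ ^ 2 ≤ ‖w‖ * ‖v‖ := by
    have := norm_inner_le_norm (𝕜 := ℂ) w v
    rw [h2, ← h1] at this
    simpa using this
  rw [← h1]
  have h4 : ‖w‖ ≤ ‖v‖ := by
    rcases (norm_nonneg w).eq_or_lt with h0 | h0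
    · rw [← h0]; exact norm_nonneg v
    · rw [sq] at h3
      exact le_of_mul_le_mul_left h3 h0
  gcongr

/-- The sum over `s` of the operators from the summand `j' s` to the summand `j s` given by `c s`
converges strongly. -/
lemma exists_hasSum [CompleteSpace H] {S : Type*} {j j' : S → Γ} (hj : Function.Injective j)
    (hj' : Function.Injective j') (c : S → H₀ →L[ℂ] H₀) (C : ℝ) (hc : ∀ s, ‖c s‖ ≤ C) :
    ∃ X : H →L[ℂ] H, ∀ u, HasSum (fun s => i (j s) (c s (κ (j' s) u))) (X u) := by
  -- Injectivity of `j` makes the terms mutually orthogonal, so summability is summability of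
  -- squared norms; injectivity of `j'` lets Bessel's inequality bound these.
  have hof := h.orthogonalFamily.comp hj
  have key : ∀ (F : Finset S) (u : H), ∑ s ∈ F, ‖c s (κ (j' s) u)‖ ^ 2 ≤ (C * ‖u‖) ^ 2 := by
    intro F u
    calc ∑ s ∈ F, ‖c s (κ (j' s) u)‖ ^ 2 ≤ ∑ s ∈ F, C ^ 2 * ‖κ (j' s) u‖ ^ 2 := by
          refine Finset.sum_le_sum fun s _ => ?_
          rw [← mul_pow]
          gcongr
          exact (c s).le_of_opNorm_le (hc s) _
      _ = C ^ 2 * ∑ g ∈ F.map ⟨j', hj'⟩, ‖κ g u‖ ^ 2 := by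
          rw [Finset.mul_sum, Finset.sum_map]; rfl
      _ ≤ C ^ 2 * ‖u‖ ^ 2 := by gcongr; exact h.bessel _ u
      _ = _ := by ring
  have hsum : ∀ u, Summable fun s => i (j s) (c s (κ (j' s) u)) := fun u => by
    refine (hof.summable_iff_norm_sq_summable fun s => c s (κ (j' s) u)).2 ?_
    exact summable_of_sum_le (fun _ => by positivity) fun F => key F u
  -- The absolute value is needed because `C` may be negative when `S` is empty.
  have hbound : ∀ u, ‖∑' s, i (j s) (c s (κ (j' s) u))‖ ≤ |C| * ‖u‖ := fun u => by
    refine le_of_tendsto (hsum u).hasSum.norm (Eventually.of_forall fun F => ?_)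
    refine (sq_le_sq₀ (norm_nonneg _) (by positivity)).1 ?_
    have h1 : ‖∑ s ∈ F, i (j s) (c s (κ (j' s) u))‖ ^ 2 = ∑ s ∈ F, ‖c s (κ (j' s) u)‖ ^ 2 :=
      hof.norm_sum (fun s => c s (κ (j' s) u)) F
    rw [h1, mul_pow, sq_abs, ← mul_pow]
    exact key F u
  refine ⟨LinearMap.mkContinuous
    { toFun := fun u => ∑' s, i (j s) (c s (κ (j' s) u))
      map_add' := fun u v => ?_
      map_smul' := fun a u => ?_ } |C| hbound, fun u => (hsum u).hasSum⟩
  · simp only [map_add]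
    exact (hsum u).tsum_add (hsum v)
  · simp only [map_smul]
    exact (hsum u).tsum_const_smul a

/-- The series converges to some `X u` with the same components as `u`, and totality of the
projections identifies the two. -/
lemma hasSum_incl_proj [CompleteSpace H] (u : H) : HasSum (fun g => i g (κ g u)) u := by
  obtain ⟨X, hX⟩ := h.exists_hasSum (j := id) (j' := id) Function.injective_id
    Function.injective_id (fun _ => ContinuousLinearMap.id ℂ H₀) 1
    fun _ => ContinuousLinearMap.norm_id_le
  have h1 : X u = u := by
    rw [← sub_eq_zero]
    refine h.total _ fun g => ?_
    have h2 := (hX u).mapL (κ g)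
    rw [map_sub, sub_eq_zero]
    refine h2.unique ?_
    convert hasSum_single g fun k hk => ?_ using 1
    · simp [h.proj_self]
    · simp [h.proj_of_ne g k _ (Ne.symm hk)]
  have h2 := hX u
  rw [h1] at h2
  exact h2

lemma ext_incl [CompleteSpace H] {E : Type*} [NormedAddCommGroup E] [NormedSpace ℂ E]
    {X Y : H →L[ℂ] E} (hXY : ∀ g f, X (i g f) = Y (i g f)) : X = Y := by
  ext u
  have h1 := (h.hasSum_incl_proj u).mapL X
  have h2 := (h.hasSum_incl_proj u).mapL Y
  simp only [hXY] at h1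
  exact h1.unique h2

lemma eq_finset_sum [CompleteSpace H] {v : H} {F : Finset Γ} (hF : ∀ g ∉ F, κ g v = 0) :
    v = ∑ g ∈ F, i g (κ g v) := by
  refine (h.hasSum_incl_proj v).unique (hasSum_sum_of_ne_finset_zero fun g hg => ?_)
  rw [hF g hg, map_zero]

end IsFrame

end Frames

/-- `T` commutes with the operators `U g`. -/
def CommutesWith {Γ H : Type*} [NormedAddCommGroup H] [InnerProductSpace ℂ H]
    (U : Γ → H →L[ℂ] H) (T : H →L[ℂ] H) : Prop := ∀ g v, T (U g v) = U g (T v)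

/-- Only finitely many coefficients of `T` starting at the summand with index `1` are nonzero. -/
def IsBanded {Γ H₀ H : Type*} [Group Γ] [NormedAddCommGroup H₀] [InnerProductSpace ℂ H₀]
    [NormedAddCommGroup H] [InnerProductSpace ℂ H] (i : Γ → H₀ →L[ℂ] H) (κ : Γ → H →L[ℂ] H₀)
    (T : H →L[ℂ] H) : Prop := {g : Γ | ∃ f, κ g (T (i 1 f)) ≠ 0}.Finite

/-! ### Pushing finitely supported vectors and banded operators forward along `q` -/

section Push

variable {Γ₁ Γ₂ H₀ H₁ H₂ : Type*} [Group Γ₁] [Group Γ₂]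
  [NormedAddCommGroup H₀] [InnerProductSpace ℂ H₀]
  [NormedAddCommGroup H₁] [InnerProductSpace ℂ H₁]
  [NormedAddCommGroup H₂] [InnerProductSpace ℂ H₂]
  {U₁ : Γ₁ → H₁ →L[ℂ] H₁} {i₁ : Γ₁ → H₀ →L[ℂ] H₁} {κ₁ : Γ₁ → H₁ →L[ℂ] H₀}
  {U₂ : Γ₂ → H₂ →L[ℂ] H₂} {i₂ : Γ₂ → H₀ →L[ℂ] H₂} {κ₂ : Γ₂ → H₂ →L[ℂ] H₀}

/-- Only finitely many components of `w` are nonzero. -/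
def FinSupported (κ₁ : Γ₁ → H₁ →L[ℂ] H₀) (w : H₁) : Prop := {a | κ₁ a w ≠ 0}.Finite

/-- The map from the finitely supported vectors of `H₁` to `H₂` which identifies the summand with
index `a` with the summand with index `q a`. -/
noncomputable def push (q : Γ₁ →* Γ₂) (κ₁ : Γ₁ → H₁ →L[ℂ] H₀) (i₂ : Γ₂ → H₀ →L[ℂ] H₂) (w : H₁) :
    H₂ := ∑ᶠ a, i₂ (q a) (κ₁ a w)

variable (q : Γ₁ →* Γ₂)

lemma push_eq_sum {w : H₁} {F : Finset Γ₁} (hF : ∀ a ∉ F, κ₁ a w = 0) :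
    push q κ₁ i₂ w = ∑ a ∈ F, i₂ (q a) (κ₁ a w) := by
  refine finsum_eq_sum_of_support_subset _ fun a ha => ?_
  by_contra hcon
  exact ha (by simp [hF a hcon])

lemma FinSupported.exists_finset {w : H₁} (hw : FinSupported κ₁ w) :
    ∃ F : Finset Γ₁, ∀ a ∉ F, κ₁ a w = 0 :=
  ⟨hw.toFinset, fun a ha => by
    by_contra hcon
    exact ha (hw.mem_toFinset.2 hcon)⟩

lemma FinSupported.add {v w : H₁} (hv : FinSupported κ₁ v) (hw : FinSupported κ₁ w) :
    FinSupported κ₁ (v + w) :=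
  (hv.union hw).subset fun a ha => by
    by_contra hcon
    simp only [mem_union, mem_ofPred_eq, not_or, not_not] at hcon
    exact ha (by simp [hcon.1, hcon.2])

lemma FinSupported.zero : FinSupported κ₁ (0 : H₁) := by
  simp [FinSupported]

lemma FinSupported.sum {S : Type*} {F : Finset S} {w : S → H₁}
    (hw : ∀ s ∈ F, FinSupported κ₁ (w s)) : FinSupported κ₁ (∑ s ∈ F, w s) := by
  classical
  induction F using Finset.induction_on with
  | empty => simpa using FinSupported.zero
  | insert a F ha ih =>
    rw [Finset.sum_insert ha]
    exact (hw a (by simp)).add (ih fun s hs => hw s (by simp [hs]))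

lemma push_add {v w : H₁} (hv : FinSupported κ₁ v) (hw : FinSupported κ₁ w) :
    push q κ₁ i₂ (v + w) = push q κ₁ i₂ v + push q κ₁ i₂ w := by
  simp only [push, map_add]
  refine finsum_add_distrib (hv.subset fun a ha => ?_) (hw.subset fun a ha => ?_) <;>
  · intro hcon
    exact ha (by simp [hcon])

lemma push_smul {v : H₁} (hv : FinSupported κ₁ v) (c : ℂ) :
    push q κ₁ i₂ (c • v) = c • push q κ₁ i₂ v := by
  obtain ⟨F, hF⟩ := hv.exists_finset
  rw [push_eq_sum q hF, push_eq_sum q (F := F) (by intro a ha; simp [hF a ha]), Finset.smul_sum]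
  simp

lemma push_zero : push q κ₁ i₂ (0 : H₁) = 0 := by simp [push]

lemma push_sum {S : Type*} {F : Finset S} {w : S → H₁}
    (hw : ∀ s ∈ F, FinSupported κ₁ (w s)) :
    push q κ₁ i₂ (∑ s ∈ F, w s) = ∑ s ∈ F, push q κ₁ i₂ (w s) := by
  classical
  induction F using Finset.induction_on with
  | empty => simpa using push_zero q
  | insert a F ha ih =>
    rw [Finset.sum_insert ha, Finset.sum_insert ha, push_add, ih fun s hs => hw s (by simp [hs])]
    · exact hw a (by simp)
    · exact FinSupported.sum fun s hs => hw s (by simp [hs])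

lemma IsFrame.finSupported_incl (h₁ : IsFrame U₁ i₁ κ₁) (t : Γ₁) (f : H₀) :
    FinSupported κ₁ (i₁ t f) :=
  (finite_singleton t).subset fun a ha => by
    by_contra hcon
    exact ha (h₁.proj_of_ne a t f hcon)

lemma IsFrame.push_incl (h₁ : IsFrame U₁ i₁ κ₁) (t : Γ₁) (f : H₀) :
    push q κ₁ i₂ (i₁ t f) = i₂ (q t) f := by
  rw [push_eq_sum q (F := {t}) fun a ha => h₁.proj_of_ne a t f (by simpa using ha)]
  simp [h₁.proj_self]

lemma IsFrame.finSupported_translate (h₁ : IsFrame U₁ i₁ κ₁) {w : H₁} (hw : FinSupported κ₁ w)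
    (g : Γ₁) : FinSupported κ₁ (U₁ g w) := by
  refine (hw.image (g * ·)).subset fun a ha => ⟨g⁻¹ * a, ?_, by simp⟩
  have := h₁.proj_translate g (g⁻¹ * a) w
  rw [mul_inv_cancel_left] at this
  rwa [mem_ofPred_eq, ← this]

lemma IsFrame.push_translate (h₁ : IsFrame U₁ i₁ κ₁) (h₂ : IsFrame U₂ i₂ κ₂) {w : H₁}
    (hw : FinSupported κ₁ w) (g : Γ₁) :
    push q κ₁ i₂ (U₁ g w) = U₂ (q g) (push q κ₁ i₂ w) := by
  have h3 : push q κ₁ i₂ (U₁ g w) = ∑ᶠ a, U₂ (q g) (i₂ (q a) (κ₁ a w)) := by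
    rw [push, ← finsum_comp_equiv (Equiv.mulLeft g)]
    refine finsum_congr fun a => ?_
    rw [Equiv.coe_mulLeft, h₁.proj_translate, h₂.translate_incl, map_mul]
  obtain ⟨F, hF⟩ := hw.exists_finset
  rw [h3, push_eq_sum q hF, map_sum]
  refine finsum_eq_sum_of_support_subset _ fun a ha => ?_
  by_contra hcon
  exact ha (by simp [hF a hcon])

variable [CompleteSpace H₁]

/-- A finitely supported vector is the finite sum of its components, so additive claims about such
vectors need only be checked on one summand. -/
lemma IsFrame.induction_finSupported (h₁ : IsFrame U₁ i₁ κ₁) {p : H₁ → Prop} {w : H₁}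
    (hw : FinSupported κ₁ w) (h0 : p 0) (hi : ∀ t f, p (i₁ t f))
    (hadd : ∀ v w, FinSupported κ₁ v → FinSupported κ₁ w → p v → p w → p (v + w)) : p w := by
  classical
  obtain ⟨F, hF⟩ := hw.exists_finset
  rw [h₁.eq_finset_sum hF]
  generalize κ₁ = k at *
  clear hF
  induction F using Finset.induction_on with
  | empty => simpa using h0
  | insert a F ha ih =>
    rw [Finset.sum_insert ha]
    exact hadd _ _ (h₁.finSupported_incl _ _)
      (FinSupported.sum fun s _ => h₁.finSupported_incl _ _) (hi _ _) ih

/-- By equivariance the column of `T` at `t` is the translate by `t` of the column at `1`, the only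
one that bandedness speaks of. -/
lemma IsBanded.finSupported (h₁ : IsFrame U₁ i₁ κ₁) {T : H₁ →L[ℂ] H₁} (hT : IsBanded i₁ κ₁ T)
    (hU : CommutesWith U₁ T) {w : H₁} (hw : FinSupported κ₁ w) : FinSupported κ₁ (T w) := by
  refine h₁.induction_finSupported (p := fun w => FinSupported κ₁ (T w)) hw ?_ (fun t f => ?_)
    fun v w _ _ hv hw => ?_
  · simpa using FinSupported.zero
  · have : i₁ t f = U₁ t (i₁ 1 f) := by rw [h₁.translate_incl, mul_one]
    simp only [this]
    rw [hU]
    exact h₁.finSupported_translate (hT.subset fun a ha => ⟨f, ha⟩) t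
  · simp only [map_add]
    exact hv.add hw

/-- The operator `X` on `H₂` is the push-forward of the operator `T` on `H₁`. -/
def IsFold (q : Γ₁ →* Γ₂) (i₁ : Γ₁ → H₀ →L[ℂ] H₁) (κ₁ : Γ₁ → H₁ →L[ℂ] H₀)
    (i₂ : Γ₂ → H₀ →L[ℂ] H₂) (T : H₁ →L[ℂ] H₁) (X : H₂ →L[ℂ] H₂) : Prop :=
  ∀ t f, X (i₂ (q t) f) = push q κ₁ i₂ (T (i₁ t f))

variable {q}

/-- This intertwining relation, extended from single summands by additivity, is what makes folding
multiplicative. -/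
lemma IsFold.apply_push {T : H₁ →L[ℂ] H₁} {X : H₂ →L[ℂ] H₂} (hX : IsFold q i₁ κ₁ i₂ T X)
    (h₁ : IsFrame U₁ i₁ κ₁) (hT : IsBanded i₁ κ₁ T) (hU : CommutesWith U₁ T) {w : H₁}
    (hw : FinSupported κ₁ w) : X (push q κ₁ i₂ w) = push q κ₁ i₂ (T w) := by
  refine h₁.induction_finSupported (p := fun w => X (push q κ₁ i₂ w) = push q κ₁ i₂ (T w)) hw ?_
    (fun t f => ?_) fun v w hv hw hpv hpw => ?_
  · simp [push_zero]
  · rw [h₁.push_incl, hX]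
  · rw [push_add q hv hw, map_add, map_add, hpv, hpw,
      push_add q (hT.finSupported h₁ hU hv) (hT.finSupported h₁ hU hw)]

variable [CompleteSpace H₂]

/-- The vectors `i₂ (q t) f` exhaust all summands of `H₂`. The algebraic identities for the folding
map are deduced from this uniqueness. -/
lemma IsFold.unique (h₂ : IsFrame U₂ i₂ κ₂) (hq : Function.Surjective q) {T : H₁ →L[ℂ] H₁}
    {X Y : H₂ →L[ℂ] H₂} (hX : IsFold q i₁ κ₁ i₂ T X) (hY : IsFold q i₁ κ₁ i₂ T Y) : X = Y := by
  refine h₂.ext_incl fun g f => ?_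
  obtain ⟨t, rfl⟩ := hq g
  rw [hX, hY]

/-- The entry of `T` from `t` to `t * k` does not depend on `t`. So `X` is a finite sum over the
band: the term of `k` sends each summand `γ` to `γ * q k` by the one operator `κ₁ k ∘ T ∘ i₁ 1`, and
it is bounded because right translation by `q k` is injective. -/
lemma IsBanded.exists_isFold (h₁ : IsFrame U₁ i₁ κ₁) (h₂ : IsFrame U₂ i₂ κ₂)
    {T : H₁ →L[ℂ] H₁} (hT : IsBanded i₁ κ₁ T) (hU : CommutesWith U₁ T) :
    ∃ X : H₂ →L[ℂ] H₂, IsFold q i₁ κ₁ i₂ T X := by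
  choose X hX using fun k : Γ₁ => h₂.exists_hasSum (j := fun γ => γ * q k) (j' := id)
    (mul_left_injective _) Function.injective_id
    (fun _ => (κ₁ k).comp (T.comp (i₁ 1))) _ fun _ => le_rfl
  refine ⟨∑ k ∈ hT.toFinset, X k, fun t f => ?_⟩
  have h3 : ∀ k, κ₁ (t * k) (T (i₁ t f)) = κ₁ k (T (i₁ 1 f)) := fun k => by
    have : i₁ t f = U₁ t (i₁ 1 f) := by rw [h₁.translate_incl, mul_one]
    rw [this, hU, h₁.proj_translate]
  have h4 : ∀ k, X k (i₂ (q t) f) = i₂ (q (t * k)) (κ₁ (t * k) (T (i₁ t f))) := fun k => by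
    refine (hX k _).unique ?_
    convert hasSum_single (q t) fun γ hγ => ?_ using 1
    · simp [h₂.proj_self, h3]
    · simp [h₂.proj_of_ne γ (q t) f hγ]
  rw [sum_apply, push, ← finsum_comp_equiv (Equiv.mulLeft t)]
  simp only [Equiv.coe_mulLeft, h4]
  symm
  refine finsum_eq_sum_of_support_subset _ fun a ha => ?_
  refine hT.mem_toFinset.2 ⟨f, fun hcon => ha ?_⟩
  simp [h3, hcon]

lemma IsFold.commutesWith (h₁ : IsFrame U₁ i₁ κ₁) (h₂ : IsFrame U₂ i₂ κ₂)
    (hq : Function.Surjective q) {T : H₁ →L[ℂ] H₁} {X : H₂ →L[ℂ] H₂}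
    (hX : IsFold q i₁ κ₁ i₂ T X) (hT : IsBanded i₁ κ₁ T) (hU : CommutesWith U₁ T) :
    CommutesWith U₂ X := by
  intro γ u
  obtain ⟨g, rfl⟩ := hq γ
  have : X.comp (U₂ (q g)) = (U₂ (q g)).comp X := by
    refine h₂.ext_incl fun γ f => ?_
    obtain ⟨t, rfl⟩ := hq γ
    simp only [ContinuousLinearMap.comp_apply]
    rw [h₂.translate_incl, ← map_mul, hX, hX, ← h₁.translate_incl, hU,
      h₁.push_translate q h₂ (hT.finSupported h₁ hU (h₁.finSupported_incl t f))]
  exact congrArg (fun Y : H₂ →L[ℂ] H₂ => Y u) this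

/-- The fold `Y` of the adjoint of `T` exists, and is compared with the adjoint of `X` through
matrix coefficients. Those of a fold are sums over the kernel of `q`, and inverting the summation
index exchanges the two sums. -/
lemma IsFold.adjoint (h₁ : IsFrame U₁ i₁ κ₁) (h₂ : IsFrame U₂ i₂ κ₂)
    (hq : Function.Surjective q) {T : H₁ →L[ℂ] H₁} {X : H₂ →L[ℂ] H₂}
    (hX : IsFold q i₁ κ₁ i₂ T X) (hT : IsBanded i₁ κ₁ T) (hU : CommutesWith U₁ T)
    (hT' : IsBanded i₁ κ₁ (ContinuousLinearMap.adjoint T))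
    (hU' : CommutesWith U₁ (ContinuousLinearMap.adjoint T)) :
    IsFold q i₁ κ₁ i₂ (ContinuousLinearMap.adjoint T) (ContinuousLinearMap.adjoint X) := by
  obtain ⟨Y, hY⟩ := hT'.exists_isFold (q := q) h₁ h₂ hU'
  suffices Y = ContinuousLinearMap.adjoint X by rwa [← this]
  have hcoeff : ∀ (A : H₁ →L[ℂ] H₁), IsBanded i₁ κ₁ A → CommutesWith U₁ A → ∀ t t' f f',
      inner ℂ (i₂ (q t') f') (push q κ₁ i₂ (A (i₁ t f))) =
        ∑ᶠ h : q.ker, inner ℂ (i₁ (h * t') f') (A (i₁ t f)) := by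
    classical
    intro A hA hAU t t' f f'
    obtain ⟨F, hF⟩ := (hA.finSupported h₁ hAU (h₁.finSupported_incl t f)).exists_finset
    rw [push_eq_sum q hF, inner_sum]
    -- The indices `a` with `q a = q t'` are exactly the `h * t'` with `h` in the kernel, each for
    -- one `h`; all others are orthogonal to the summand of `q t'`.
    have e1 : ∀ a, inner ℂ (i₂ (q t') f') (i₂ (q a) (κ₁ a (A (i₁ t f)))) =
        ∑ᶠ h : q.ker, if (h : Γ₁) * t' = a then inner ℂ (i₁ a f') (A (i₁ t f)) else 0 := by
      intro a
      by_cases hqa : q t' = q a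
      · have hmem : a * t'⁻¹ ∈ q.ker := by simp [MonoidHom.mem_ker, hqa]
        rw [hqa, h₂.inner_incl, finsum_eq_single _ (⟨a * t'⁻¹, hmem⟩ : q.ker)]
        · simp [h₁.inner_left]
        · rintro ⟨b, hb⟩ hne
          rw [if_neg]
          rintro rfl
          exact hne (by simp)
      · rw [h₂.inner_left, h₂.proj_of_ne _ _ _ hqa, inner_zero_right]
        symm
        refine finsum_eq_zero_of_forall_eq_zero fun b => if_neg ?_
        rintro rfl
        have := b.2
        rw [MonoidHom.mem_ker] at this
        exact hqa (by rw [map_mul, this, one_mul])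
    simp only [e1]
    rw [← finsum_sum_comm]
    · refine finsum_congr fun b => ?_
      rw [Finset.sum_ite_eq]
      split_ifs with hb
      · rfl
      · rw [h₁.inner_left, hF _ hb, inner_zero_right]
    · intro a _
      refine ((finite_singleton a).preimage (f := fun b : q.ker => (b : Γ₁) * t')
        (fun b _ b' _ hbb => Subtype.ext (mul_right_cancel hbb))).subset fun b hb => ?_
      by_contra hcon
      exact hb (if_neg hcon)
  have hpair : ∀ t t' f f', inner ℂ (i₂ (q t') f') (Y (i₂ (q t) f)) =
      inner ℂ (X (i₂ (q t') f')) (i₂ (q t) f) := by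
    intro t t' f f'
    rw [← inner_conj_symm (X _), hX, hY, hcoeff _ hT hU, hcoeff _ hT' hU']
    have : (starRingEnd ℂ) (∑ᶠ h : q.ker, inner ℂ (i₁ (h * t) f) (T (i₁ t' f'))) =
        ∑ᶠ h : q.ker, (starRingEnd ℂ) (inner ℂ (i₁ (h * t) f) (T (i₁ t' f'))) :=
      AddEquiv.map_finsum (starRingAut : ℂ ≃+* ℂ).toAddEquiv _
    -- Equivariance moves `b` across the inner product as `b⁻¹`, so the sums match only after
    -- inversion.
    rw [this, ← finsum_comp_equiv (Equiv.inv q.ker)]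
    refine finsum_congr fun b => ?_
    rw [inner_conj_symm, ← ContinuousLinearMap.adjoint_inner_right T, ← h₁.translate_incl b t f, hU',
      h₁.inner_left, h₁.inner_left, Equiv.inv_apply, ← h₁.proj_translate b,
      InvMemClass.coe_inv, mul_inv_cancel_left]
  symm
  refine h₂.ext_incl fun γ f => ?_
  obtain ⟨t, rfl⟩ := hq γ
  symm
  rw [← sub_eq_zero]
  refine h₂.total _ fun γ' => ext_inner_left ℂ fun f' => ?_
  obtain ⟨t', rfl⟩ := hq γ'
  rw [← h₂.inner_left, inner_sub_right, ContinuousLinearMap.adjoint_inner_right, hpair, sub_self,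
    inner_zero_right]

end Push

/-! ### The folding homomorphism and its decomposition by cutoffs -/

section FoldHom

variable {Γ₁ Γ₂ H₀ H₁ H₂ : Type*} [Group Γ₁] [Group Γ₂]
  [NormedAddCommGroup H₀] [InnerProductSpace ℂ H₀]
  [NormedAddCommGroup H₁] [InnerProductSpace ℂ H₁] [CompleteSpace H₁]
  [NormedAddCommGroup H₂] [InnerProductSpace ℂ H₂] [CompleteSpace H₂]
  {U₁ : Γ₁ → H₁ →L[ℂ] H₁} {i₁ : Γ₁ → H₀ →L[ℂ] H₁} {κ₁ : Γ₁ → H₁ →L[ℂ] H₀}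
  {U₂ : Γ₂ → H₂ →L[ℂ] H₂} {i₂ : Γ₂ → H₀ →L[ℂ] H₂} {κ₂ : Γ₂ → H₂ →L[ℂ] H₀}
  {q : Γ₁ →* Γ₂}

/-- Push-forward of operators is a `*`-homomorphism. -/
theorem exists_starAlgHom_isFold (h₁ : IsFrame U₁ i₁ κ₁) (h₂ : IsFrame U₂ i₂ κ₂)
    (hq : Function.Surjective q) (B₁ : StarSubalgebra ℂ (H₁ →L[ℂ] H₁))
    (B₂ : StarSubalgebra ℂ (H₂ →L[ℂ] H₂)) (hb : ∀ T ∈ B₁, IsBanded i₁ κ₁ T)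
    (hU : ∀ T ∈ B₁, CommutesWith U₁ T)
    (hB₂ : ∀ T ∈ B₁, ∀ X, IsFold q i₁ κ₁ i₂ T X → X ∈ B₂) :
    ∃ Ψ : B₁ →⋆ₐ[ℂ] B₂, ∀ T : B₁, IsFold q i₁ κ₁ i₂ T.1 (Ψ T).1 := by
  choose X hX using fun T : B₁ => (hb T.1 T.2).exists_isFold (q := q) h₁ h₂ (hU T.1 T.2)
  have hfs : ∀ (T : B₁) t f, FinSupported κ₁ (T.1 (i₁ t f)) := fun T t f =>
    (hb T.1 T.2).finSupported h₁ (hU T.1 T.2) (h₁.finSupported_incl t f)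
  -- Each algebraic identity below reduces to checking that its right-hand side is a fold of the
  -- operator on the left.
  have huniq : ∀ (T : B₁) Y, IsFold q i₁ κ₁ i₂ T.1 Y → X T = Y := fun T Y hY =>
    (hX T).unique h₂ hq hY
  have hone : X 1 = 1 := huniq _ _ fun t f => (h₁.push_incl q t f).symm
  have hmul : ∀ S T, X (S * T) = X S * X T := fun S T => huniq _ _ fun t f => by
    change X S (X T _) = _
    rw [hX T, (hX S).apply_push h₁ (hb S.1 S.2) (hU S.1 S.2) (hfs T t f)]
    rfl
  have hadd : ∀ S T, X (S + T) = X S + X T := fun S T => huniq _ _ fun t f => by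
    change X S _ + X T _ = _
    rw [hX S, hX T, ← push_add q (hfs S t f) (hfs T t f)]
    rfl
  have hsmul : ∀ (c : ℂ) T, X (c • T) = c • X T := fun c T => huniq _ _ fun t f => by
    change c • X T _ = _
    rw [hX T, ← push_smul q (hfs T t f)]
    rfl
  have hstar : ∀ T, X (star T) = star (X T) := fun T => huniq _ _ <|
    (hX T).adjoint h₁ h₂ hq (hb T.1 T.2) (hU T.1 T.2) (hb _ (star T).2) (hU _ (star T).2)
  refine ⟨{
    toFun := fun T => ⟨X T, hB₂ T.1 T.2 _ (hX T)⟩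
    map_one' := Subtype.ext hone
    map_mul' := fun S T => Subtype.ext (hmul S T)
    map_zero' := Subtype.ext ?_
    map_add' := fun S T => Subtype.ext (hadd S T)
    commutes' := fun c => Subtype.ext ?_
    map_star' := fun T => Subtype.ext (hstar T) }, hX⟩
  · have := hsmul 0 0
    rwa [zero_smul, zero_smul] at this
  · rw [Algebra.algebraMap_eq_smul_one, Algebra.algebraMap_eq_smul_one]
    change X (c • 1) = c • 1
    rw [hsmul, hone]

/-- A family of operators which, up to translation, acts diagonally on finitely many summands and
whose sum is the identity. -/
structure IsCutoff (U₁ : Γ₁ → H₁ →L[ℂ] H₁) (i₁ : Γ₁ → H₀ →L[ℂ] H₁) (κ₁ : Γ₁ → H₁ →L[ℂ] H₀)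
    (m : Γ₁ → H₁ →L[ℂ] H₁) (F : Finset Γ₁) : Prop where
  translate : ∀ g k v, m (g * k) (U₁ g v) = U₁ g (m k v)
  diag : ∀ g t f, m g (i₁ t f) = i₁ t (κ₁ t (m g (i₁ t f)))
  eq_zero : ∀ g t f, g⁻¹ * t ∉ F → m g (i₁ t f) = 0
  sum_eq : ∀ f, ∑ b ∈ F, m b⁻¹ (i₁ 1 f) = i₁ 1 f

namespace IsCutoff

variable {m : Γ₁ → H₁ →L[ℂ] H₁} {F : Finset Γ₁}

-- The cutoffs meeting the summand `t` have `g⁻¹ * t = b` in `F`, that is `g = t * b⁻¹`; translation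
-- by `t` reduces to `sum_eq`.
omit [CompleteSpace H₁] in
lemma sum_incl (hm : IsCutoff U₁ i₁ κ₁ m F) (h₁ : IsFrame U₁ i₁ κ₁) (t : Γ₁) (f : H₀) :
    ∑ b ∈ F, m (t * b⁻¹) (i₁ t f) = i₁ t f := by
  have : i₁ t f = U₁ t (i₁ 1 f) := by rw [h₁.translate_incl, mul_one]
  simp only [this, hm.translate]
  rw [← map_sum, hm.sum_eq]

/-- A diagonal operator computes its component at `a` from the component of `w` at `a` alone. -/
lemma proj_apply (hm : IsCutoff U₁ i₁ κ₁ m F) (h₁ : IsFrame U₁ i₁ κ₁) {w : H₁}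
    (hw : FinSupported κ₁ w) (g a : Γ₁) : κ₁ a (m g w) = κ₁ a (m g (i₁ a (κ₁ a w))) := by
  refine h₁.induction_finSupported (p := fun w => κ₁ a (m g w) = κ₁ a (m g (i₁ a (κ₁ a w)))) hw
    (by simp) (fun t f => ?_) fun v w _ _ hv hw => by simp only [map_add, hv, hw]
  by_cases hat : a = t
  · subst hat
    rw [h₁.proj_self]
  · rw [hm.diag g t f, h₁.proj_of_ne a t _ hat, h₁.proj_of_ne a t _ hat]
    simp

lemma finSupported (hm : IsCutoff U₁ i₁ κ₁ m F) (h₁ : IsFrame U₁ i₁ κ₁) {w : H₁}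
    (hw : FinSupported κ₁ w) (g : Γ₁) : FinSupported κ₁ (m g w) :=
  hw.subset fun a ha hcon => ha (by rw [hm.proj_apply h₁ hw, hcon]; simp)

lemma push_apply (hm : IsCutoff U₁ i₁ κ₁ m F) (h₁ : IsFrame U₁ i₁ κ₁) {w : H₁}
    (hw : FinSupported κ₁ w) (g : Γ₁) :
    push q κ₁ i₂ (m g w) = ∑ b ∈ F, i₂ (q (g * b)) (κ₁ (g * b) (m g w)) := by
  have h0 : ∀ a ∉ F.map (Equiv.mulLeft g).toEmbedding, κ₁ a (m g w) = 0 := fun a ha => by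
    rw [hm.proj_apply h₁ hw, hm.eq_zero, map_zero]
    intro hcon
    exact ha (Finset.mem_map.2 ⟨g⁻¹ * a, hcon, by simp⟩)
  rw [push_eq_sum q h0, Finset.sum_map]
  rfl

/-- On a single summand all but finitely many of the cutoffs vanish, and the remaining ones sum to
the identity. -/
lemma hasSum_push (hm : IsCutoff U₁ i₁ κ₁ m F) (h₁ : IsFrame U₁ i₁ κ₁) {w : H₁}
    (hw : FinSupported κ₁ w) : HasSum (fun g => push q κ₁ i₂ (m g w)) (push q κ₁ i₂ w) := by
  refine h₁.induction_finSupported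
    (p := fun w => HasSum (fun g => push q κ₁ i₂ (m g w)) (push q κ₁ i₂ w)) hw
    ?_ (fun t f => ?_) fun v w hv hw hpv hpw => ?_
  · simp [push_zero]
  · have hinj : Function.Injective fun b : Γ₁ => t * b⁻¹ := fun b b' hbb => by simpa using hbb
    have h0 : ∀ g ∉ F.map ⟨_, hinj⟩, push q κ₁ i₂ (m g (i₁ t f)) = 0 := fun g hg => by
      rw [hm.eq_zero, push_zero]
      intro hcon
      exact hg (Finset.mem_map.2 ⟨g⁻¹ * t, hcon, by simp⟩)
    have := hasSum_sum_of_ne_finset_zero (L := SummationFilter.unconditional _) h0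
    rw [Finset.sum_map, Function.Embedding.coeFn_mk,
      ← push_sum q fun b _ => hm.finSupported h₁ (h₁.finSupported_incl t f) _,
      hm.sum_incl h₁] at this
    exact this
  · simp only [map_add]
    rw [push_add q hv hw]
    refine (hpv.add hpw).congr_fun fun g => ?_
    rw [push_add q (hm.finSupported h₁ hv g) (hm.finSupported h₁ hw g)]

end IsCutoff

section HasSum

variable {m : Γ₁ → H₁ →L[ℂ] H₁} {F : Finset Γ₁}

/-- The part of the push-forward of `T` which is cut out by `m g` and `m s`. -/
noncomputable def foldPiece (q : Γ₁ →* Γ₂) (i₁ : Γ₁ → H₀ →L[ℂ] H₁) (κ₁ : Γ₁ → H₁ →L[ℂ] H₀)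
    (i₂ : Γ₂ → H₀ →L[ℂ] H₂) (κ₂ : Γ₂ → H₂ →L[ℂ] H₀) (m : Γ₁ → H₁ →L[ℂ] H₁) (F : Finset Γ₁)
    (T : H₁ →L[ℂ] H₁) (u : H₂) (g s : Γ₁) : H₂ :=
  ∑ b ∈ F, ∑ b' ∈ F, i₂ (q (g * b)) (κ₁ (g * b) (m g (T (m s
    (i₁ (s * b') (κ₂ (q (s * b')) u))))))

/-- Convergence is separated from the computation of the limit. Writing `g = s * k`, equivariance
makes the coefficient of the piece independent of `s`, and only finitely many `k` contribute. For
fixed `k`, `b`, `b'` the sum over `s` converges by `IsFrame.exists_hasSum`, as `q` is injective on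
`S`. -/
lemma exists_hasSum_foldPiece (hm : IsCutoff U₁ i₁ κ₁ m F) (h₁ : IsFrame U₁ i₁ κ₁)
    (h₂ : IsFrame U₂ i₂ κ₂) {T : H₁ →L[ℂ] H₁} (hT : IsBanded i₁ κ₁ T)
    (hU : CommutesWith U₁ T) {S : Set Γ₁} (hS : ∀ γ : Γ₂, ∃! s : S, q s = γ) :
    ∃ Y : H₂ →L[ℂ] H₂, ∀ u,
      HasSum (fun k : Γ₁ × S => foldPiece q i₁ κ₁ i₂ κ₂ m F T u k.1 k.2) (Y u) := by
  classical
  have hSinj : Function.Injective fun s : S => q s := fun s s' hss =>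
    (hS (q s')).unique hss rfl
  have hconst : ∀ (s k b b' : Γ₁) f, κ₁ (s * k * b) (m (s * k) (T (m s (i₁ (s * b') f)))) =
      κ₁ (k * b) (m k (T (m 1 (i₁ b' f)))) := by
    intro s k b b' f
    have h3 : m s (U₁ s (i₁ b' f)) = U₁ s (m 1 (i₁ b' f)) := by
      rw [← hm.translate, mul_one]
    rw [← h₁.translate_incl, h3, hU, hm.translate, mul_assoc, h₁.proj_translate]
  choose Y hY using fun (k b b' : Γ₁) => h₂.exists_hasSum (S := S)
    (j := fun s => q (s * k * b)) (j' := fun s => q (s * b'))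
    (fun s s' hss => hSinj (by simpa using hss)) (fun s s' hss => hSinj (by simpa using hss))
    (fun _ => (κ₁ (k * b)).comp ((m k).comp (T.comp ((m 1).comp (i₁ b'))))) _ fun _ => le_rfl
  -- A nonzero entry of `T` from `b'` to `k * b` needs `b'⁻¹ * (k * b)` in the band of `T`; solving
  -- for `k` gives these products.
  let K : Finset Γ₁ := (F ×ˢ hT.toFinset ×ˢ F).image fun x => x.1 * x.2.1 * x.2.2⁻¹
  have hK : ∀ k ∉ K, ∀ b ∈ F, ∀ b' ∈ F, ∀ f, κ₁ (k * b) (m k (T (m 1 (i₁ b' f)))) = 0 := by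
    intro k hk b hb b' hb' f
    rw [hm.diag]
    set f' := κ₁ b' (m 1 (i₁ b' f))
    rw [hm.proj_apply h₁ (hT.finSupported h₁ hU (h₁.finSupported_incl b' f'))]
    suffices κ₁ (k * b) (T (i₁ b' f')) = 0 by rw [this]; simp
    by_contra hcon
    apply hk
    refine Finset.mem_image.2 ⟨(b', b'⁻¹ * (k * b), b), ?_, by simp [mul_assoc]⟩
    simp only [Finset.mem_product]
    refine ⟨hb', hT.mem_toFinset.2 ⟨f', ?_⟩, hb⟩
    have e1 := h₁.proj_translate b' (b'⁻¹ * (k * b)) (T (i₁ 1 f'))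
    rw [mul_inv_cancel_left, ← hU, h₁.translate_incl, mul_one] at e1
    rwa [← e1]
  refine ⟨∑ k ∈ K, ∑ b ∈ F, ∑ b' ∈ F, Y k b b', fun u => ?_⟩
  -- The nonzero pieces lie on the finitely many graphs `g = s * k` with `k` in `K`, each
  -- parametrized by `s`.
  have hsplit : ∀ p : Γ₁ × S, foldPiece q i₁ κ₁ i₂ κ₂ m F T u p.1 p.2 =
      ∑ k ∈ K, if (p.2 : Γ₁) * k = p.1 then foldPiece q i₁ κ₁ i₂ κ₂ m F T u p.1 p.2 else 0 := by
    rintro ⟨g, s⟩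
    have hgs : ∀ k, (s : Γ₁) * k = g ↔ (s : Γ₁)⁻¹ * g = k := fun k =>
      ⟨fun h => by rw [← h, inv_mul_cancel_left], fun h => by rw [← h, mul_inv_cancel_left]⟩
    simp only [hgs]
    rw [Finset.sum_ite_eq]
    split_ifs with hk
    · rfl
    · refine Finset.sum_eq_zero fun b hb => Finset.sum_eq_zero fun b' hb' => ?_
      have := hconst s ((s : Γ₁)⁻¹ * g) b b' (κ₂ (q (s * b')) u)
      rw [mul_inv_cancel_left, hK _ hk b hb b' hb'] at this
      rw [this, map_zero]
  simp only [sum_apply]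
  refine (hasSum_sum (f := fun k (p : Γ₁ × S) => if (p.2 : Γ₁) * k = p.1 then
    foldPiece q i₁ κ₁ i₂ κ₂ m F T u p.1 p.2 else 0) (s := K) fun k _ => ?_).congr_fun hsplit
  have hinj : Function.Injective fun s : S => ((s : Γ₁) * k, s) := fun s s' hss =>
    (Prod.ext_iff.1 hss).2
  rw [← hinj.hasSum_iff]
  · refine (hasSum_sum fun b _ => hasSum_sum fun b' _ => hY k b b' u).congr_fun fun s => ?_
    simp only [Function.comp_apply, if_pos]
    refine Finset.sum_congr rfl fun b _ => Finset.sum_congr rfl fun b' _ => ?_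
    rw [hconst]
    rfl
  · rintro ⟨g, s⟩ hgs
    refine if_neg fun hcon => hgs ⟨s, ?_⟩
    exact Prod.ext hcon rfl

/-- The pieces of the push-forward of `T` cut out by a cutoff sum up to the push-forward of `T`. -/
theorem IsFold.hasSum_foldPiece (hm : IsCutoff U₁ i₁ κ₁ m F) (h₁ : IsFrame U₁ i₁ κ₁)
    (h₂ : IsFrame U₂ i₂ κ₂) (hq : Function.Surjective q) {T : H₁ →L[ℂ] H₁} {X : H₂ →L[ℂ] H₂}
    (hX : IsFold q i₁ κ₁ i₂ T X) (hT : IsBanded i₁ κ₁ T) (hU : CommutesWith U₁ T)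
    {S : Set Γ₁} (hS : ∀ γ : Γ₂, ∃! s : S, q s = γ) (u : H₂) :
    HasSum (fun k : Γ₁ × S => foldPiece q i₁ κ₁ i₂ κ₂ m F T u k.1 k.2) (X u) := by
  classical
  obtain ⟨Y, hY⟩ := exists_hasSum_foldPiece hm h₁ h₂ hT hU hS
  -- The sum is already a bounded operator `Y` applied to `u`, so it suffices to evaluate it on one
  -- summand, where every vector involved is finitely supported.
  suffices Y = X by rw [← this]; exact hY u
  refine h₂.ext_incl fun γ f => ?_
  obtain ⟨t, rfl⟩ := hq γ
  set u := i₂ (q t) f with hu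
  set v : Γ₁ → H₁ := fun s => ∑ b ∈ F, m s (i₁ (s * b) (κ₂ (q (s * b)) u)) with hv
  have hvfs : ∀ s, FinSupported κ₁ (v s) := fun s => FinSupported.sum fun b _ =>
    hm.finSupported h₁ (h₁.finSupported_incl _ _) s
  have hpiece : ∀ g s, foldPiece q i₁ κ₁ i₂ κ₂ m F T u g s = push q κ₁ i₂ (m g (T (v s))) := by
    intro g s
    rw [hm.push_apply h₁ (hT.finSupported h₁ hU (hvfs s)), foldPiece]
    simp only [hv, map_sum]
  -- Summing over `g` first removes the outer cutoff by `hasSum_push`, after which `X` can be pulled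
  -- out.
  have h3 : HasSum (fun s : S => X (push q κ₁ i₂ (v s))) (Y u) := by
    have h4 := (Equiv.prodComm S Γ₁).hasSum_iff.2 (hY u)
    refine h4.prod_fiberwise fun s => ?_
    simp only [Function.comp_def, Equiv.prodComm_apply, Prod.swap_prod_mk, hpiece]
    rw [hX.apply_push h₁ hT hU (hvfs s)]
    exact hm.hasSum_push h₁ (hT.finSupported h₁ hU (hvfs s))
  refine h3.unique (HasSum.mapL X ?_)
  -- If `q s = q (t * b⁻¹)`, then `s` is the product of a kernel element `a` and `t * b⁻¹`, and
  -- `push` does not see the translation by `a`. Otherwise the component of `u` at `q (s * b)` is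
  -- zero.
  have h5 : ∀ s, push q κ₁ i₂ (v s) =
      ∑ b ∈ F, if q s = q (t * b⁻¹) then push q κ₁ i₂ (m (t * b⁻¹) (i₁ t f)) else 0 := by
    intro s
    rw [hv, push_sum q fun b _ => hm.finSupported h₁ (h₁.finSupported_incl _ _) s]
    refine Finset.sum_congr rfl fun b _ => ?_
    split_ifs with hs
    · have hsb : q (s * b) = q t := by rw [map_mul, hs, ← map_mul, inv_mul_cancel_right]
      set a := s * b * t⁻¹ with ha
      have e1 : s = a * (t * b⁻¹) := by rw [ha]; group
      have e2 : s * b = a * t := by rw [ha]; group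
      have e3 : q (a * t) = q t := by rw [← e2, hsb]
      rw [hsb, hu, h₂.proj_self, e2, ← h₁.translate_incl]
      conv_lhs => rw [e1]
      rw [hm.translate, hm.diag, h₁.translate_incl, h₁.push_incl, h₁.push_incl, e3]
    · rw [hu, h₂.proj_of_ne, map_zero, map_zero, push_zero]
      intro hcon
      exact hs (by rw [map_mul, ← hcon, ← map_mul, mul_inv_cancel_right])
  have h6 : u = ∑ b ∈ F, push q κ₁ i₂ (m (t * b⁻¹) (i₁ t f)) := by
    rw [← push_sum q fun b _ => hm.finSupported h₁ (h₁.finSupported_incl t f) _, hm.sum_incl h₁,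
      h₁.push_incl]
  rw [h6]
  refine (hasSum_sum fun b _ => ?_).congr_fun fun s => h5 s
  -- Exactly one representative lies in the coset of `t * b⁻¹`, so each `b` is counted once whatever
  -- `S` is.
  obtain ⟨s₀, hs₀, hs₀'⟩ := hS (q (t * b⁻¹))
  convert hasSum_single s₀ fun s hs => ?_ using 1
  · rw [if_pos hs₀]
  · exact if_neg fun hcon => hs (hs₀' s hcon)

end HasSum

end FoldHom

/-! ### Transport between equal fibres -/

section FiberCast

variable {N : Type*} {E : N → Type*} {x x' : N}

@[simp] lemma fiberCast_rfl (v : E x) : fiberCast (rfl : x = x) v = v := rfl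

lemma fiberCast_fiberCast {x'' : N} (h : x = x') (h' : x' = x'') (v : E x) :
    fiberCast h' (fiberCast h v) = fiberCast (h.trans h') v := by
  subst h; subst h'; rfl

lemma fiberCast_section {M : Type*} {p : M → N} (s : ∀ y, E (p y)) {y y' : M} (h : y = y')
    (h' : p y = p y') : fiberCast h' (s y) = s y' := by
  subst h; rfl

variable [∀ x, NormedAddCommGroup (E x)]

lemma fiberCast_add (h : x = x') (v w : E x) :
    fiberCast h (v + w) = fiberCast h v + fiberCast h w := by subst h; rfl

@[simp] lemma fiberCast_zero (h : x = x') : fiberCast h (0 : E x) = 0 := by subst h; rfl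

@[simp] lemma enorm_fiberCast (h : x = x') (v : E x) : ‖fiberCast h v‖ₑ = ‖v‖ₑ := by
  subst h; rfl

lemma fiberCast_eq_zero (h : x = x') {v : E x} : fiberCast h v = 0 ↔ v = 0 := by
  subst h; rfl

variable [∀ x, InnerProductSpace ℂ (E x)]

lemma fiberCast_smul (h : x = x') (c : ℂ) (v : E x) :
    fiberCast h (c • v) = c • fiberCast h v := by subst h; rfl

lemma inner_fiberCast (h : x = x') (v w : E x) :
    inner ℂ (fiberCast h v) (fiberCast h w) = inner ℂ v w := by subst h; rfl

end FiberCast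

/-! ### Weighted composition operators on square-integrable sections -/

section WeightedComposition

variable {N : Type*} [TopologicalSpace N]
  {F : Type*} [NormedAddCommGroup F] [NormedSpace ℂ F]
  {E : N → Type*} [TopologicalSpace (TotalSpace F E)] [∀ x, NormedAddCommGroup (E x)]
  [∀ x, InnerProductSpace ℂ (E x)] [FiberBundle F E] [VectorBundle ℂ F E]
  {M : Type*} [TopologicalSpace M] [MeasurableSpace M] {p : C(M, N)} {μ : Measure M}
  {M' : Type*} [TopologicalSpace M'] [MeasurableSpace M'] {p' : C(M', N)} {μ' : Measure M'}

/-- The section `y ↦ c y • s (τ y)` for a map `τ` over the base. -/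
def wcompSec {p : M → N} {p' : M' → N} {τ : M → M'} (hτ : ∀ y, p' (τ y) = p y) (c : M → ℂ)
    (s : ∀ x, E (p' x)) : ∀ y, E (p y) :=
  fun y => c y • fiberCast (hτ y) (s (τ y))

/-- The condition for `s ↦ c • (s ∘ τ)` to be a bounded operator on square-integrable sections. -/
structure IsAdmissible (μ : Measure M) (μ' : Measure M') (τ : M → M') (c : M → ℂ) : Prop where
  measurable_map : Measurable τ
  measurable_weight : Measurable c
  exists_bound : ∃ C : NNReal, ∀ f : M' → ENNReal, Measurable f →
    ∫⁻ y, ‖c y‖ₑ ^ 2 * f (τ y) ∂μ ≤ (C : ENNReal) ^ 2 * ∫⁻ x, f x ∂μ'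

-- The bound applied to the indicator of a measurable null set shows that the weight vanishes almost
-- everywhere on its preimage. Hence the operator is well defined on classes although `τ` alone need
-- not pull null sets back to null sets.
omit [TopologicalSpace M] [TopologicalSpace M'] in
lemma IsAdmissible.ae {τ : M → M'} {c : M → ℂ} (h : IsAdmissible μ μ' τ c) {P : M' → Prop}
    (hP : ∀ᵐ x ∂μ', P x) : ∀ᵐ y ∂μ, c y ≠ 0 → P (τ y) := by
  obtain ⟨C, hC⟩ := h.exists_bound
  obtain ⟨A, hA, hAm, hA0⟩ := exists_measurable_superset_of_null (ae_iff.1 hP)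
  have h1 := hC (A.indicator 1) (measurable_one.indicator hAm)
  rw [lintegral_indicator_one hAm, hA0, mul_zero, nonpos_iff_eq_zero, lintegral_eq_zero_iff] at h1
  · filter_upwards [h1] with y hy hcy
    by_contra hcon
    have : τ y ∈ A := hA hcon
    simp [this, hcy] at hy
  · exact (h.measurable_weight.enorm.pow_const 2).mul
      ((measurable_one.indicator hAm).comp h.measurable_map)

omit [TopologicalSpace M] [TopologicalSpace M'] in
lemma IsAdmissible.lintegral_le {τ : M → M'} {c : M → ℂ} (h : IsAdmissible μ μ' τ c)
    {C : NNReal} (hC : ∀ f : M' → ENNReal, Measurable f →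
      ∫⁻ y, ‖c y‖ₑ ^ 2 * f (τ y) ∂μ ≤ (C : ENNReal) ^ 2 * ∫⁻ x, f x ∂μ')
    {f : M' → ENNReal} (hf : AEMeasurable f μ') :
    ∫⁻ y, ‖c y‖ₑ ^ 2 * f (τ y) ∂μ ≤ (C : ENNReal) ^ 2 * ∫⁻ x, f x ∂μ' := by
  rw [lintegral_congr_ae hf.ae_eq_mk]
  refine le_trans (lintegral_mono_ae ?_) (hC _ hf.measurable_mk)
  filter_upwards [h.ae hf.ae_eq_mk] with y hy
  by_cases hc : c y = 0
  · simp [hc]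
  · rw [hy hc]

lemma AEMeasurableSection.wcomp {τ : M → M'} {c : M → ℂ} (h : IsAdmissible μ μ' τ c)
    (hτ : ∀ y, p' (τ y) = p y) {s : ∀ x, E (p' x)} (hs : AEMeasurableSection F E p' μ' s) :
    AEMeasurableSection F E p μ (wcompSec hτ c s) := by
  intro x₀
  have hmeas : StronglyMeasurable fun y => c y • (hs x₀).mk _ (τ y) :=
    h.measurable_weight.stronglyMeasurable.smul
      ((hs x₀).stronglyMeasurable_mk.comp_measurable h.measurable_map)
  refine ⟨_, hmeas, ?_⟩
  have hcast : ∀ (x x' : N) (hx : x = x') (v : E x),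
      (trivializationAt F E x₀).continuousLinearMapAt ℂ x' (fiberCast hx v) =
        (trivializationAt F E x₀).continuousLinearMapAt ℂ x v := by
    rintro x _ rfl v; rfl
  filter_upwards [h.ae (hs x₀).ae_eq_mk] with y hy
  rw [wcompSec, map_smul, hcast]
  by_cases hc : c y = 0
  · simp [hc]
  · rw [hy hc]

variable [FiniteDimensional ℂ F] [ContinuousHermitianBundle F E] [CompactSpace N]
  [BorelSpace M] [BorelSpace M']

lemma lintegral_wcompSec_le {τ : M → M'} {c : M → ℂ} (h : IsAdmissible μ μ' τ c)
    (hτ : ∀ y, p' (τ y) = p y) {C : NNReal} (hC : ∀ f : M' → ENNReal, Measurable f →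
      ∫⁻ y, ‖c y‖ₑ ^ 2 * f (τ y) ∂μ ≤ (C : ENNReal) ^ 2 * ∫⁻ x, f x ∂μ')
    {s : ∀ x, E (p' x)} (hs : MemL2 F E p' μ' s) :
    ∫⁻ y, ‖wcompSec hτ c s y‖ₑ ^ 2 ∂μ ≤ (C : ENNReal) ^ 2 * ∫⁻ x, ‖s x‖ₑ ^ 2 ∂μ' := by
  have hm : AEMeasurable (fun x => ‖s x‖ₑ) μ' := by simpa using hs.1.norm.enorm
  refine le_trans (le_of_eq ?_) (h.lintegral_le hC (hm.pow_const 2))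
  refine lintegral_congr fun y => ?_
  rw [wcompSec, enorm_smul, mul_pow, enorm_fiberCast]

lemma MemL2.wcomp {τ : M → M'} {c : M → ℂ} (h : IsAdmissible μ μ' τ c)
    (hτ : ∀ y, p' (τ y) = p y) {s : ∀ x, E (p' x)} (hs : MemL2 F E p' μ' s) :
    MemL2 F E p μ (wcompSec hτ c s) := by
  obtain ⟨C, hC⟩ := h.exists_bound
  exact ⟨hs.1.wcomp h hτ, (lintegral_wcompSec_le h hτ hC hs).trans_lt
    (ENNReal.mul_lt_top (by simp) hs.2)⟩

omit [FiniteDimensional ℂ F] [ContinuousHermitianBundle F E] [CompactSpace N] [BorelSpace M] in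
lemma MemL2.congr {s t : ∀ y, E (p y)} (hs : MemL2 F E p μ s) (h : ∀ᵐ y ∂μ, s y = t y) :
    MemL2 F E p μ t := by
  refine ⟨fun x₀ => (hs.1 x₀).congr ?_, ?_⟩
  · filter_upwards [h] with y hy
    rw [hy]
  · rw [← lintegral_congr_ae (f := fun y => ‖s y‖ₑ ^ 2)]
    · exact hs.2
    · filter_upwards [h] with y hy
      rw [hy]

lemma toL2_eq_mk {s : ∀ y, E (p y)} (hs : MemL2 F E p μ s) :
    (toL2 s : L2 F E p μ) = SeparationQuotient.mk (PreL2.mk s hs) := by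
  rw [toL2, dif_pos hs]

lemma toL2_congr {s t : ∀ y, E (p y)} (hs : MemL2 F E p μ s) (h : ∀ᵐ y ∂μ, s y = t y) :
    (toL2 s : L2 F E p μ) = toL2 t := by
  rw [toL2_eq_mk hs, toL2_eq_mk (hs.congr h), SeparationQuotient.mk_eq_mk, PreL2.inseparable_iff]
  exact h

lemma L2.ext_rep {u v : L2 F E p μ} (h : ∀ᵐ y ∂μ, u.rep y = v.rep y) : u = v := by
  rw [← toL2_rep u, ← toL2_rep v]
  exact toL2_congr u.memL2_rep h

lemma L2.rep_congr {u v : L2 F E p μ} (h : u = v) : ∀ᵐ y ∂μ, u.rep y = v.rep y :=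
  Eventually.of_forall fun y => by rw [h]

lemma toL2_add {s t : ∀ y, E (p y)} (hs : MemL2 F E p μ s) (ht : MemL2 F E p μ t) :
    (toL2 (s + t) : L2 F E p μ) = toL2 s + toL2 t := by
  rw [toL2_eq_mk hs, toL2_eq_mk ht, toL2_eq_mk (hs.add ht)]
  rfl

lemma memL2_zero : MemL2 F E p μ (0 : ∀ y, E (p y)) := (l2Submodule F E p μ).zero_mem

lemma toL2_zero : (toL2 (0 : ∀ y, E (p y)) : L2 F E p μ) = 0 := by
  rw [toL2_eq_mk memL2_zero]
  rfl

lemma toL2_smul (c : ℂ) {s : ∀ y, E (p y)} (hs : MemL2 F E p μ s) :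
    (toL2 (c • s) : L2 F E p μ) = c • toL2 s := by
  rw [toL2_eq_mk hs, toL2_eq_mk (hs.const_smul c)]
  rfl

lemma memL2_sum {ι : Type*} {A : Finset ι} {s : ι → ∀ y, E (p y)}
    (hs : ∀ i ∈ A, MemL2 F E p μ (s i)) : MemL2 F E p μ (∑ i ∈ A, s i) :=
  (l2Submodule F E p μ).sum_mem hs

lemma toL2_sum {ι : Type*} {A : Finset ι} {s : ι → ∀ y, E (p y)}
    (hs : ∀ i ∈ A, MemL2 F E p μ (s i)) :
    (toL2 (∑ i ∈ A, s i) : L2 F E p μ) = ∑ i ∈ A, toL2 (s i) := by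
  classical
  induction A using Finset.induction_on with
  | empty => simpa using toL2_zero
  | insert a A ha ih =>
    rw [Finset.sum_insert ha, Finset.sum_insert ha,
      toL2_add (hs a (by simp)) (memL2_sum fun i hi => hs i (by simp [hi])),
      ih fun i hi => hs i (by simp [hi])]

lemma L2.rep_add (u v : L2 F E p μ) : ∀ᵐ y ∂μ, (u + v).rep y = u.rep y + v.rep y := by
  have h := rep_toL2 (u.memL2_rep.add v.memL2_rep)
  rw [toL2_add u.memL2_rep v.memL2_rep, toL2_rep, toL2_rep] at h
  exact h

lemma L2.rep_smul (c : ℂ) (u : L2 F E p μ) : ∀ᵐ y ∂μ, (c • u).rep y = c • u.rep y := by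
  have h := rep_toL2 (u.memL2_rep.const_smul c)
  rw [toL2_smul c u.memL2_rep, toL2_rep] at h
  exact h

lemma L2.rep_zero : ∀ᵐ y ∂μ, (0 : L2 F E p μ).rep y = 0 := by
  have h := rep_toL2 (memL2_zero (F := F) (E := E) (p := p) (μ := μ))
  rw [toL2_zero] at h
  exact h

lemma L2.inner_eq (u v : L2 F E p μ) : inner ℂ u v = ∫ y, inner ℂ (u.rep y) (v.rep y) ∂μ := by
  conv_lhs => rw [← toL2_rep u, ← toL2_rep v, toL2_eq_mk u.memL2_rep, toL2_eq_mk v.memL2_rep]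
  rfl

/-- The operator `s ↦ c • (s ∘ τ)` on square-integrable sections. -/
noncomputable def preWcomp {τ : M → M'} {c : M → ℂ} (h : IsAdmissible μ μ' τ c)
    (hτ : ∀ y, p' (τ y) = p y) : PreL2 F E p' μ' →L[ℂ] PreL2 F E p μ :=
  LinearMap.mkContinuous
    { toFun := fun s => PreL2.mk (wcompSec hτ c s.sec) (s.mem.wcomp h hτ)
      map_add' := fun s t => Subtype.ext (funext fun y => by
        change c y • fiberCast _ (s.sec _ + t.sec _) = _
        rw [fiberCast_add, smul_add]
        rfl)
      map_smul' := fun a s => Subtype.ext (funext fun y => by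
        change c y • fiberCast _ (a • s.sec _) = _
        rw [fiberCast_smul, smul_comm]
        rfl) }
    h.exists_bound.choose (fun s => by
      have h1 := lintegral_wcompSec_le h hτ h.exists_bound.choose_spec s.mem
      have h2 := PreL2.enorm_eq' (PreL2.mk (wcompSec hτ c s.sec) (s.mem.wcomp h hτ))
      have h3 := PreL2.enorm_eq' s
      set C := h.exists_bound.choose
      have h4 : ‖PreL2.mk (wcompSec hτ c s.sec) (s.mem.wcomp h hτ)‖ₑ ≤ C * ‖s‖ₑ := by
        rw [h2, h3]
        have h5 := ENNReal.rpow_le_rpow h1 (by norm_num : (0 : ℝ) ≤ 1 / 2)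
        rw [ENNReal.mul_rpow_of_nonneg _ _ (by norm_num), ← ENNReal.rpow_natCast_mul] at h5
        simpa using h5
      have h6 : ‖PreL2.mk (wcompSec hτ c s.sec) (s.mem.wcomp h hτ)‖₊ ≤ C * ‖s‖₊ := by
        rw [enorm_eq_nnnorm, enorm_eq_nnnorm] at h4
        exact_mod_cast h4
      exact_mod_cast h6)

/-- The operator `s ↦ c • (s ∘ τ)` on `L²`. -/
noncomputable def wcomp {τ : M → M'} {c : M → ℂ} (h : IsAdmissible μ μ' τ c)
    (hτ : ∀ y, p' (τ y) = p y) : L2 F E p' μ' →L[ℂ] L2 F E p μ :=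
  SeparationQuotient.liftCLM ((SeparationQuotient.mkCLM ℂ (PreL2 F E p μ)).comp (preWcomp h hτ))
    fun _ _ hst => SeparationQuotient.mk_eq_mk.2 (hst.map (preWcomp h hτ).continuous)

lemma wcomp_toL2 {τ : M → M'} {c : M → ℂ} (h : IsAdmissible μ μ' τ c)
    (hτ : ∀ y, p' (τ y) = p y) {s : ∀ x, E (p' x)} (hs : MemL2 F E p' μ' s) :
    wcomp h hτ (toL2 s : L2 F E p' μ') = toL2 (wcompSec hτ c s) := by
  rw [toL2_eq_mk hs, toL2_eq_mk (hs.wcomp h hτ)]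
  rfl

lemma wcomp_eq {τ : M → M'} {c : M → ℂ} (h : IsAdmissible μ μ' τ c)
    (hτ : ∀ y, p' (τ y) = p y) (u : L2 F E p' μ') :
    wcomp h hτ u = toL2 (wcompSec hτ c u.rep) := by
  rw [← wcomp_toL2 h hτ u.memL2_rep, toL2_rep]

lemma rep_wcomp {τ : M → M'} {c : M → ℂ} (h : IsAdmissible μ μ' τ c)
    (hτ : ∀ y, p' (τ y) = p y) (u : L2 F E p' μ') :
    ∀ᵐ y ∂μ, (wcomp h hτ u).rep y = c y • fiberCast (hτ y) (u.rep (τ y)) := by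
  rw [wcomp_eq]
  exact rep_toL2 (u.memL2_rep.wcomp h hτ)

end WeightedComposition

/-! ### The decomposition of L² by the translates of a Borel section -/

section SectionSystem

variable {N : Type*} [TopologicalSpace N] [MeasurableSpace N]
  {M : Type*} [TopologicalSpace M] [MeasurableSpace M] {Γ : Type*} [Group Γ] [MulAction Γ M]

/-- A family of Borel sections of `p`, permuted by `Γ`, whose images form a partition of `M`. -/
structure IsSectionSystem (p : C(M, N)) (ν : Measure N) (μ : Measure M) (σ : Γ → N → M) :
    Prop where
  right_inv : ∀ g x, p (σ g x) = x
  measurable : ∀ g, Measurable (σ g)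
  measurableSet_range : ∀ g, MeasurableSet (range (σ g))
  map_eq : ∀ g, ν.map (σ g) = μ.restrict (range (σ g))
  mul_eq : ∀ g k x, σ (g * k) x = g • σ k x
  injective : ∀ g k x, σ g x = σ k x → g = k
  exists_eq : ∀ y, ∃ g, σ g (p y) = y
  measurePreserving : ∀ g : Γ, MeasurePreserving (fun y : M => g • y) μ μ

lemma isAdmissible_of_measurePreserving {μ : Measure M} {τ : M → M}
    (hτ : MeasurePreserving τ μ μ) : IsAdmissible μ μ τ fun _ => 1 where
  measurable_map := hτ.measurable
  measurable_weight := measurable_const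
  exists_bound := ⟨1, fun f hf => by simp [hτ.lintegral_comp hf]⟩

lemma isAdmissible_id {μ : Measure M} {c : M → ℂ} (hc : Measurable c) {C : NNReal}
    (hC : ∀ y, ‖c y‖ₑ ≤ C) : IsAdmissible μ μ id c where
  measurable_map := measurable_id
  measurable_weight := hc
  exists_bound := ⟨C, fun f hf => by
    rw [← lintegral_const_mul _ hf]
    refine lintegral_mono fun y => ?_
    dsimp only [id]
    gcongr
    exact hC y⟩

namespace IsSectionSystem

variable {p : C(M, N)} {ν : Measure N} {μ : Measure M} {σ : Γ → N → M}
  (h : IsSectionSystem p ν μ σ)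
include h

lemma mem_range_iff {g : Γ} {y : M} : y ∈ range (σ g) ↔ σ g (p y) = y :=
  ⟨by rintro ⟨x, rfl⟩; rw [h.right_inv], fun hy => ⟨_, hy⟩⟩

lemma setLIntegral_range (g : Γ) {f : M → ENNReal} (hf : Measurable f) :
    ∫⁻ y in range (σ g), f y ∂μ = ∫⁻ x, f (σ g x) ∂ν := by
  rw [← h.map_eq, lintegral_map hf (h.measurable g)]

lemma isAdmissible_proj (g : Γ) : IsAdmissible ν μ (σ g) fun _ => 1 where
  measurable_map := h.measurable g
  measurable_weight := measurable_const
  exists_bound := ⟨1, fun f hf => by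
    simp only [enorm_one, one_pow, one_mul, ENNReal.coe_one]
    rw [← h.setLIntegral_range g hf]
    exact setLIntegral_le_lintegral _ _⟩

variable [BorelSpace N] [BorelSpace M]

lemma isAdmissible_incl (g : Γ) :
    IsAdmissible μ ν p ((range (σ g)).indicator fun _ => (1 : ℂ)) where
  measurable_map := p.continuous.measurable
  measurable_weight := measurable_const.indicator (h.measurableSet_range g)
  exists_bound := ⟨1, fun f hf => by
    have h1 : ∀ y, ‖(range (σ g)).indicator (fun _ => (1 : ℂ)) y‖ₑ ^ 2 * f (p y) =
        (range (σ g)).indicator (fun y => f (p y)) y := fun y => by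
      by_cases hy : y ∈ range (σ g) <;> simp [hy]
    simp only [h1]
    have h2 := h.setLIntegral_range g (hf.comp p.continuous.measurable)
    simp only [Function.comp_apply, h.right_inv] at h2
    rw [lintegral_indicator (h.measurableSet_range g), h2]
    simp⟩

variable
  {F : Type*} [NormedAddCommGroup F] [NormedSpace ℂ F]
  {E : N → Type*} [TopologicalSpace (TotalSpace F E)] [∀ x, NormedAddCommGroup (E x)]
  [∀ x, InnerProductSpace ℂ (E x)] [FiberBundle F E] [VectorBundle ℂ F E]
  [FiniteDimensional ℂ F] [ContinuousHermitianBundle F E] [CompactSpace N]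

omit h in
/-- A representative of an element of `L²(N; E)`. -/
noncomputable def baseRep (f : L2 F E (ContinuousMap.id N) ν) (x : N) : E x := f.rep x

/-- Extension by zero of sections over the image of `σ g`. -/
noncomputable def incl (g : Γ) : L2 F E (ContinuousMap.id N) ν →L[ℂ] L2 F E p μ :=
  wcomp (h.isAdmissible_incl g) fun _ => rfl

/-- Restriction of sections to the image of `σ g`. -/
noncomputable def proj (g : Γ) : L2 F E p μ →L[ℂ] L2 F E (ContinuousMap.id N) ν :=
  wcomp (p := ContinuousMap.id N) (h.isAdmissible_proj g) fun x => h.right_inv g x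

/-- The action of `Γ` on square-integrable sections. -/
noncomputable def action (hp : ∀ (g : Γ) (y : M), p (g • y) = p y) (g : Γ) :
    L2 F E p μ →L[ℂ] L2 F E p μ :=
  wcomp (isAdmissible_of_measurePreserving (h.measurePreserving g⁻¹)) fun y => hp g⁻¹ y

lemma rep_incl (g : Γ) (f : L2 F E (ContinuousMap.id N) ν) : ∀ᵐ y ∂μ, (h.incl g f).rep y =
    (range (σ g)).indicator (fun _ => (1 : ℂ)) y • baseRep f (p y) :=
  rep_wcomp (h.isAdmissible_incl g) (fun _ => rfl) f

lemma rep_proj (g : Γ) (u : L2 F E p μ) : ∀ᵐ x ∂ν,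
    baseRep (h.proj g u) x = fiberCast (h.right_inv g x) (u.rep (σ g x)) := by
  filter_upwards [rep_wcomp (p := ContinuousMap.id N) (h.isAdmissible_proj g)
    (fun x => h.right_inv g x) u] with x hx
  exact hx.trans (one_smul _ _)

lemma rep_action (hp : ∀ (g : Γ) (y : M), p (g • y) = p y) (g : Γ) (u : L2 F E p μ) :
    ∀ᵐ y ∂μ, (h.action hp g u).rep y = translate hp g u.rep y := by
  filter_upwards [rep_wcomp (isAdmissible_of_measurePreserving (h.measurePreserving g⁻¹))
    (fun y => hp g⁻¹ y) u] with x hx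
  exact hx.trans (one_smul _ _)

lemma ae_of_ae_comp (g : Γ) {P : M → Prop} (hae : ∀ᵐ y ∂μ, P y) : ∀ᵐ x ∂ν, P (σ g x) := by
  filter_upwards [(h.isAdmissible_proj g).ae hae] with x hx using hx one_ne_zero

lemma ae_range (g : Γ) {P : N → Prop} (hae : ∀ᵐ x ∂ν, P x) :
    ∀ᵐ y ∂μ, y ∈ range (σ g) → P (p y) := by
  filter_upwards [(h.isAdmissible_incl g).ae hae] with y hy hyr
  exact hy (by simp [hyr])

/-- The integrand lives on the tile `range (σ g)`, where `μ` is the image of `ν` under `σ g`. -/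
lemma inner_incl_left (g : Γ) (f : L2 F E (ContinuousMap.id N) ν) (v : L2 F E p μ) :
    inner ℂ (h.incl g f) v = inner ℂ f (h.proj g v) := by
  rw [L2.inner_eq, L2.inner_eq]
  have hint := (h.incl g f : L2 F E p μ).memL2_rep.integrable_inner v.memL2_rep
  have h1 : ∫ y, inner ℂ ((h.incl g f : L2 F E p μ).rep y) (v.rep y) ∂μ =
      ∫ y in range (σ g), inner ℂ ((h.incl g f : L2 F E p μ).rep y) (v.rep y) ∂μ := by
    rw [← integral_indicator (h.measurableSet_range g)]
    refine integral_congr_ae ?_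
    filter_upwards [h.rep_incl g f] with y hy
    by_cases hyr : y ∈ range (σ g)
    · rw [indicator_of_mem hyr]
    · rw [indicator_of_notMem hyr, hy, indicator_of_notMem hyr, zero_smul, inner_zero_left]
  have hm : AEStronglyMeasurable
      (fun y => inner ℂ ((h.incl g f : L2 F E p μ).rep y) (v.rep y)) (ν.map (σ g)) := by
    rw [h.map_eq]
    exact hint.1.restrict
  rw [h1, ← h.map_eq, integral_map (h.measurable g).aemeasurable hm]
  refine integral_congr_ae ?_
  filter_upwards [h.rep_proj g v, h.ae_of_ae_comp g (h.rep_incl g f)] with x hx hx'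
  change _ = inner ℂ (baseRep f x) (baseRep (h.proj g v) x)
  rw [hx, hx', indicator_of_mem (mem_range_self x), one_smul,
    ← inner_fiberCast (h.right_inv g x)]
  congr 1
  exact fiberCast_section (baseRep f) (h.right_inv g x) _

/-- Disjointness of the tiles gives orthogonality and their covering `M` gives totality.
Countability of `Γ` serves to merge the exceptional null sets of all tiles into one. -/
lemma isFrame [Countable Γ] (hp : ∀ (g : Γ) (y : M), p (g • y) = p y) :
    IsFrame (H₀ := L2 F E (ContinuousMap.id N) ν) (H := L2 F E p μ) (h.action hp) h.incl
      h.proj where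
  inner_left := h.inner_incl_left
  proj_self g f := by
    refine L2.ext_rep ?_
    filter_upwards [h.rep_proj g (h.incl g f), h.ae_of_ae_comp g (h.rep_incl g f)]
      with x hx hx'
    change baseRep (h.proj g (h.incl g f)) x = baseRep f x
    rw [hx, hx', indicator_of_mem (mem_range_self x), one_smul]
    exact fiberCast_section (baseRep f) (h.right_inv g x) _
  proj_of_ne g k f hgk := by
    refine L2.ext_rep ?_
    filter_upwards [h.rep_proj g (h.incl k f), h.ae_of_ae_comp g (h.rep_incl k f),
      L2.rep_zero (F := F) (E := E) (p := ContinuousMap.id N)] with x hx hx' hx0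
    change baseRep (h.proj g (h.incl k f)) x = _
    rw [hx, hx', indicator_of_notMem, zero_smul, hx0]
    · exact fiberCast_zero _
    · rw [h.mem_range_iff, h.right_inv]
      exact fun hcon => hgk (h.injective k g x hcon).symm
  total v hv := by
    refine L2.ext_rep ?_
    have hg : ∀ g, ∀ᵐ y ∂μ, y ∈ range (σ g) → v.rep y = 0 := fun g => by
      have h1 : ∀ᵐ x ∂ν, v.rep (σ g x) = 0 := by
        filter_upwards [h.rep_proj g v, L2.rep_congr (hv g), L2.rep_zero (F := F) (E := E) (p := ContinuousMap.id N)] with x hx hx' hx0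
        change baseRep (h.proj g v) x = _ at hx'
        rw [hx', hx0] at hx
        exact (fiberCast_eq_zero _).1 hx.symm
      filter_upwards [h.ae_range g h1] with y hy hyr
      have := hy hyr
      rwa [h.mem_range_iff.1 hyr] at this
    filter_upwards [ae_all_iff.2 hg, L2.rep_zero (F := F) (E := E) (p := p)] with y hy hy0
    obtain ⟨g, hg⟩ := h.exists_eq y
    rw [hy g (h.mem_range_iff.2 hg), hy0]
  translate_incl g k f := by
    refine L2.ext_rep ?_
    filter_upwards [h.rep_action hp g (h.incl k f), h.rep_incl (g * k) f,
      (h.measurePreserving g⁻¹).quasiMeasurePreserving.ae (h.rep_incl k f)] with y hy hy' hy''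
    have hiff : g⁻¹ • y ∈ range (σ k) ↔ y ∈ range (σ (g * k)) := by
      rw [h.mem_range_iff, h.mem_range_iff, h.mul_eq, hp, eq_inv_smul_iff]
    rw [hy, hy', translate, hy'', fiberCast_smul]
    congr 1
    · by_cases hyr : y ∈ range (σ (g * k))
      · rw [indicator_of_mem (hiff.2 hyr), indicator_of_mem hyr]
      · rw [indicator_of_notMem (mt hiff.1 hyr), indicator_of_notMem hyr]
    · exact fiberCast_section (baseRep f) (hp _ _) _
  proj_translate g k v := by
    refine L2.ext_rep ?_
    filter_upwards [h.rep_proj (g * k) (h.action hp g v), h.rep_proj k v,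
      h.ae_of_ae_comp (g * k) (h.rep_action hp g v)] with x hx hx' hx''
    change baseRep (h.proj (g * k) (h.action hp g v)) x = baseRep (h.proj k v) x
    rw [hx, hx', hx'', translate, fiberCast_fiberCast]
    have e1 : σ k x = g⁻¹ • σ (g * k) x := by rw [h.mul_eq, inv_smul_smul]
    rw [← fiberCast_section v.rep e1 ((h.right_inv k x).trans
      (((hp _ _).trans (h.right_inv (g * k) x)).symm)), fiberCast_fiberCast]

lemma isEquivariant_iff (hp : ∀ (g : Γ) (y : M), p (g • y) = p y) (T : L2 F E p μ →L[ℂ] L2 F E p μ) :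
    IsEquivariant hp T ↔ CommutesWith (h.action hp) T := by
  constructor
  · intro hT g u
    refine L2.ext_rep ?_
    filter_upwards [hT g u _ (h.rep_action hp g u), h.rep_action hp g (T u)] with y hy hy'
    rw [hy, hy']
  · intro hT g u v hv
    have : v = h.action hp g u := by
      refine L2.ext_rep ?_
      filter_upwards [hv, h.rep_action hp g u] with y hy hy'
      rw [hy, hy']
    rw [this, hT]
    exact h.rep_action hp g (T u)

end IsSectionSystem

end SectionSystem

/-! ### Translates of the lifted partition functions -/

namespace LiftedPartition

variable {M₁ N Γ₁ : Type*} [TopologicalSpace M₁] [TopologicalSpace N]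
  [Group Γ₁] [MulAction Γ₁ M₁] {p₁ : C(M₁, N)} {ι : Type} (P : LiftedPartition p₁ ι)

lemma φ₁_mul (g k : Γ₁) (i : ι) (y : M₁) : P.φ₁ (g * k) i y = P.φ₁ k i (g⁻¹ • y) := by
  rw [φ₁, φ₁, mul_inv_rev, mul_smul]

lemma φ₁_eq (g : Γ₁) (i : ι) (y : M₁) : P.φ₁ g i y = P.φ₁ (1 : Γ₁) i (g⁻¹ • y) := by
  rw [← φ₁_mul, mul_one]

lemma φ₁_nonneg (g : Γ₁) (i : ι) (y : M₁) : 0 ≤ P.φ₁ g i y :=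
  indicator_nonneg (fun _ _ => P.φ.nonneg i _) _

lemma φ₁_le_one (g : Γ₁) (i : ι) (y : M₁) : P.φ₁ g i y ≤ 1 :=
  indicator_le_self' (f := fun y => P.φ i (p₁ y)) (fun _ _ => P.φ.nonneg i _) _ |>.trans
    (P.φ.le_one i _)

lemma enorm_φ₁_le (g : Γ₁) (i : ι) (y : M₁) : ‖(P.φ₁ g i y : ℂ)‖ₑ ≤ (1 : NNReal) := by
  rw [enorm_eq_nnnorm, ENNReal.coe_le_coe, ← NNReal.coe_le_coe, coe_nnnorm, Complex.norm_real,
    Real.norm_eq_abs, abs_of_nonneg (P.φ₁_nonneg g i y)]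
  exact P.φ₁_le_one g i y

lemma mem_sheet_iff {g : Γ₁} {i : ι} {y : M₁} : y ∈ P.sheet g i ↔ g⁻¹ • y ∈ P.lift i := by
  constructor
  · rintro ⟨z, hz, rfl⟩
    simpa using hz
  · exact fun h => ⟨_, h, smul_inv_smul g y⟩

variable (hp : ∀ (g : Γ₁) (y : M₁), p₁ (g • y) = p₁ y)
include hp

lemma φ₁_of_mem {g : Γ₁} {i : ι} {y : M₁} (hy : y ∈ P.sheet g i) :
    P.φ₁ g i y = P.φ i (p₁ y) := by
  rw [φ₁, indicator_of_mem (P.mem_sheet_iff.1 hy), hp]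

omit hp in
lemma φ₁_of_notMem {g : Γ₁} {i : ι} {y : M₁} (hy : y ∉ P.sheet g i) : P.φ₁ g i y = 0 := by
  rw [φ₁, indicator_of_notMem (mt P.mem_sheet_iff.2 hy)]

lemma injOn_sheet (g : Γ₁) (i : ι) : InjOn p₁ (P.sheet g i) := by
  intro y hy z hz hyz
  have := (P.bijOn i).injOn (P.mem_sheet_iff.1 hy) (P.mem_sheet_iff.1 hz) (by rw [hp, hp, hyz])
  exact smul_left_cancel _ this

omit hp in
lemma measurable_φ₁ [MeasurableSpace M₁] [BorelSpace M₁] {g : Γ₁}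
    (hg : Measurable fun y : M₁ => g⁻¹ • y) (i : ι) : Measurable fun y => (P.φ₁ g i y : ℂ) := by
  refine Complex.measurable_ofReal.comp (Measurable.comp ?_ hg)
  exact (((P.φ i).continuous.comp p₁.continuous).measurable).indicator
    (P.isOpen_lift i).measurableSet

end LiftedPartition

/-! ### The partition of unity as a cutoff, and the terms of the folding sum -/

section Cutoff

lemma smul_fiberCast_eq_zero {N : Type*} {E : N → Type*} [∀ x, NormedAddCommGroup (E x)]
    [∀ x, InnerProductSpace ℂ (E x)] {x x' : N} (h : x = x') (c : ℂ) {v : E x} (hv : v = 0) :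
    c • fiberCast h v = 0 := by
  subst h; rw [hv]; exact smul_zero c

lemma fiberCast_section_congr {N M : Type*} {E : N → Type*} {p : M → N} (s : ∀ y, E (p y))
    {y y' : M} (h : y = y') {x : N} (hx : p y = x) (hx' : p y' = x) :
    fiberCast hx (s y) = fiberCast hx' (s y') := by
  subst h; rfl

variable {N : Type*} [TopologicalSpace N] [MeasurableSpace N] [BorelSpace N]
  {F : Type*} [NormedAddCommGroup F] [NormedSpace ℂ F]
  {E : N → Type*} [TopologicalSpace (TotalSpace F E)] [∀ x, NormedAddCommGroup (E x)]
  [∀ x, InnerProductSpace ℂ (E x)] [FiberBundle F E] [VectorBundle ℂ F E]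
  [FiniteDimensional ℂ F] [ContinuousHermitianBundle F E] [CompactSpace N]
  {M₁ : Type*} [TopologicalSpace M₁] [MeasurableSpace M₁] [BorelSpace M₁]
  {M₂ : Type*} [TopologicalSpace M₂] [MeasurableSpace M₂] [BorelSpace M₂]
  {Γ₁ Γ₂ : Type*} [Group Γ₁] [Group Γ₂] [MulAction Γ₁ M₁] [MulAction Γ₂ M₂]
  {p₁ : C(M₁, N)} {p₂ : C(M₂, N)} {ν : Measure N} {μ₁ : Measure M₁} {μ₂ : Measure M₂}
  {σ₁ : Γ₁ → N → M₁} {σ₂ : Γ₂ → N → M₂} {ι : Type}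

/-- Multiplication by `φ_i^g` on square-integrable sections. -/
noncomputable def mulφ (h₁ : IsSectionSystem p₁ ν μ₁ σ₁) (P : LiftedPartition p₁ ι) (g : Γ₁)
    (i : ι) : L2 F E p₁ μ₁ →L[ℂ] L2 F E p₁ μ₁ :=
  wcomp (isAdmissible_id (P.measurable_φ₁ (h₁.measurePreserving g⁻¹).measurable i)
    (P.enorm_φ₁_le g i)) fun _ => rfl

variable (h₁ : IsSectionSystem p₁ ν μ₁ σ₁) (h₂ : IsSectionSystem p₂ ν μ₂ σ₂)
  (P : LiftedPartition p₁ ι)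

lemma rep_mulφ (g : Γ₁) (i : ι) (u : L2 F E p₁ μ₁) :
    ∀ᵐ y ∂μ₁, (mulφ h₁ P g i u).rep y = (P.φ₁ g i y : ℂ) • u.rep y :=
  rep_wcomp (isAdmissible_id (P.measurable_φ₁ (h₁.measurePreserving g⁻¹).measurable i)
    (P.enorm_φ₁_le g i)) (fun _ => rfl) u

lemma IsSectionSystem.incl_proj_of_forall {t : Γ₁} {v : L2 F E p₁ μ₁}
    (hv : ∀ᵐ y ∂μ₁, y ∉ range (σ₁ t) → v.rep y = 0) : h₁.incl t (h₁.proj t v) = v := by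
  refine L2.ext_rep ?_
  filter_upwards [hv, h₁.rep_incl t (h₁.proj t v), h₁.ae_range t (h₁.rep_proj t v)]
    with y hy hy' hy''
  rw [hy']
  by_cases hyr : y ∈ range (σ₁ t)
  · rw [indicator_of_mem hyr, one_smul, hy'' hyr]
    exact fiberCast_section v.rep (h₁.mem_range_iff.1 hyr) _
  · rw [indicator_of_notMem hyr, zero_smul, hy hyr]

variable [Fintype ι] {A : Finset Γ₁}
  (hA : ∀ b x i, P.φ₁ (1 : Γ₁) i (σ₁ b x) ≠ 0 → b ∈ A)
include hA

omit [MeasurableSpace N] [BorelSpace N] [CompactSpace N] [MeasurableSpace M₁] [BorelSpace M₁]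
  [Fintype ι] in
lemma mem_of_φ₁_ne_zero (hσ : ∀ g k x, σ₁ (g * k) x = g • σ₁ k x) {g b : Γ₁} {x : N} {i : ι}
    (h : P.φ₁ g i (σ₁ b x) ≠ 0) : g⁻¹ * b ∈ A := by
  rw [P.φ₁_eq, ← hσ] at h
  exact hA _ _ _ h

/-- Multiplication operators preserve every tile, hence are diagonal, and `hA` bounds the tiles they
meet. The sum is the identity because each fibre over the support of `φ i` meets the lift in exactly
one point, so the translates of `φ_i` add up to `φ i ∘ p₁`. -/
lemma isCutoff_mulφ (hp : ∀ (g : Γ₁) (y : M₁), p₁ (g • y) = p₁ y) :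
    IsCutoff (H₀ := L2 F E (ContinuousMap.id N) ν) (H₁ := L2 F E p₁ μ₁) (h₁.action hp) h₁.incl
      h₁.proj (fun g => ∑ i, mulφ h₁ P g i) A where
  translate g k v := by
    simp only [sum_apply, map_sum]
    refine Finset.sum_congr rfl fun i _ => L2.ext_rep ?_
    filter_upwards [rep_mulφ h₁ P (g * k) i (h₁.action hp g v), h₁.rep_action hp g v,
      h₁.rep_action hp g (mulφ h₁ P k i v),
      (h₁.measurePreserving g⁻¹).quasiMeasurePreserving.ae (rep_mulφ h₁ P k i v)]
      with y hy hy' hy'' hy3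
    rw [hy, hy', hy'', translate, translate, hy3, P.φ₁_mul, fiberCast_smul]
  diag g t f := by
    symm
    refine h₁.incl_proj_of_forall ?_
    rw [sum_apply]
    have h3 : ∀ i, ∀ᵐ y ∂μ₁, y ∉ range (σ₁ t) → (mulφ h₁ P g i (h₁.incl t f)).rep y = 0 := by
      intro i
      filter_upwards [rep_mulφ h₁ P g i (h₁.incl t f), h₁.rep_incl t f] with y hy hy' hyr
      rw [hy, hy', indicator_of_notMem hyr, zero_smul, smul_zero]
    generalize (Finset.univ : Finset ι) = I
    classical
    induction I using Finset.induction_on with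
    | empty =>
      rw [Finset.sum_empty]
      filter_upwards [L2.rep_zero (F := F) (E := E) (p := p₁)] with y hy _ using hy
    | insert a I ha ih =>
      rw [Finset.sum_insert ha]
      filter_upwards [ih, h3 a, L2.rep_add (mulφ h₁ P g a (h₁.incl t f))
        (∑ i ∈ I, mulφ h₁ P g i (h₁.incl t f))] with y hy hy' hy'' hyr
      rw [hy'', hy hyr, hy' hyr, add_zero]
  eq_zero g t f hgt := by
    rw [sum_apply]
    refine Finset.sum_eq_zero fun i _ => L2.ext_rep ?_
    filter_upwards [rep_mulφ h₁ P g i (h₁.incl t f), h₁.rep_incl t f,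
      L2.rep_zero (F := F) (E := E) (p := p₁)] with y hy hy' hy0
    rw [hy, hy', hy0]
    by_cases hyr : y ∈ range (σ₁ t)
    · have : P.φ₁ g i y = 0 := by
        by_contra hcon
        rw [← h₁.mem_range_iff.1 hyr] at hcon
        exact hgt (mem_of_φ₁_ne_zero P hA h₁.mul_eq hcon)
      rw [this, Complex.ofReal_zero, zero_smul]
    · rw [indicator_of_notMem hyr, zero_smul, smul_zero]
  sum_eq f := by
    -- The value of `φ_i` for `b⁻¹` at the point over `x` in the tile of `1` is the value for `1` at
    -- the point in the tile of `b`, and only one tile contains the point of the lift over `x`.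
    have h3 : ∀ i (x : N), ∑ b ∈ A, P.φ₁ b⁻¹ i (σ₁ 1 x) = P.φ i x := by
      intro i x
      have h4 : ∀ b, P.φ₁ b⁻¹ i (σ₁ 1 x) = P.φ₁ (1 : Γ₁) i (σ₁ b x) := fun b => by
        rw [P.φ₁_eq, inv_inv, ← h₁.mul_eq, mul_one]
      simp only [h4]
      by_cases hx : P.φ i x = 0
      · rw [hx]
        refine Finset.sum_eq_zero fun b _ => ?_
        by_cases hb : σ₁ b x ∈ P.sheet (1 : Γ₁) i
        · rw [P.φ₁_of_mem hp hb, h₁.right_inv, hx]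
        · rw [P.φ₁_of_notMem hb]
      · have hxU : x ∈ P.U i := P.isSubordinate i (subset_tsupport _ hx)
        obtain ⟨y, hy, rfl⟩ := (P.bijOn i).surjOn hxU
        obtain ⟨b, hb⟩ := h₁.exists_eq y
        have hyS : y ∈ P.sheet (1 : Γ₁) i := P.mem_sheet_iff.2 (by simpa using hy)
        have hval : P.φ₁ (1 : Γ₁) i (σ₁ b (p₁ y)) = P.φ i (p₁ y) := by
          rw [hb, P.φ₁_of_mem hp hyS]
        rw [Finset.sum_eq_single b, hval]
        · intro c _ hcb
          refine P.φ₁_of_notMem fun hc => hcb ?_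
          refine h₁.injective c b (p₁ y) (P.injOn_sheet hp 1 i hc (by rwa [hb]) ?_)
          rw [h₁.right_inv, h₁.right_inv]
        · intro hbA
          by_contra hcon
          exact hbA (hA b _ i hcon)
    simp only [sum_apply]
    rw [Finset.sum_comm]
    have hone : ∀ x, ∑ i, P.φ i x = 1 := fun x => by
      have := P.φ.sum_eq_one (mem_univ x)
      rwa [finsum_eq_sum_of_fintype] at this
    have hsum : ∀ (B : Finset (ι × Γ₁)), ∀ᵐ y ∂μ₁,
        (∑ k ∈ B, mulφ h₁ P k.2⁻¹ k.1 (h₁.incl 1 f)).rep y =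
          (∑ k ∈ B, (P.φ₁ k.2⁻¹ k.1 y : ℂ)) • (h₁.incl 1 f).rep y := by
      classical
      intro B
      induction B using Finset.induction_on with
      | empty =>
        filter_upwards [L2.rep_zero (F := F) (E := E) (p := p₁)] with y hy
        rw [Finset.sum_empty, Finset.sum_empty, zero_smul, hy]
      | insert a B ha ih =>
        filter_upwards [ih, rep_mulφ h₁ P a.2⁻¹ a.1 (h₁.incl 1 f),
          L2.rep_add (mulφ h₁ P a.2⁻¹ a.1 (h₁.incl 1 f))
          (∑ k ∈ B, mulφ h₁ P k.2⁻¹ k.1 (h₁.incl 1 f))] with y hy hy' hy''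
        rw [Finset.sum_insert ha, Finset.sum_insert ha, hy'', hy, hy', add_smul]
    rw [← Finset.sum_product']
    refine L2.ext_rep ?_
    filter_upwards [hsum (Finset.univ ×ˢ A), h₁.rep_incl 1 f] with y hy hy'
    rw [hy]
    by_cases hyr : y ∈ range (σ₁ 1)
    · rw [Finset.sum_product]
      have : ∑ i, ∑ b ∈ A, (P.φ₁ b⁻¹ i y : ℂ) = 1 := by
        rw [← h₁.mem_range_iff.1 hyr]
        exact_mod_cast (Finset.sum_congr rfl fun i _ => h3 i (p₁ y)).trans (hone (p₁ y))
      rw [this, one_smul]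
    · rw [hy', indicator_of_notMem hyr, zero_smul, smul_zero]

variable {ϖ : C(M₁, M₂)} (hϖ : ∀ y, p₂ (ϖ y) = p₁ y) {q : Γ₁ →* Γ₂}
  (hσ : ∀ g x, σ₂ (q g) x = ϖ (σ₁ g x)) (hp : ∀ (g : Γ₁) (y : M₁), p₁ (g • y) = p₁ y)
include h₁ h₂ hσ hp

-- A sheet need not lie in one tile. On its part in the tile of `s * b`, pulling back along `ϖ`
-- amounts to restricting to the tile of `q (s * b)` in `M₂`, regarding the result as a section over
-- `N`, and placing it on the tile of `s * b` in `M₁`.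
omit [Fintype ι] in
lemma pulledPiece_eq_sum (s : Γ₁) (j : ι) (u : ∀ x, E (p₂ x)) :
    pulledPiece hϖ P s j u = ∑ b ∈ A, wcompSec (p := p₁) (p' := p₁) (τ := id) (fun _ => rfl)
      (fun y => (P.φ₁ s j y : ℂ)) (wcompSec (p := p₁) (p' := ContinuousMap.id N) (τ := p₁)
        (fun _ => rfl) ((range (σ₁ (s * b))).indicator fun _ => (1 : ℂ))
        (wcompSec (p := ContinuousMap.id N) (p' := p₂) (h₂.right_inv (q (s * b))) (fun _ => 1)
          u)) := by
  funext y
  rw [Finset.sum_apply]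
  simp only [wcompSec, id, fiberCast_rfl, one_smul]
  have hL : pulledPiece hϖ P s j u y = (P.φ₁ s j y : ℂ) • fiberCast (hϖ y) (u (ϖ y)) := by
    by_cases hy : y ∈ P.sheet s j
    · rw [pulledPiece, pullSection, if_pos hy, fiberCast_smul, LiftedPartition.φ₂,
        indicator_of_mem (show ϖ y ∈ P.sheet₂ ϖ s j from mem_image_of_mem ϖ hy), P.φ₁_of_mem hp hy]
      have : P.φ j (p₂ (ϖ y)) = P.φ j (p₁ y) := by rw [hϖ]
      rw [this]
    · rw [pulledPiece, pullSection, if_neg hy, P.φ₁_of_notMem hy, Complex.ofReal_zero, zero_smul]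
  rw [hL]
  by_cases hφ : P.φ₁ s j y = 0
  · simp [hφ]
  obtain ⟨a, ha⟩ := h₁.exists_eq y
  have haA : s⁻¹ * a ∈ A := mem_of_φ₁_ne_zero P hA h₁.mul_eq (by rwa [ha])
  rw [Finset.sum_eq_single_of_mem _ haA]
  · have hr : y ∈ range (σ₁ (s * (s⁻¹ * a))) := by
      rw [mul_inv_cancel_left]; exact h₁.mem_range_iff.2 ha
    rw [indicator_of_mem hr, one_smul]
    congr 1
    refine (fiberCast_section_congr u ?_ _ _).symm
    rw [hσ, mul_inv_cancel_left, ha]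
  · intro b _ hb
    rw [indicator_of_notMem, zero_smul]
    · exact smul_zero _
    · rw [h₁.mem_range_iff]
      intro hcon
      have := h₁.injective _ _ _ (hcon.trans ha.symm)
      exact hb (by rw [← this, inv_mul_cancel_left])

-- At most one `b` contributes at each `x`: a contributing point of the tile of `g * b` lies in the
-- sheet over `p₂ x`, and `p₁` is injective there. That point is therefore the preimage chosen in
-- `pushSection`.
omit [Fintype ι] in
lemma pushedPiece_eq_sum (g : Γ₁) (i : ι) (v : ∀ y, E (p₁ y)) :
    pushedPiece hϖ P g i v = ∑ b ∈ A, wcompSec (p := p₂) (p' := ContinuousMap.id N) (τ := p₂)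
      (fun _ => rfl) ((range (σ₂ (q (g * b)))).indicator fun _ => (1 : ℂ))
      (wcompSec (p := ContinuousMap.id N) (p' := p₁) (h₁.right_inv (g * b)) (fun _ => 1)
        (wcompSec (p := p₁) (p' := p₁) (τ := id) (fun _ => rfl)
          (fun y => (P.φ₁ g i y : ℂ)) v)) := by
  funext x
  rw [Finset.sum_apply]
  simp only [wcompSec, id, fiberCast_rfl, one_smul]
  have hmem : ∀ b, x ∈ range (σ₂ (q (g * b))) → P.φ₁ g i (σ₁ (g * b) (p₂ x)) ≠ 0 →
      σ₁ (g * b) (p₂ x) ∈ P.sheet g i ∧ ϖ (σ₁ (g * b) (p₂ x)) = x := fun b hb hφ => by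
    refine ⟨by_contra fun hcon => hφ (P.φ₁_of_notMem hcon), ?_⟩
    rw [← hσ, h₂.mem_range_iff.1 hb]
  by_cases hx : ∃ y ∈ P.sheet g i, ϖ y = x
  · obtain ⟨hy, hyx⟩ := hx.choose_spec
    rw [pushedPiece, pushSection, dif_pos hx]
    set y := hx.choose
    have hpy : p₁ y = p₂ x := by rw [← hϖ, hyx]
    have huniq : ∀ b, x ∈ range (σ₂ (q (g * b))) → P.φ₁ g i (σ₁ (g * b) (p₂ x)) ≠ 0 →
        σ₁ (g * b) (p₂ x) = y := fun b hb hφ =>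
      P.injOn_sheet hp g i (hmem b hb hφ).1 hy (by rw [h₁.right_inv, hpy])
    obtain ⟨a, ha⟩ := h₁.exists_eq y
    rw [hpy] at ha
    by_cases hφ : P.φ₁ g i y = 0
    · rw [hφ, Complex.ofReal_zero, zero_smul, Finset.sum_eq_zero]
      · exact fiberCast_zero _
      · intro b _
        by_cases hb : x ∈ range (σ₂ (q (g * b)))
        · have : P.φ₁ g i (σ₁ (g * b) (p₂ x)) = 0 := by
            by_contra hcon
            rw [huniq b hb hcon] at hcon
            exact hcon hφ
          exact smul_fiberCast_eq_zero _ _ (by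
            rw [this, Complex.ofReal_zero, zero_smul]; exact fiberCast_zero _)
        · rw [indicator_of_notMem hb, zero_smul]
    have haA : g⁻¹ * a ∈ A := mem_of_φ₁_ne_zero P hA h₁.mul_eq (by rwa [ha])
    rw [Finset.sum_eq_single_of_mem _ haA]
    · have hr : x ∈ range (σ₂ (q (g * (g⁻¹ * a)))) := by
        rw [mul_inv_cancel_left, h₂.mem_range_iff, hσ, ha, hyx]
      rw [indicator_of_mem hr, one_smul]
      exact fiberCast_section_congr (fun y => (P.φ₁ g i y : ℂ) • v y)
        (by rw [mul_inv_cancel_left]; exact ha.symm) hpy _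
    · intro b _ hb
      by_cases hr : x ∈ range (σ₂ (q (g * b)))
      · have : P.φ₁ g i (σ₁ (g * b) (p₂ x)) = 0 := by
          by_contra hcon
          refine hb ?_
          rw [← h₁.injective _ _ _ ((huniq b hr hcon).trans ha.symm), inv_mul_cancel_left]
        exact smul_fiberCast_eq_zero _ _ (by
            rw [this, Complex.ofReal_zero, zero_smul]; exact fiberCast_zero _)
      · rw [indicator_of_notMem hr, zero_smul]
  · rw [pushedPiece, pushSection, dif_neg hx, Finset.sum_eq_zero]
    intro b _
    by_cases hb : x ∈ range (σ₂ (q (g * b)))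
    · have : P.φ₁ g i (σ₁ (g * b) (p₂ x)) = 0 := by
        by_contra hcon
        exact hx ⟨_, hmem b hb hcon⟩
      exact smul_fiberCast_eq_zero _ _ (by
            rw [this, Complex.ofReal_zero, zero_smul]; exact fiberCast_zero _)
    · rw [indicator_of_notMem hb, zero_smul]

omit [Fintype ι] in
lemma memL2_pulledPiece (s : Γ₁) (j : ι) {u : ∀ x, E (p₂ x)} (hu : MemL2 F E p₂ μ₂ u) :
    MemL2 F E p₁ μ₁ (pulledPiece hϖ P s j u) := by
  rw [pulledPiece_eq_sum h₁ h₂ P hA hϖ hσ hp]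
  exact memL2_sum fun b _ => ((hu.wcomp (p := ContinuousMap.id N)
    (h₂.isAdmissible_proj (q (s * b))) (h₂.right_inv _)).wcomp (h₁.isAdmissible_incl (s * b))
    (fun _ => rfl)).wcomp (isAdmissible_id (P.measurable_φ₁
      (h₁.measurePreserving s⁻¹).measurable j) (P.enorm_φ₁_le s j)) fun _ => rfl

omit [Fintype ι] in
lemma memL2_pushedPiece (g : Γ₁) (i : ι) {v : ∀ y, E (p₁ y)} (hv : MemL2 F E p₁ μ₁ v) :
    MemL2 F E p₂ μ₂ (pushedPiece hϖ P g i v) := by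
  rw [pushedPiece_eq_sum h₁ h₂ P hA hϖ hσ hp]
  exact memL2_sum fun b _ => ((hv.wcomp (isAdmissible_id (P.measurable_φ₁
      (h₁.measurePreserving g⁻¹).measurable i) (P.enorm_φ₁_le g i)) fun _ => rfl).wcomp
    (p := ContinuousMap.id N) (h₁.isAdmissible_proj (g * b)) (h₁.right_inv _)).wcomp
    (h₂.isAdmissible_incl (q (g * b))) (fun _ => rfl)

omit [Fintype ι] in
lemma toL2_pulledPiece (s : Γ₁) (j : ι) (u : L2 F E p₂ μ₂) :
    (toL2 (pulledPiece hϖ P s j u.rep) : L2 F E p₁ μ₁) =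
      ∑ b ∈ A, mulφ h₁ P s j (h₁.incl (s * b) (h₂.proj (q (s * b)) u)) := by
  have hm := fun b => u.memL2_rep.wcomp (p := ContinuousMap.id N)
    (h₂.isAdmissible_proj (q (s * b))) (h₂.right_inv _)
  have hm' := fun b => (hm b).wcomp (h₁.isAdmissible_incl (s * b)) (fun _ => rfl)
  rw [pulledPiece_eq_sum h₁ h₂ P hA hϖ hσ hp, toL2_sum fun b _ => (hm' b).wcomp
    (isAdmissible_id (P.measurable_φ₁ (h₁.measurePreserving s⁻¹).measurable j)
      (P.enorm_φ₁_le s j)) fun _ => rfl]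
  refine Finset.sum_congr rfl fun b _ => ?_
  exact (wcomp_toL2 _ _ (hm' b)).symm.trans (congrArg (mulφ h₁ P s j)
    ((wcomp_toL2 _ _ (hm b)).symm.trans (congrArg (h₁.incl _) (wcomp_eq _ _ u).symm)))

omit [Fintype ι] in
lemma toL2_pushedPiece (g : Γ₁) (i : ι) (v : L2 F E p₁ μ₁) :
    (toL2 (pushedPiece hϖ P g i v.rep) : L2 F E p₂ μ₂) =
      ∑ b ∈ A, h₂.incl (q (g * b)) (h₁.proj (g * b) (mulφ h₁ P g i v)) := by
  have hm := v.memL2_rep.wcomp (isAdmissible_id (P.measurable_φ₁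
    (h₁.measurePreserving g⁻¹).measurable i) (P.enorm_φ₁_le g i)) fun _ => rfl
  have hm' := fun b => hm.wcomp (p := ContinuousMap.id N) (h₁.isAdmissible_proj (g * b))
    (h₁.right_inv _)
  rw [pushedPiece_eq_sum h₁ h₂ P hA hϖ hσ hp, toL2_sum fun b _ => (hm' b).wcomp
    (h₂.isAdmissible_incl (q (g * b))) (fun _ => rfl)]
  refine Finset.sum_congr rfl fun b _ => ?_
  exact (wcomp_toL2 _ _ (hm' b)).symm.trans (congrArg (h₂.incl _)
    ((wcomp_toL2 _ _ hm).symm.trans (congrArg (h₁.proj _) (wcomp_eq _ _ v).symm)))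

lemma sum_foldingTerm (T : L2 F E p₁ μ₁ →L[ℂ] L2 F E p₁ μ₁) (u : L2 F E p₂ μ₂) (g s : Γ₁) :
    ∑ i, ∑ j, foldingTerm hϖ P T u g s i j = foldPiece (H₀ := L2 F E (ContinuousMap.id N) ν) q
      h₁.incl h₁.proj h₂.incl h₂.proj (fun g => ∑ i, mulφ h₁ P g i) A T u g s := by
  simp only [foldingTerm, foldPiece, toL2_pushedPiece h₁ h₂ P hA hϖ hσ hp,
    toL2_pulledPiece h₁ h₂ P hA hϖ hσ hp, sum_apply, map_sum]
  simp only [Finset.sum_comm (s := (Finset.univ : Finset ι)) (t := A)]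
  exact Finset.sum_congr rfl fun _ _ => Finset.sum_congr rfl fun _ _ => Finset.sum_comm

end Cutoff

/-! ### Local isometries in coordinates -/

section LocalIsometry

variable {n : ℕ}
  {M : Type*} [TopologicalSpace M] [ChartedSpace (EuclideanSpace ℝ (Fin n)) M]
  [RiemannianBundle (fun y : M => TangentSpace (𝓡 n) y)]
  {M' : Type*} [TopologicalSpace M'] [ChartedSpace (EuclideanSpace ℝ (Fin n)) M']
  [RiemannianBundle (fun y : M' => TangentSpace (𝓡 n) y)]

/-- A smooth map whose derivatives are isometric. -/
structure IsRiemannianIsometric (n : ℕ) {M : Type*} [TopologicalSpace M]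
    [ChartedSpace (EuclideanSpace ℝ (Fin n)) M]
    [RiemannianBundle (fun y : M => TangentSpace (𝓡 n) y)]
    {M' : Type*} [TopologicalSpace M'] [ChartedSpace (EuclideanSpace ℝ (Fin n)) M']
    [RiemannianBundle (fun y : M' => TangentSpace (𝓡 n) y)] (f : M → M') : Prop where
  contMDiff : ContMDiff (𝓡 n) (𝓡 n) 1 f
  inner_mfderiv : ∀ (y : M) (v w : TangentSpace (𝓡 n) y),
    inner ℝ (mfderiv (𝓡 n) (𝓡 n) f y v) (mfderiv (𝓡 n) (𝓡 n) f y w) = inner ℝ v w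

/-- Applied to the identity, the results on isometries in charts become the rules for changing
charts. -/
lemma isRiemannianIsometric_id : IsRiemannianIsometric n (id : M → M) where
  contMDiff := contMDiff_id
  inner_mfderiv y v w := by rw [mfderiv_id]; rfl

/-- The inner product of two coordinate vectors as vectors of the tangent space at `y`. -/
noncomputable def tangentInner (y : M) (v w : EuclideanSpace ℝ (Fin n)) : ℝ :=
  @inner ℝ (TangentSpace (𝓡 n) y) _ v w

lemma tangentInner_sum_left (y : M) {ι : Type*} (A : Finset ι) (c : ι → ℝ)
    (v : ι → EuclideanSpace ℝ (Fin n)) (w : EuclideanSpace ℝ (Fin n)) :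
    tangentInner y (∑ i ∈ A, c i • v i) w = ∑ i ∈ A, c i * tangentInner y (v i) w := by
  simp only [tangentInner]
  refine (sum_inner (𝕜 := ℝ) (E := TangentSpace (𝓡 n) y) A (fun i => c i • v i) w).trans ?_
  exact Finset.sum_congr rfl fun i _ => real_inner_smul_left (F := TangentSpace (𝓡 n) y) _ _ _

lemma tangentInner_sum_right (y : M) {ι : Type*} (A : Finset ι) (c : ι → ℝ)
    (v : ι → EuclideanSpace ℝ (Fin n)) (w : EuclideanSpace ℝ (Fin n)) :
    tangentInner y w (∑ i ∈ A, c i • v i) = ∑ i ∈ A, c i * tangentInner y w (v i) := by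
  simp only [tangentInner]
  refine (inner_sum (𝕜 := ℝ) (E := TangentSpace (𝓡 n) y) A (fun i => c i • v i) w).trans ?_
  exact Finset.sum_congr rfl fun i _ => real_inner_smul_right (F := TangentSpace (𝓡 n) y) _ _ _

variable [IsManifold (𝓡 n) ∞ M] [IsManifold (𝓡 n) ∞ M']

lemma mdifferentiableAt_chartAt_symm (x : M) {z : EuclideanSpace ℝ (Fin n)}
    (hz : z ∈ (chartAt (EuclideanSpace ℝ (Fin n)) x).target) :
    MDifferentiableAt (𝓡 n) (𝓡 n) (chartAt (EuclideanSpace ℝ (Fin n)) x).symm z :=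
  ((contMDiffOn_chart_symm (n := 1) (I := 𝓡 n) (x := x)).contMDiffAt
    ((chartAt (EuclideanSpace ℝ (Fin n)) x).open_target.mem_nhds hz)).mdifferentiableAt one_ne_zero

/-- The coordinate expression of a map. -/
noncomputable def inCharts (f : M → M') (x : M) (x' : M') (z : EuclideanSpace ℝ (Fin n)) :
    EuclideanSpace ℝ (Fin n) :=
  chartAt (EuclideanSpace ℝ (Fin n)) x' (f ((chartAt (EuclideanSpace ℝ (Fin n)) x).symm z))

variable {f : M → M'} (hf : IsRiemannianIsometric n f) {x : M} {x' : M'}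
  {z : EuclideanSpace ℝ (Fin n)} (hz : z ∈ (chartAt (EuclideanSpace ℝ (Fin n)) x).target)
  (hz' : f ((chartAt (EuclideanSpace ℝ (Fin n)) x).symm z) ∈
    (chartAt (EuclideanSpace ℝ (Fin n)) x').source)
include hf hz hz'

lemma IsRiemannianIsometric.contMDiffAt_inCharts :
    ContMDiffAt (𝓡 n) (𝓡 n) 1 (inCharts (n := n) f x x') z := by
  have h1 := (contMDiffOn_chart (n := 1) (I := 𝓡 n) (x := x')).contMDiffAt
    ((chartAt (EuclideanSpace ℝ (Fin n)) x').open_source.mem_nhds hz')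
  have h2 := (contMDiffOn_chart_symm (n := 1) (I := 𝓡 n) (x := x)).contMDiffAt
    ((chartAt (EuclideanSpace ℝ (Fin n)) x).open_target.mem_nhds hz)
  exact h1.comp z ((hf.contMDiff _).comp z h2)

lemma IsRiemannianIsometric.differentiableAt_inCharts :
    DifferentiableAt ℝ (inCharts (n := n) f x x') z :=
  (hf.contMDiffAt_inCharts hz hz').contDiffAt.differentiableAt one_ne_zero

/-- Both sides compute inner products of images under the derivative of `f ∘ c.symm`, which near `z`
is also `c'.symm` composed with the coordinate expression of `f`. -/
lemma IsRiemannianIsometric.tangentInner_eq (v w : EuclideanSpace ℝ (Fin n)) :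
    tangentInner ((chartAt (EuclideanSpace ℝ (Fin n)) x).symm z)
      (mfderiv (𝓡 n) (𝓡 n) (chartAt (EuclideanSpace ℝ (Fin n)) x).symm z v)
      (mfderiv (𝓡 n) (𝓡 n) (chartAt (EuclideanSpace ℝ (Fin n)) x).symm z w) =
    tangentInner ((chartAt (EuclideanSpace ℝ (Fin n)) x').symm (inCharts (n := n) f x x' z))
      (mfderiv (𝓡 n) (𝓡 n) (chartAt (EuclideanSpace ℝ (Fin n)) x').symm (inCharts (n := n) f x x' z)
        (fderiv ℝ (inCharts (n := n) f x x') z v))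
      (mfderiv (𝓡 n) (𝓡 n) (chartAt (EuclideanSpace ℝ (Fin n)) x').symm (inCharts (n := n) f x x' z)
        (fderiv ℝ (inCharts (n := n) f x x') z w)) := by
  set c := chartAt (EuclideanSpace ℝ (Fin n)) x with hc
  set c' := chartAt (EuclideanSpace ℝ (Fin n)) x' with hc'
  have hpt : c'.symm (inCharts (n := n) f x x' z) = f (c.symm z) := c'.left_inv hz'
  have htgt : inCharts (n := n) f x x' z ∈ c'.target := c'.map_source hz'
  have heq : (f ∘ c.symm) =ᶠ[𝓝 z] c'.symm ∘ inCharts (n := n) f x x' := by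
    have hcont : ContinuousAt (f ∘ c.symm) z :=
      hf.contMDiff.continuous.continuousAt.comp (c.continuousAt_symm hz)
    filter_upwards [hcont.preimage_mem_nhds (c'.open_source.mem_nhds hz')] with z' hz''
    exact (c'.left_inv hz'').symm
  have hd : ∀ v : EuclideanSpace ℝ (Fin n),
      (mfderiv (𝓡 n) (𝓡 n) f (c.symm z) (mfderiv (𝓡 n) (𝓡 n) c.symm z v) :
        EuclideanSpace ℝ (Fin n)) =
      mfderiv (𝓡 n) (𝓡 n) c'.symm (inCharts (n := n) f x x' z) (fderiv ℝ (inCharts (n := n) f x x') z v) := by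
    intro v
    have h1 := mfderiv_comp_apply z ((hf.contMDiff _).mdifferentiableAt one_ne_zero)
      (mdifferentiableAt_chartAt_symm x hz) v
    have h2 := mfderiv_comp_apply z (mdifferentiableAt_chartAt_symm x' htgt)
      ((hf.contMDiffAt_inCharts hz hz').mdifferentiableAt one_ne_zero) v
    rw [← mfderiv_eq_fderiv]
    refine h1.symm.trans (Eq.trans ?_ h2)
    have h3 := heq.mfderiv_eq (I := 𝓡 n) (I' := 𝓡 n)
    exact congrArg (fun L : EuclideanSpace ℝ (Fin n) →L[ℝ] EuclideanSpace ℝ (Fin n) => L v) h3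
  have hmove : ∀ (a b : M') (_ : a = b) (v w : EuclideanSpace ℝ (Fin n)),
      tangentInner a v w = tangentInner b v w := by rintro a _ rfl v w; rfl
  rw [← hd v, ← hd w]
  exact (hf.inner_mfderiv _ _ _).symm.trans (hmove _ _ hpt.symm _ _)

/-- The metric matrices are related by `G = Jᵀ G' J` with `J` the Jacobian matrix; take determinants
and square roots. -/
lemma IsRiemannianIsometric.sqrt_det_metricMatrix :
    Real.sqrt (metricMatrix n x z).det =
      |(fderiv ℝ (inCharts (n := n) f x x') z).det| *
        Real.sqrt (metricMatrix n x' (inCharts (n := n) f x x' z)).det := by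
  set φ := inCharts (n := n) f x x' with hφ
  set b := (EuclideanSpace.basisFun (Fin n) ℝ).toBasis with hb
  set J : Matrix (Fin n) (Fin n) ℝ := LinearMap.toMatrix b b (fderiv ℝ φ z).toLinearMap with hJ
  have hJdet : (fderiv ℝ φ z).det = J.det := by
    rw [hJ, LinearMap.det_toMatrix]
  have hexp : ∀ i, fderiv ℝ φ z (EuclideanSpace.single i 1) =
      ∑ k, J k i • EuclideanSpace.single k (1 : ℝ) := by
    intro i
    have h1 := (b.sum_repr (fderiv ℝ φ z (b i))).symm
    simpa [hb, hJ, LinearMap.toMatrix_apply] using h1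
  have hG : metricMatrix n x z = J.transpose * metricMatrix n x' (φ z) * J := by
    ext i j
    have h1 := hf.tangentInner_eq hz hz' (EuclideanSpace.single i 1) (EuclideanSpace.single j 1)
    have h2 : metricMatrix n x z i j = tangentInner
      ((chartAt (EuclideanSpace ℝ (Fin n)) x).symm z)
      (mfderiv (𝓡 n) (𝓡 n) (chartAt (EuclideanSpace ℝ (Fin n)) x).symm z
        (EuclideanSpace.single i 1))
      (mfderiv (𝓡 n) (𝓡 n) (chartAt (EuclideanSpace ℝ (Fin n)) x).symm z
        (EuclideanSpace.single j 1)) := rfl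
    set D : EuclideanSpace ℝ (Fin n) →L[ℝ] EuclideanSpace ℝ (Fin n) :=
      mfderiv (𝓡 n) (𝓡 n) (chartAt (EuclideanSpace ℝ (Fin n)) x').symm (φ z) with hD
    have h3 : ∀ i, D (fderiv ℝ φ z (EuclideanSpace.single i 1)) =
        ∑ k, J k i • D (EuclideanSpace.single k (1 : ℝ)) := fun i => by
      rw [hexp, map_sum]; simp
    have h4 : metricMatrix n x z i j = tangentInner
      ((chartAt (EuclideanSpace ℝ (Fin n)) x').symm (φ z))
      (D (fderiv ℝ φ z (EuclideanSpace.single i 1)))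
      (D (fderiv ℝ φ z (EuclideanSpace.single j 1))) := h2.trans h1
    rw [h4, h3, h3, tangentInner_sum_left]
    simp only [tangentInner_sum_right]
    have h5 : ∀ k l, tangentInner ((chartAt (EuclideanSpace ℝ (Fin n)) x').symm (φ z))
      (D (EuclideanSpace.single k 1)) (D (EuclideanSpace.single l 1)) =
        metricMatrix n x' (φ z) k l := fun _ _ => rfl
    simp only [h5, Matrix.mul_apply, Matrix.transpose_apply, Finset.mul_sum, Finset.sum_mul]
    rw [Finset.sum_comm]
    refine Finset.sum_congr rfl fun k _ => Finset.sum_congr rfl fun l _ => by ring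
  rw [hG, hJdet, Matrix.det_mul, Matrix.det_mul, Matrix.det_transpose]
  rw [show J.det * (metricMatrix n x' (φ z)).det * J.det =
    J.det ^ 2 * (metricMatrix n x' (φ z)).det by ring, Real.sqrt_mul (sq_nonneg _),
    Real.sqrt_sq_eq_abs]

end LocalIsometry

/-! ### Countable Borel partitions subordinate to an open cover -/

section Partition

variable {M : Type*} [MeasurableSpace M]

lemma exists_measurable_partition [TopologicalSpace M] [SecondCountableTopology M] [BorelSpace M]
    [Nonempty M] (V : M → Set M) (hV : ∀ y, IsOpen (V y)) (hmem : ∀ y, y ∈ V y) :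
    ∃ (ξ : ℕ → M) (D : ℕ → Set M), (∀ k, MeasurableSet (D k)) ∧ Pairwise (Function.onFun Disjoint D) ∧
      ⋃ k, D k = univ ∧ ∀ k, D k ⊆ V (ξ k) := by
  obtain ⟨s, hs, hsU⟩ := TopologicalSpace.countable_cover_nhds fun y =>
    (hV y).mem_nhds (hmem y)
  have hne : s.Nonempty := by
    by_contra h
    rw [not_nonempty_iff_eq_empty] at h
    subst h
    simp only [mem_empty_iff_false, iUnion_of_empty, iUnion_empty] at hsU
    exact empty_ne_univ hsU
  obtain ⟨ξ, rfl⟩ := hs.exists_eq_range hne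
  refine ⟨ξ, disjointed fun k => V (ξ k), fun k => ?_, disjoint_disjointed _, ?_, fun k =>
    disjointed_subset _ k⟩
  · exact MeasurableSet.disjointed (fun k => (hV _).measurableSet) k
  · rw [iUnion_disjointed]
    simpa using hsU

lemma measure_eq_tsum_inter {μ : Measure M} {D : ℕ → Set M} (hD : ∀ k, MeasurableSet (D k))
    (hd : Pairwise (Function.onFun Disjoint D)) (hU : ⋃ k, D k = univ) {A : Set M} (hA : MeasurableSet A) :
    μ A = ∑' k, μ (A ∩ D k) := by
  rw [← measure_iUnion (fun i j hij => (hd hij).mono inter_subset_right inter_subset_right)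
    fun k => hA.inter (hD k), ← inter_iUnion, hU, inter_univ]

end Partition

/-! ### The Riemannian measure and local isometries -/

section Volume

variable {n : ℕ}
  {M : Type*} [TopologicalSpace M] [ChartedSpace (EuclideanSpace ℝ (Fin n)) M]
  [RiemannianBundle (fun y : M => TangentSpace (𝓡 n) y)]
  [MeasurableSpace M] [BorelSpace M]
  {M' : Type*} [TopologicalSpace M'] [ChartedSpace (EuclideanSpace ℝ (Fin n)) M']
  [RiemannianBundle (fun y : M' => TangentSpace (𝓡 n) y)]
  [MeasurableSpace M'] [BorelSpace M']

lemma chartAt_image_eq (x : M) {B : Set M}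
    (hBs : B ⊆ (chartAt (EuclideanSpace ℝ (Fin n)) x).source) :
    chartAt (EuclideanSpace ℝ (Fin n)) x '' B =
      (chartAt (EuclideanSpace ℝ (Fin n)) x).symm ⁻¹' B ∩
        (chartAt (EuclideanSpace ℝ (Fin n)) x).target := by
  rw [(chartAt (EuclideanSpace ℝ (Fin n)) x).image_eq_target_inter_inv_preimage hBs, inter_comm]

lemma measurableSet_chartAt_image (x : M) {B : Set M} (hB : MeasurableSet B)
    (hBs : B ⊆ (chartAt (EuclideanSpace ℝ (Fin n)) x).source) :
    MeasurableSet (chartAt (EuclideanSpace ℝ (Fin n)) x '' B) := by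
  rw [chartAt_image_eq x hBs]
  set c := chartAt (EuclideanSpace ℝ (Fin n)) x
  have h1 := (continuousOn_iff_continuous_domRestrict.1 c.continuousOn_symm).measurable hB
  have h2 := c.open_target.measurableSet.subtype_image h1
  convert h2 using 1
  ext z
  simp [and_comm]

lemma chartVolume_apply (x : M) {B : Set M} (hB : MeasurableSet B) :
    chartVolume n x B = ∫⁻ z in (chartAt (EuclideanSpace ℝ (Fin n)) x).symm ⁻¹' B ∩
        (chartAt (EuclideanSpace ℝ (Fin n)) x).target,
      ENNReal.ofReal (Real.sqrt (metricMatrix n x z).det) := by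
  set c := chartAt (EuclideanSpace ℝ (Fin n)) x with hc
  have hae : AEMeasurable c.symm ((volume.restrict c.target).withDensity
      (fun z => ENNReal.ofReal (Real.sqrt (metricMatrix n x z).det))) :=
    (c.continuousOn_symm.aemeasurable c.open_target.measurableSet).mono_ac
      (withDensity_absolutelyContinuous _ _)
  rw [chartVolume, Measure.map_apply_of_aemeasurable hae hB, withDensity_apply',
    Measure.restrict_restrict' c.open_target.measurableSet]

lemma chartVolume_inter_source (x : M) {B : Set M} (hB : MeasurableSet B) :
    chartVolume n x (B ∩ (chartAt (EuclideanSpace ℝ (Fin n)) x).source) = chartVolume n x B := by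
  set c := chartAt (EuclideanSpace ℝ (Fin n)) x with hc
  rw [chartVolume_apply x (hB.inter c.open_source.measurableSet), chartVolume_apply x hB]
  congr 2
  ext z
  simp only [mem_inter_iff, mem_preimage]
  exact ⟨fun h => ⟨h.1.1, h.2⟩, fun h => ⟨⟨h.1, c.map_target h.2⟩, h.2⟩⟩

variable [IsManifold (𝓡 n) ∞ M] [IsManifold (𝓡 n) ∞ M']

/-- The Jacobian factor in the change of variables formula is exactly the ratio of the two metric
densities. -/
lemma IsRiemannianIsometric.chartVolume_image {f : M → M'} (hf : IsRiemannianIsometric n f)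
    (x : M) (x' : M') {B : Set M} (hB : MeasurableSet B)
    (hBs : B ⊆ (chartAt (EuclideanSpace ℝ (Fin n)) x).source) (hfB : MeasurableSet (f '' B))
    (hfBs : f '' B ⊆ (chartAt (EuclideanSpace ℝ (Fin n)) x').source) (hinj : InjOn f B) :
    chartVolume n x' (f '' B) = chartVolume n x B := by
  set c := chartAt (EuclideanSpace ℝ (Fin n)) x with hc
  set c' := chartAt (EuclideanSpace ℝ (Fin n)) x' with hc'
  rw [chartVolume_apply x hB, chartVolume_apply x' hfB, ← chartAt_image_eq x hBs,
    ← chartAt_image_eq x' hfBs]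
  have himg : c' '' (f '' B) = inCharts (n := n) f x x' '' (c '' B) := by
    rw [image_image, image_image]
    refine image_congr fun y hy => ?_
    simp only [inCharts]
    rw [← hc, c.left_inv (hBs hy)]
  have hmem : ∀ z ∈ c '' B, z ∈ c.target ∧ f (c.symm z) ∈ c'.source := by
    rintro _ ⟨y, hy, rfl⟩
    refine ⟨c.map_source (hBs hy), ?_⟩
    rw [c.left_inv (hBs hy)]
    exact hfBs (mem_image_of_mem _ hy)
  have hinj' : InjOn (inCharts (n := n) f x x') (c '' B) := by
    rintro _ ⟨y, hy, rfl⟩ _ ⟨y', hy', rfl⟩ h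
    simp only [inCharts] at h
    rw [← hc, c.left_inv (hBs hy), c.left_inv (hBs hy')] at h
    rw [hinj hy hy' (c'.injOn (hfBs (mem_image_of_mem _ hy)) (hfBs (mem_image_of_mem _ hy')) h)]
  have hmeas := measurableSet_chartAt_image x hB hBs
  rw [← hc, ← hc', himg, lintegral_image_eq_lintegral_abs_det_fderiv_mul volume hmeas
    (fun z hz => (hf.differentiableAt_inCharts (hmem z hz).1
      (hmem z hz).2).hasFDerivAt.hasFDerivWithinAt) hinj']
  refine setLIntegral_congr_fun hmeas fun z hz => ?_
  rw [hf.sqrt_det_metricMatrix (hmem z hz).1 (hmem z hz).2, ENNReal.ofReal_mul (abs_nonneg _)]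

lemma chartVolume_eq_chartVolume (x x' : M) {B : Set M} (hB : MeasurableSet B)
    (hBs : B ⊆ (chartAt (EuclideanSpace ℝ (Fin n)) x).source)
    (hBs' : B ⊆ (chartAt (EuclideanSpace ℝ (Fin n)) x').source) :
    chartVolume n x' B = chartVolume n x B := by
  have h := (isRiemannianIsometric_id (n := n) (M := M)).chartVolume_image x x' hB hBs
    (by simpa using hB) (by simpa using hBs') (injOn_id _)
  simpa using h

/-- The Riemannian measure is given by the density `√(det g)` in each chart. -/
lemma riemannianVolume_eq_chartVolume [SecondCountableTopology M] (x : M) {B : Set M}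
    (hB : MeasurableSet B) (hBs : B ⊆ (chartAt (EuclideanSpace ℝ (Fin n)) x).source) :
    riemannianVolume n M B = chartVolume n x B := by
  have : Nonempty M := ⟨x⟩
  obtain ⟨ξ, D, hD, hd, hU, hDV⟩ := exists_measurable_partition
    (fun y : M => (chartAt (EuclideanSpace ℝ (Fin n)) y).source)
    (fun y => (chartAt (EuclideanSpace ℝ (Fin n)) y).open_source)
    (fun y => mem_chart_source _ y)
  have hρ : ∀ A, MeasurableSet A → Measure.sum (fun k => (chartVolume n (ξ k)).restrict (D k)) A
      = ∑' k, chartVolume n (ξ k) (A ∩ D k) := fun A hA => by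
    rw [Measure.sum_apply _ hA]
    exact tsum_congr fun k => Measure.restrict_apply hA
  refine le_antisymm ?_ (le_iSup (fun y : M => chartVolume n y) x B)
  -- Gluing the chart measures along the partition gives one measure that dominates all of them,
  -- because they agree on overlaps.
  have hle : riemannianVolume n M ≤ Measure.sum fun k => (chartVolume n (ξ k)).restrict (D k) := by
    refine iSup_le fun y => Measure.le_iff.2 fun A hA => ?_
    rw [hρ A hA, measure_eq_tsum_inter hD hd hU hA]
    refine ENNReal.tsum_le_tsum fun k => ?_
    rw [← chartVolume_inter_source y (hA.inter (hD k)),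
      chartVolume_eq_chartVolume (ξ k) y
        ((hA.inter (hD k)).inter (chartAt (EuclideanSpace ℝ (Fin n)) y).open_source.measurableSet)
        ((inter_subset_left.trans inter_subset_right).trans (hDV k)) inter_subset_right]
    exact measure_mono inter_subset_left
  refine (hle B).trans ?_
  rw [hρ B hB, measure_eq_tsum_inter hD hd hU hB]
  refine ENNReal.tsum_le_tsum fun k => le_of_eq ?_
  exact chartVolume_eq_chartVolume x (ξ k) (hB.inter (hD k)) (inter_subset_left.trans hBs)
    (inter_subset_right.trans (hDV k))

/-- A measurable section of a local isometry is measure preserving onto its image. -/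
lemma IsRiemannianIsometric.map_section [SecondCountableTopology M] [SecondCountableTopology M']
    {p : M → M'} (hp : IsRiemannianIsometric n p) {τ : M' → M} (hτ : Measurable τ)
    (hpτ : ∀ x, p (τ x) = x) (hr : MeasurableSet (range τ)) :
    (riemannianVolume n M').map τ = (riemannianVolume n M).restrict (range τ) := by
  rcases isEmpty_or_nonempty M with hM | hM
  · have : Subsingleton (Measure M) := inferInstance
    exact Subsingleton.elim _ _
  obtain ⟨ξ, D, hD, hd, hU, hDV⟩ := exists_measurable_partition
    (fun y : M => (chartAt (EuclideanSpace ℝ (Fin n)) y).source ∩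
      p ⁻¹' (chartAt (EuclideanSpace ℝ (Fin n)) (p y)).source)
    (fun y => (chartAt (EuclideanSpace ℝ (Fin n)) y).open_source.inter
      ((chartAt (EuclideanSpace ℝ (Fin n)) (p y)).open_source.preimage hp.contMDiff.continuous))
    (fun y => ⟨mem_chart_source _ y, mem_chart_source _ (p y)⟩)
  ext A hA
  rw [Measure.map_apply hτ hA, Measure.restrict_apply hA,
    measure_eq_tsum_inter hD hd hU (hA.inter hr),
    measure_eq_tsum_inter (fun k => hτ (hD k)) (fun i j hij => (hd hij).preimage τ)
      (by rw [← preimage_iUnion, hU, preimage_univ]) (hτ hA)]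
  refine tsum_congr fun k => ?_
  -- On the image of `τ` the map `p` is injective with inverse `τ`, and each `D k` fits in one chart
  -- above and one below, so `chartVolume_image` applies piece by piece.
  have himg : p '' (A ∩ range τ ∩ D k) = τ ⁻¹' A ∩ τ ⁻¹' D k := by
    ext x
    constructor
    · rintro ⟨_, ⟨⟨hA, ⟨x', rfl⟩⟩, hD⟩, rfl⟩
      rw [hpτ]
      exact ⟨hA, hD⟩
    · rintro ⟨h1, h2⟩
      exact ⟨τ x, ⟨⟨h1, x, rfl⟩, h2⟩, hpτ x⟩
  have hm := (hA.inter hr).inter (hD k)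
  have hm' : MeasurableSet (p '' (A ∩ range τ ∩ D k)) := by
    rw [himg]; exact (hτ hA).inter (hτ (hD k))
  have hs : A ∩ range τ ∩ D k ⊆ (chartAt (EuclideanSpace ℝ (Fin n)) (ξ k)).source :=
    fun y hy => (hDV k hy.2).1
  have hs' : p '' (A ∩ range τ ∩ D k) ⊆ (chartAt (EuclideanSpace ℝ (Fin n)) (p (ξ k))).source := by
    rintro _ ⟨y, hy, rfl⟩
    exact (hDV k hy.2).2
  have hinj : InjOn p (A ∩ range τ ∩ D k) := by
    rintro _ ⟨⟨_, ⟨x, rfl⟩⟩, _⟩ _ ⟨⟨_, ⟨x', rfl⟩⟩, _⟩ h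
    rw [hpτ, hpτ] at h
    rw [h]
  rw [← himg, riemannianVolume_eq_chartVolume (p (ξ k)) hm' hs',
    riemannianVolume_eq_chartVolume (ξ k) hm hs, hp.chartVolume_image _ _ hm hs hm' hs' hinj]

end Volume

/-! ### Lifts of local isometries, and their effect on distances -/

section Lifting

variable {n : ℕ}
  {M : Type*} [TopologicalSpace M] [ChartedSpace (EuclideanSpace ℝ (Fin n)) M]
  [RiemannianBundle (fun y : M => TangentSpace (𝓡 n) y)]
  {M' : Type*} [TopologicalSpace M'] [ChartedSpace (EuclideanSpace ℝ (Fin n)) M']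
  [RiemannianBundle (fun y : M' => TangentSpace (𝓡 n) y)]
  {N : Type*} [TopologicalSpace N] [ChartedSpace (EuclideanSpace ℝ (Fin n)) N]
  [RiemannianBundle (fun y : N => TangentSpace (𝓡 n) y)]

lemma eq_zero_of_tangentInner_self {y : M} {v : EuclideanSpace ℝ (Fin n)}
    (h : tangentInner y v v = 0) : v = 0 :=
  (inner_self_eq_zero (𝕜 := ℝ) (E := TangentSpace (𝓡 n) y)).1 h

lemma IsRiemannianIsometric.enorm_mfderiv {f : M → M'} (hf : IsRiemannianIsometric n f) (y : M)
    (v : TangentSpace (𝓡 n) y) : ‖mfderiv (𝓡 n) (𝓡 n) f y v‖ₑ = ‖v‖ₑ := by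
  have h := hf.inner_mfderiv y v v
  rw [real_inner_self_eq_norm_sq, real_inner_self_eq_norm_sq,
    sq_eq_sq₀ (norm_nonneg _) (norm_nonneg _)] at h
  rw [← ofReal_norm, ← ofReal_norm, h]

/-- Local isometries do not increase the Riemannian distance. -/
lemma IsRiemannianIsometric.riemannianEDist_le {f : M → M'} (hf : IsRiemannianIsometric n f)
    (y y' : M) : Manifold.riemannianEDist (𝓡 n) (f y) (f y') ≤
      Manifold.riemannianEDist (𝓡 n) y y' := by
  refine le_of_forall_gt fun r hr => ?_
  obtain ⟨γ, h0, h1, hγ, hlt⟩ := Manifold.exists_lt_of_riemannianEDist_lt hr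
  refine lt_of_le_of_lt (Manifold.riemannianEDist_le_pathELength (γ := f ∘ γ) (a := 0) (b := 1)
    (hf.contMDiff.comp_contMDiffOn hγ) (by simp [h0]) (by simp [h1]) zero_le_one) ?_
  refine lt_of_le_of_lt (le_of_eq ?_) hlt
  rw [Manifold.pathELength_eq_lintegral_mfderiv_Ioo, Manifold.pathELength_eq_lintegral_mfderiv_Ioo]
  refine setLIntegral_congr_fun measurableSet_Ioo fun t ht => ?_
  have hγt : MDifferentiableAt 𝓘(ℝ, ℝ) (𝓡 n) γ t :=
    ((hγ t ⟨ht.1.le, ht.2.le⟩).contMDiffAt (Icc_mem_nhds ht.1 ht.2)).mdifferentiableAt one_ne_zero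
  have h := mfderiv_comp_apply t ((hf.contMDiff _).mdifferentiableAt one_ne_zero) hγt 1
  exact (congrArg (fun v : TangentSpace (𝓡 n) (f (γ t)) => ‖v‖ₑ) h).trans
    (hf.enorm_mfderiv (γ t) _)

variable [IsManifold (𝓡 n) ∞ M] [IsManifold (𝓡 n) ∞ M'] [IsManifold (𝓡 n) ∞ N]

lemma mfderiv_chartAt_symm_eq_zero {x : M} {z : EuclideanSpace ℝ (Fin n)}
    (hz : z ∈ (chartAt (EuclideanSpace ℝ (Fin n)) x).target) {v : EuclideanSpace ℝ (Fin n)}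
    (hv : mfderiv (𝓡 n) (𝓡 n) (chartAt (EuclideanSpace ℝ (Fin n)) x).symm z v = 0) : v = 0 := by
  set c := chartAt (EuclideanSpace ℝ (Fin n)) x with hc
  have h1 : MDifferentiableAt (𝓡 n) (𝓡 n) c (c.symm z) :=
    ((contMDiffOn_chart (n := 1) (I := 𝓡 n) (x := x)).contMDiffAt
      (c.open_source.mem_nhds (c.map_target hz))).mdifferentiableAt one_ne_zero
  have h2 := mfderiv_comp_apply z h1 (mdifferentiableAt_chartAt_symm x hz) v
  have h2' := h2.trans ((congrArg _ hv).trans (map_zero _))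
  have heq : (c ∘ c.symm) =ᶠ[𝓝 z] id := by
    filter_upwards [c.open_target.mem_nhds hz] with w hw
    exact c.right_inv hw
  have h3 := heq.mfderiv_eq (I := 𝓡 n) (I' := 𝓡 n)
  rw [mfderiv_id] at h3
  exact (congrArg (fun L : EuclideanSpace ℝ (Fin n) →L[ℝ] EuclideanSpace ℝ (Fin n) => L v)
    h3).symm.trans h2'

/-- Locally `f` is a local inverse of `p` after `p ∘ f`. That inverse is `C¹` by the inverse
function theorem: the derivative of `p` preserves inner products, hence is injective, hence
invertible between spaces of equal finite dimension. -/
lemma IsRiemannianIsometric.contMDiff_of_comp {p : M' → N} (hp : IsRiemannianIsometric n p)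
    (hloc : IsLocalHomeomorph p) {f : M → M'} (hf : Continuous f)
    (hpf : ContMDiff (𝓡 n) (𝓡 n) 1 (p ∘ f)) : ContMDiff (𝓡 n) (𝓡 n) 1 f := by
  intro y
  obtain ⟨e, he, rfl⟩ := hloc (f y)
  set c := chartAt (EuclideanSpace ℝ (Fin n)) (f y) with hc
  set c₀ := chartAt (EuclideanSpace ℝ (Fin n)) (e (f y)) with hc₀
  have hyc : f y ∈ c.source := mem_chart_source _ _
  have hyc₀ : e (f y) ∈ c₀.source := mem_chart_source _ _
  set ψ : OpenPartialHomeomorph (EuclideanSpace ℝ (Fin n)) (EuclideanSpace ℝ (Fin n)) :=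
    (c.symm.trans e).trans c₀ with hψ
  have hψe : ∀ z, ψ z = inCharts (n := n) e (f y) (e (f y)) z := fun z => rfl
  have hz : c (f y) ∈ c.target := c.map_source hyc
  have hz' : e (c.symm (c (f y))) ∈ c₀.source := by rw [c.left_inv hyc]; exact hyc₀
  have hzψ : c (f y) ∈ ψ.source := by
    simp only [hψ, OpenPartialHomeomorph.trans_source, OpenPartialHomeomorph.symm_source,
      mem_inter_iff, mem_preimage, OpenPartialHomeomorph.coe_trans, Function.comp_apply]
    exact ⟨⟨hz, by rwa [c.left_inv hyc]⟩, hz'⟩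
  have hinj : Function.Injective (fderiv ℝ ψ (c (f y))) := by
    rw [injective_iff_map_eq_zero]
    intro v hv
    have h1 := hp.tangentInner_eq hz hz' v v
    refine mfderiv_chartAt_symm_eq_zero hz (eq_zero_of_tangentInner_self (h1.trans ?_))
    have h2 : fderiv ℝ (inCharts (n := n) e (f y) (e (f y))) (c (f y)) v = 0 := hv
    have hL : ∀ (q : N) (L : EuclideanSpace ℝ (Fin n) →L[ℝ] EuclideanSpace ℝ (Fin n)),
        tangentInner q (L 0) (L 0) = 0 := fun q L => by
      rw [map_zero]
      exact inner_zero_left (𝕜 := ℝ) (E := TangentSpace (𝓡 n) q) _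
    rw [h2]
    exact hL _ _
  set A : EuclideanSpace ℝ (Fin n) ≃L[ℝ] EuclideanSpace ℝ (Fin n) :=
    (LinearEquiv.ofInjectiveEndo (fderiv ℝ ψ (c (f y))).toLinearMap hinj).toContinuousLinearEquiv
    with hA
  have hAeq : (A : EuclideanSpace ℝ (Fin n) →L[ℝ] EuclideanSpace ℝ (Fin n)) =
      fderiv ℝ ψ (c (f y)) := by ext1 v; rfl
  have ha : ψ (c (f y)) ∈ ψ.target := ψ.map_source hzψ
  have hsymm : ContDiffAt ℝ 1 ψ.symm (ψ (c (f y))) := by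
    refine ψ.contDiffAt_symm ha (f₀' := A) ?_ ?_
    · rw [ψ.left_inv hzψ, hAeq]
      exact (hp.differentiableAt_inCharts hz hz').hasFDerivAt
    · rw [ψ.left_inv hzψ]
      exact (hp.contMDiffAt_inCharts hz hz').contDiffAt
  have hval : ψ (c (f y)) = c₀ (e (f y)) := by
    rw [hψe, inCharts, ← hc, ← hc₀, c.left_inv hyc]
  have hsymmz : ψ.symm (c₀ (e (f y))) = c (f y) := by rw [← hval, ψ.left_inv hzψ]
  have heq : f =ᶠ[𝓝 y] c.symm ∘ ψ.symm ∘ c₀ ∘ (e ∘ f) := by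
    filter_upwards [hf.continuousAt.preimage_mem_nhds
        ((c.open_source.inter e.open_source).mem_nhds ⟨hyc, he⟩),
      hpf.continuous.continuousAt.preimage_mem_nhds (c₀.open_source.mem_nhds hyc₀)] with w hw hw'
    simp only [hψ, OpenPartialHomeomorph.trans_symm_eq_symm_trans_symm,
      OpenPartialHomeomorph.coe_trans, Function.comp_apply, OpenPartialHomeomorph.symm_symm]
    rw [show c₀.symm (c₀ (e (f w))) = e (f w) from c₀.left_inv hw', e.left_inv hw.2, c.left_inv hw.1]
  refine ContMDiffAt.congr_of_eventuallyEq ?_ heq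
  have h1 : ContMDiffAt (𝓡 n) (𝓡 n) 1 c₀ (e (f y)) :=
    (contMDiffOn_chart (n := 1) (I := 𝓡 n) (x := e (f y))).contMDiffAt
      (c₀.open_source.mem_nhds hyc₀)
  have h2 : ContMDiffAt (𝓡 n) (𝓡 n) 1 ψ.symm (c₀ (e (f y))) := by
    rw [← hval]; exact hsymm.contMDiffAt
  have h3 : ContMDiffAt (𝓡 n) (𝓡 n) 1 c.symm (ψ.symm (c₀ (e (f y)))) := by
    rw [hsymmz]
    exact (contMDiffOn_chart_symm (n := 1) (I := 𝓡 n) (x := f y)).contMDiffAt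
      (c.open_target.mem_nhds hz)
  exact h3.comp y (h2.comp y (h1.comp y (hpf y)))

/-- Continuous lifts of local isometries along local isometries are local isometries. -/
lemma IsRiemannianIsometric.of_comp {p : M' → N} (hp : IsRiemannianIsometric n p)
    (hloc : IsLocalHomeomorph p) {f : M → M'} (hf : Continuous f)
    (hpf : IsRiemannianIsometric n (p ∘ f)) : IsRiemannianIsometric n f where
  contMDiff := hp.contMDiff_of_comp hloc hf hpf.contMDiff
  inner_mfderiv y v w := by
    have hc := hp.contMDiff_of_comp hloc hf hpf.contMDiff
    have h : ∀ v, mfderiv (𝓡 n) (𝓡 n) (p ∘ f) y v =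
        mfderiv (𝓡 n) (𝓡 n) p (f y) (mfderiv (𝓡 n) (𝓡 n) f y v) := fun v =>
      mfderiv_comp_apply y ((hp.contMDiff _).mdifferentiableAt one_ne_zero)
        ((hc _).mdifferentiableAt one_ne_zero) v
    have h1 := hpf.inner_mfderiv y v w
    rw [h v, h w] at h1
    exact (hp.inner_mfderiv _ _ _).symm.trans h1

end Lifting

/-! ### Riemannian distance and relatively compact neighbourhoods -/

section Distance

variable {n : ℕ}
  {M : Type*} [TopologicalSpace M] [T2Space M] [ChartedSpace (EuclideanSpace ℝ (Fin n)) M]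
  [IsManifold (𝓡 n) ∞ M] [RiemannianBundle (fun y : M => TangentSpace (𝓡 n) y)]
  [IsContMDiffRiemannianBundle (𝓡 n) ∞ (EuclideanSpace ℝ (Fin n))
      (fun y : M => TangentSpace (𝓡 n) y)]

variable (n M) in
omit [T2Space M] in
lemma isContinuousRiemannianBundle_tangentSpace :
    IsContinuousRiemannianBundle (EuclideanSpace ℝ (Fin n))
      (fun y : M => TangentSpace (𝓡 n) y) := by
  obtain ⟨g, hg, h⟩ := IsContMDiffRiemannianBundle.exists_contMDiff (IB := 𝓡 n) (n := ∞)
    (F := EuclideanSpace ℝ (Fin n)) (E := fun y : M => TangentSpace (𝓡 n) y)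
  exact ⟨g, hg.continuous, h⟩

variable (n M) in
lemma continuous_riemannianEDist :
    Continuous fun z : M × M => Manifold.riemannianEDist (𝓡 n) z.1 z.2 := by
  have : LocallyCompactSpace M := ChartedSpace.locallyCompactSpace (EuclideanSpace ℝ (Fin n)) M
  have := isContinuousRiemannianBundle_tangentSpace n M
  have : IsManifold (𝓡 n) 1 M := IsManifold.of_le (n := ∞) (by simp)
  let : PseudoEMetricSpace M := PseudoEMetricSpace.ofRiemannianMetric (𝓡 n) M
  exact continuous_edist

/-- A point on a short path at a prescribed distance of the starting point. -/
lemma exists_riemannianEDist_eq {y y' : M} {δ s : ENNReal}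
    (h : Manifold.riemannianEDist (𝓡 n) y y' < δ + s)
    (hδ : δ ≤ Manifold.riemannianEDist (𝓡 n) y y') :
    ∃ z, Manifold.riemannianEDist (𝓡 n) y z = δ ∧ Manifold.riemannianEDist (𝓡 n) z y' < s := by
  obtain ⟨γ, h0, h1, hγ, hlt⟩ := Manifold.exists_lt_of_riemannianEDist_lt h
  have hc : ContinuousOn (fun t => Manifold.riemannianEDist (𝓡 n) y (γ t)) (Icc 0 1) :=
    (continuous_riemannianEDist n M).comp_continuousOn
      (continuousOn_const.prodMk hγ.continuousOn)
  -- The distance from `y` varies continuously along a path of length below `δ + s`. Cutting where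
  -- it equals `δ` uses up length at least `δ`, which leaves less than `s`.
  obtain ⟨t, ht, hdt⟩ := intermediate_value_Icc zero_le_one hc
    (show δ ∈ Icc _ _ from ⟨by rw [h0, Manifold.riemannianEDist_self]; exact zero_le, by rwa [h1]⟩)
  refine ⟨γ t, hdt, ?_⟩
  have h2 : δ ≤ Manifold.pathELength (𝓡 n) γ 0 t := by
    rw [← hdt]
    exact Manifold.riemannianEDist_le_pathELength (hγ.mono (Icc_subset_Icc_right ht.2)) h0 rfl ht.1
  have h3 : Manifold.riemannianEDist (𝓡 n) (γ t) y' ≤ Manifold.pathELength (𝓡 n) γ t 1 :=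
    Manifold.riemannianEDist_le_pathELength (hγ.mono (Icc_subset_Icc_left ht.1)) rfl h1 ht.2
  rw [← Manifold.pathELength_add ht.1 ht.2] at hlt
  by_contra hcon
  exact absurd hlt (not_lt.2 (add_le_add h2 ((not_lt.1 hcon).trans h3)))

variable (n) in
/-- Bounded neighbourhoods of compact sets are relatively compact. -/
def HasCompactNeighborhoods (M : Type*) [TopologicalSpace M]
    [ChartedSpace (EuclideanSpace ℝ (Fin n)) M]
    [RiemannianBundle (fun y : M => TangentSpace (𝓡 n) y)] : Prop :=
  ∀ R : ENNReal, R < ⊤ → ∀ K : Set M, IsCompact K → ∃ K' : Set M, IsCompact K' ∧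
    ∀ y ∈ K, ∀ y', Manifold.riemannianEDist (𝓡 n) y y' ≤ R → y' ∈ K'

/-- A distance below `m * δ` with `δ < r` is covered in `m` steps, each peeling off length `δ` along
an almost shortest path and enlarging the compact set once. No completeness or geodesics are needed.
-/
lemma hasCompactNeighborhoods_of_uniform {r : ENNReal} (hr : 0 < r)
    (h : ∀ K : Set M, IsCompact K → ∃ K' : Set M, IsCompact K' ∧
      ∀ y ∈ K, ∀ y', Manifold.riemannianEDist (𝓡 n) y y' < r → y' ∈ K') :
    HasCompactNeighborhoods n M := by
  intro R hR K hK
  obtain ⟨δ, hδ, hδr⟩ := exists_between hr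
  obtain ⟨m, hm⟩ := ENNReal.exists_nat_mul_gt hδ.ne' hR.ne
  suffices H : ∀ m : ℕ, ∀ K : Set M, IsCompact K → ∃ K' : Set M, IsCompact K' ∧
      ∀ y ∈ K, ∀ y', Manifold.riemannianEDist (𝓡 n) y y' < m * δ → y' ∈ K' by
    obtain ⟨K', hK', h'⟩ := H m K hK
    exact ⟨K', hK', fun y hy y' hd => h' y hy y' (hd.trans_lt hm)⟩
  intro m
  induction m with
  | zero => exact fun K hK => ⟨K, hK, fun y _ y' hd => absurd hd (by simp)⟩
  | succ m ih =>
    intro K hK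
    obtain ⟨K₁, hK₁, h₁⟩ := h K hK
    obtain ⟨K₂, hK₂, h₂⟩ := ih K₁ hK₁
    refine ⟨K₁ ∪ K₂, hK₁.union hK₂, fun y hy y' hd => ?_⟩
    by_cases hlt : Manifold.riemannianEDist (𝓡 n) y y' < δ
    · exact Or.inl (h₁ y hy y' (hlt.trans hδr))
    · obtain ⟨z, hz, hz'⟩ := exists_riemannianEDist_eq (n := n) (δ := δ) (s := m * δ)
        (by rwa [Nat.cast_succ, add_mul, one_mul, add_comm] at hd) (not_lt.1 hlt)
      exact Or.inr (h₂ z (h₁ y hy z (hz.trans_lt hδr)) y' hz')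

/-- A Lebesgue number argument: a ball of radius `c` inside `U` serves all points within `c / 2` of
its centre with radius `c / 2`, and compactness leaves finitely many radii. -/
lemma exists_uniform_radius {K U : Set M} (hK : IsCompact K) (hU : IsOpen U) (hKU : K ⊆ U) :
    ∃ r : ENNReal, 0 < r ∧ ∀ y ∈ K, ∀ y', Manifold.riemannianEDist (𝓡 n) y y' < r → y' ∈ U := by
  have : LocallyCompactSpace M := ChartedSpace.locallyCompactSpace (EuclideanSpace ℝ (Fin n)) M
  have := isContinuousRiemannianBundle_tangentSpace n M
  have : IsManifold (𝓡 n) 1 M := IsManifold.of_le (n := ∞) (by simp)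
  refine hK.induction_on (p := fun s => ∃ r : ENNReal, 0 < r ∧ ∀ y ∈ s, ∀ y',
    Manifold.riemannianEDist (𝓡 n) y y' < r → y' ∈ U) ⟨1, one_pos, by simp⟩ ?_ ?_ ?_
  · rintro s t hst ⟨r, hr, h⟩
    exact ⟨r, hr, fun y hy => h y (hst hy)⟩
  · rintro s t ⟨r, hr, h⟩ ⟨r', hr', h'⟩
    refine ⟨min r r', lt_min hr hr', ?_⟩
    rintro y (hy | hy) y' hd
    · exact h y hy y' (hd.trans_le (min_le_left _ _))
    · exact h' y hy y' (hd.trans_le (min_le_right _ _))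
  · intro x hx
    obtain ⟨c, hc, hcU⟩ := setOfPred_riemannianEDist_lt_subset_nhds' (𝓡 n)
      (hU.mem_nhds (hKU hx))
    refine ⟨{y | Manifold.riemannianEDist (𝓡 n) x y < c / 2}, mem_nhdsWithin_of_mem_nhds
      (eventually_riemannianEDist_lt (𝓡 n) x (ENNReal.half_pos hc.ne')), c / 2,
      ENNReal.half_pos hc.ne', fun y hy y' hd => hcU ?_⟩
    calc Manifold.riemannianEDist (𝓡 n) x y'
        ≤ Manifold.riemannianEDist (𝓡 n) x y + Manifold.riemannianEDist (𝓡 n) y y' :=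
          Manifold.riemannianEDist_triangle
      _ < c / 2 + c / 2 := ENNReal.add_lt_add hy hd
      _ = c := ENNReal.add_halves c

/-- A manifold with a cocompact isometric group action has the Heine-Borel property. -/
lemma hasCompactNeighborhoods_of_cocompact {Γ : Type*} [Group Γ] [MulAction Γ M]
    (hΓ : ∀ g : Γ, Continuous fun y : M => g • y)
    (hd : ∀ (g : Γ) (y y' : M), Manifold.riemannianEDist (𝓡 n) (g • y) (g • y') ≤
      Manifold.riemannianEDist (𝓡 n) y y')
    {K₀ : Set M} (hK₀ : IsCompact K₀) (hcov : ∀ y : M, ∃ g : Γ, g • y ∈ K₀) :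
    HasCompactNeighborhoods n M := by
  have : LocallyCompactSpace M := ChartedSpace.locallyCompactSpace (EuclideanSpace ℝ (Fin n)) M
  obtain ⟨K₁, hK₁, h₀₁⟩ := exists_compact_superset hK₀
  obtain ⟨K₂, hK₂, h₁₂⟩ := exists_compact_superset hK₁
  -- This radius works at every point of `M`: some group element moves the point into `K₁`, its
  -- neighbours then land in `K₂`, and finitely many group elements suffice for a compact set.
  obtain ⟨r, hr, h⟩ := exists_uniform_radius (n := n) hK₁ isOpen_interior h₁₂
  refine hasCompactNeighborhoods_of_uniform hr fun K hK => ?_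
  obtain ⟨t, ht⟩ := hK.elim_finite_subcover (fun g : Γ => (fun y => g • y) ⁻¹' interior K₁)
    (fun g => isOpen_interior.preimage (hΓ g)) fun y _ => by
      obtain ⟨g, hg⟩ := hcov y
      exact mem_iUnion.2 ⟨g, h₀₁ hg⟩
  refine ⟨⋃ g ∈ t, (fun y => g⁻¹ • y) '' K₂, t.isCompact_biUnion fun g _ => hK₂.image (hΓ _),
    fun y hy y' hdy => ?_⟩
  obtain ⟨g, hg, hyg⟩ := mem_iUnion₂.1 (ht hy)
  exact mem_iUnion₂.2 ⟨g, hg, g • y', interior_subset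
    (h _ (interior_subset hyg) _ ((hd g y y').trans_lt hdy)), inv_smul_smul g y'⟩

end Distance

/-! ### Bounded Borel sections -/

section BorelSection

variable {M N : Type*} [TopologicalSpace M] [T2Space M] [LocallyCompactSpace M] [MeasurableSpace M]
  [BorelSpace M] [TopologicalSpace N] [T2Space N] [SecondCountableTopology N] [CompactSpace N]
  [MeasurableSpace N] [BorelSpace N]

/-- A surjective local homeomorphism onto a compact space has a bounded Borel section. -/
lemma exists_measurable_section [Nonempty M] {p : M → N} (hp : IsLocalHomeomorph p)
    (hs : Function.Surjective p) : ∃ τ : N → M, Measurable τ ∧ (∀ x, p (τ x) = x) ∧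
      ∃ K : Set M, IsCompact K ∧ ∀ x, τ x ∈ K := by
  have key := isCompact_univ.induction_on (X := N) (p := fun s => ∃ τ : N → M, Measurable τ ∧
      (∀ x ∈ s, p (τ x) = x) ∧ ∃ K : Set M, IsCompact K ∧ ∀ x, τ x ∈ K) ?_ ?_ ?_ ?_
  · obtain ⟨τ, hτ, h, hK⟩ := key
    exact ⟨τ, hτ, fun x => h x (mem_univ x), hK⟩
  · inhabit M
    exact ⟨fun _ => default, measurable_const, by simp, {default}, isCompact_singleton, by simp⟩
  · rintro s t hst ⟨τ, hτ, h, hK⟩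
    exact ⟨τ, hτ, fun x hx => h x (hst hx), hK⟩
  · rintro s t ⟨τ, hτ, h, K, hK, hτK⟩ ⟨τ', hτ', h', K', hK', hτK'⟩
    classical
    -- The sets of the compactness induction need not be Borel, so the sections are glued along the
    -- Borel set where `τ` happens to be a right inverse.
    have hm : MeasurableSet {x | p (τ x) = x} :=
      measurableSet_eq_fun (hp.continuous.measurable.comp hτ) measurable_id
    refine ⟨fun x => if p (τ x) = x then τ x else τ' x, Measurable.ite hm hτ hτ', ?_, K ∪ K',
      hK.union hK', fun x => ?_⟩
    · intro x hx
      by_cases hx' : p (τ x) = x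
      · simp [hx']
      · simp only [hx', if_false]
        exact h' x (hx.resolve_left fun hxs => hx' (h x hxs))
    · by_cases hx' : p (τ x) = x
      · simp only [hx', if_true]; exact Or.inl (hτK x)
      · simp only [hx', if_false]; exact Or.inr (hτK' x)
  · intro x _
    obtain ⟨y, rfl⟩ := hs x
    obtain ⟨e, hy, rfl⟩ := hp y
    obtain ⟨K, hK, hyK⟩ := exists_compact_mem_nhds y
    have hV : IsOpen (e.target ∩ e.symm ⁻¹' interior K) :=
      e.continuousOn_symm.isOpen_inter_preimage e.open_target isOpen_interior
    classical
    refine ⟨e.target ∩ e.symm ⁻¹' interior K, mem_nhdsWithin_of_mem_nhds (hV.mem_nhds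
      ⟨e.map_source hy, ?_⟩), (e.target ∩ e.symm ⁻¹' interior K).piecewise e.symm fun _ => y, ?_,
      ?_, K, hK, ?_⟩
    · rw [mem_preimage, e.left_inv hy]
      exact mem_interior_iff_mem_nhds.2 hyK
    · exact (e.continuousOn_symm.mono inter_subset_left).measurable_piecewise continuousOn_const
        hV.measurableSet
    · intro x' hx'
      rw [piecewise_eq_of_mem _ _ _ hx', e.right_inv hx'.1]
    · intro x'
      by_cases hx' : x' ∈ e.target ∩ e.symm ⁻¹' interior K
      · rw [piecewise_eq_of_mem _ _ _ hx']; exact interior_subset hx'.2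
      · rw [piecewise_eq_of_notMem _ _ _ hx']; exact mem_of_mem_nhds hyK

end BorelSection

/-! ### Geometry of Riemannian Galois covers -/

namespace IsRiemannianGaloisCover

variable {n : ℕ} {N : Type*} [TopologicalSpace N]
  [ChartedSpace (EuclideanSpace ℝ (Fin n)) N] [IsManifold (𝓡 n) ∞ N]
  [RiemannianBundle (fun x : N => TangentSpace (𝓡 n) x)]
  {M : Type*} [TopologicalSpace M]
  [ChartedSpace (EuclideanSpace ℝ (Fin n)) M] [IsManifold (𝓡 n) ∞ M]
  [RiemannianBundle (fun y : M => TangentSpace (𝓡 n) y)]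
  {M' : Type*} [TopologicalSpace M']
  [ChartedSpace (EuclideanSpace ℝ (Fin n)) M'] [IsManifold (𝓡 n) ∞ M']
  [RiemannianBundle (fun y : M' => TangentSpace (𝓡 n) y)]
  {Γ Γ' : Type*} [Group Γ] [MulAction Γ M] [Group Γ'] [MulAction Γ' M'] {p : C(M, N)}
  {p' : C(M', N)} (h : IsRiemannianGaloisCover n Γ p) (h' : IsRiemannianGaloisCover n Γ' p')
include h

omit [IsManifold (𝓡 n) ∞ N] [IsManifold (𝓡 n) ∞ M] in
lemma isRiemannianIsometric : IsRiemannianIsometric n p where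
  contMDiff := h.contMDiff.of_le (by simp)
  inner_mfderiv := h.inner_mfderiv

include h' in
lemma isRiemannianIsometric_lift {f : M → M'} (hf : Continuous f) (hpf : ∀ y, p' (f y) = p y) :
    IsRiemannianIsometric n f := by
  refine h'.isRiemannianIsometric.of_comp h'.isCoveringMap.isLocalHomeomorph hf ?_
  have : p' ∘ f = p := funext hpf
  rw [this]
  exact h.isRiemannianIsometric

lemma riemannianEDist_smul_le (g : Γ) (y y' : M) :
    Manifold.riemannianEDist (𝓡 n) (g • y) (g • y') ≤ Manifold.riemannianEDist (𝓡 n) y y' :=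
  (h.isRiemannianIsometric_lift h (h.continuous_smul g) (h.map_smul g)).riemannianEDist_le y y'

omit [IsManifold (𝓡 n) ∞ N] [IsManifold (𝓡 n) ∞ M] in
lemma eq_of_smul_eq {g k : Γ} {y : M} (hgk : g • y = k • y) : g = k := by
  have := h.free (k⁻¹ * g) y (by rw [mul_smul, hgk, inv_smul_smul])
  rwa [inv_mul_eq_one, eq_comm] at this

omit [IsManifold (𝓡 n) ∞ N] [IsManifold (𝓡 n) ∞ M] in
/-- The deck transformation group acts properly. -/
lemma finite_setOf_smul_mem [T2Space N] {K K' : Set M} (hK : IsCompact K) (hK' : IsCompact K') :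
    {g : Γ | ∃ y ∈ K, g • y ∈ K'}.Finite := by
  have key := (hK.prod hK').induction_on
    (p := fun s => {g : Γ | ∃ y, (y, g • y) ∈ s}.Finite) ?_ ?_ ?_ ?_
  · refine key.subset ?_
    rintro g ⟨y, hy, hgy⟩
    exact ⟨y, hy, hgy⟩
  · simp
  · rintro s t hst ht
    exact ht.subset fun g ⟨y, hy⟩ => ⟨y, hst hy⟩
  · rintro s t hs ht
    refine (hs.union ht).subset ?_
    rintro g ⟨y, hy | hy⟩
    · exact Or.inl ⟨y, hy⟩
    · exact Or.inr ⟨y, hy⟩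
  · rintro ⟨x, y⟩ _
    -- If `y = k • x`, injectivity of `p` near `x` leaves only `k` as a possible element near the
    -- pair. If the images differ, disjoint neighbourhoods in `N` exclude every element.
    by_cases hxy : p x = p y
    · obtain ⟨k, rfl⟩ := h.exists_smul_eq x y hxy
      obtain ⟨e, hx, he⟩ := h.isCoveringMap.isLocalHomeomorph x
      have hW : e.source ×ˢ ((fun y => k⁻¹ • y) ⁻¹' e.source) ∈ 𝓝 (x, k • x) :=
        prod_mem_nhds (e.open_source.mem_nhds hx)
          ((e.open_source.preimage (h.continuous_smul k⁻¹)).mem_nhds (by simpa using hx))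
      refine ⟨_, mem_nhdsWithin_of_mem_nhds hW, (finite_singleton k).subset ?_⟩
      rintro g ⟨y, hy, hgy⟩
      have h1 : e y = e (k⁻¹ • g • y) := by rw [← he, h.map_smul, h.map_smul]
      have h2 : y = k⁻¹ • g • y := e.injOn hy hgy h1
      refine h.eq_of_smul_eq (y := y) ?_
      rw [← smul_inv_smul k (g • y), ← h2]
    · obtain ⟨U, V, hU, hV, hxU, hyV, hd⟩ := t2_separation hxy
      refine ⟨_, mem_nhdsWithin_of_mem_nhds (prod_mem_nhds
        ((hU.preimage p.continuous).mem_nhds hxU) ((hV.preimage p.continuous).mem_nhds hyV)),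
        finite_empty.subset ?_⟩
      rintro g ⟨y, hy, hgy⟩
      rw [mem_preimage, h.map_smul] at hgy
      exact hd.le_bot ⟨hy, hgy⟩

-- By properness, only finitely many group elements send a given point into each compact set of an
-- exhaustion.
omit [IsManifold (𝓡 n) ∞ N] [IsManifold (𝓡 n) ∞ M] in
lemma countable [T2Space N] [T2Space M] [SecondCountableTopology M] [Nonempty M] :
    Countable Γ := by
  have : LocallyCompactSpace M := ChartedSpace.locallyCompactSpace (EuclideanSpace ℝ (Fin n)) M
  inhabit M
  rw [← countable_univ_iff]
  have hc : (⋃ k : ℕ, {g : Γ | ∃ y ∈ ({default} : Set M), g • y ∈ compactCovering M k}).Countable :=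
    countable_iUnion fun k =>
      (h.finite_setOf_smul_mem isCompact_singleton (isCompact_compactCovering M k)).countable
  refine hc.mono fun g _ => ?_
  have hg : g • (default : M) ∈ ⋃ k, compactCovering M k := by
    rw [iUnion_compactCovering]; trivial
  obtain ⟨k, hk⟩ := mem_iUnion.1 hg
  exact mem_iUnion.2 ⟨k, default, rfl, hk⟩

variable [T2Space N] [SecondCountableTopology N] [MeasurableSpace N] [BorelSpace N]
  [T2Space M] [SecondCountableTopology M] [MeasurableSpace M] [BorelSpace M]

/-- The translates of a Borel section form a section system. -/
lemma isSectionSystem {τ : N → M} (hτ : Measurable τ) (hpτ : ∀ x, p (τ x) = x) :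
    IsSectionSystem p (riemannianVolume n N) (riemannianVolume n M)
      (fun (g : Γ) x => g • τ x) := by
  have hr : ∀ (g : Γ) (x : N), p (g • τ x) = x := fun g x => by rw [h.map_smul, hpτ]
  have hm : ∀ g : Γ, Measurable fun x => g • τ x := fun g =>
    (h.continuous_smul g).measurable.comp hτ
  have hrange : ∀ g : Γ, MeasurableSet (range fun x => g • τ x) := fun g => by
    -- As the equalizer of two Borel maps into a second countable Hausdorff space, the image is
    -- Borel.
    have : (range fun x => g • τ x) = {y | g • τ (p y) = y} := by
      ext y
      constructor
      · rintro ⟨x, rfl⟩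
        simp only [mem_ofPred_eq, hr]
      · intro hy
        exact ⟨p y, hy⟩
    rw [this]
    exact measurableSet_eq_fun ((hm g).comp p.continuous.measurable) measurable_id
  have hmap : ∀ g : Γ, (riemannianVolume n N).map (fun x => g • τ x) =
      (riemannianVolume n M).restrict (range fun x => g • τ x) := fun g =>
    h.isRiemannianIsometric.map_section (hm g) (hr g) (hrange g)
  have hex : ∀ y, ∃ g : Γ, g • τ (p y) = y := fun y => h.exists_smul_eq _ _ (hpτ _)
  have hinj : ∀ (g k : Γ) (x : N), g • τ x = k • τ x → g = k := fun g k x => h.eq_of_smul_eq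
  refine ⟨hr, hm, hrange, hmap, fun g k x => mul_smul _ _ _, hinj, hex, fun g =>
    ⟨(h.continuous_smul g).measurable, ?_⟩⟩
  rcases isEmpty_or_nonempty M with hM | hM
  · have : Subsingleton (Measure M) := inferInstance
    exact Subsingleton.elim _ _
  have := h.countable
  have hU : ⋃ g : Γ, range (fun x => g • τ x) = univ := eq_univ_of_forall fun y => by
    obtain ⟨g, hg⟩ := hex y
    exact mem_iUnion.2 ⟨g, p y, hg⟩
  have hd : Pairwise (Function.onFun Disjoint fun g : Γ => range fun x => g • τ x) := by
    intro g k hgk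
    refine disjoint_left.2 ?_
    rintro _ ⟨x, rfl⟩ ⟨x', hx'⟩
    have hxx : x' = x := by rw [← hr k x', ← hr g x]; exact congrArg p hx'
    subst hxx
    exact hgk (hinj _ _ _ hx').symm
  -- The measure is written as a sum over the tiles of the measure of `N`; acting by `g` only
  -- permutes the terms of this sum, so it preserves the measure.
  have hsum : ∀ A, MeasurableSet A → riemannianVolume n M A =
      ∑' k : Γ, riemannianVolume n N ((fun x => k • τ x) ⁻¹' A) := fun A hA => by
    have h1 : A = ⋃ k : Γ, A ∩ range (fun x => k • τ x) := by rw [← inter_iUnion, hU, inter_univ]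
    conv_lhs => rw [h1]
    rw [measure_iUnion (fun i j hij => (hd hij).mono inter_subset_right inter_subset_right)
      fun k => hA.inter (hrange k)]
    refine tsum_congr fun k => ?_
    rw [← Measure.restrict_apply hA, ← hmap k, Measure.map_apply (hm k) hA]
  ext A hA
  have hgm := (h.continuous_smul g).measurable
  rw [Measure.map_apply hgm hA, hsum _ (hgm hA), hsum A hA,
    ← (Equiv.mulLeft g).tsum_eq fun k : Γ => riemannianVolume n N ((fun x => k • τ x) ⁻¹' A)]
  refine tsum_congr fun k => ?_
  congr 1
  ext x
  simp [mul_smul]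

-- A compact set containing the values of a section meets every orbit, so the isometric action of
-- `Γ` is cocompact.
omit [MeasurableSpace N] [BorelSpace N] [MeasurableSpace M] [BorelSpace M] in
lemma hasCompactNeighborhoods [IsContMDiffRiemannianBundle (𝓡 n) ∞ (EuclideanSpace ℝ (Fin n))
      (fun y : M => TangentSpace (𝓡 n) y)] [CompactSpace N] : HasCompactNeighborhoods n M := by
  borelize M N
  rcases isEmpty_or_nonempty M with hM | hM
  · exact fun R _ K hK => ⟨K, hK, fun y => hM.elim y⟩
  have : LocallyCompactSpace M := ChartedSpace.locallyCompactSpace (EuclideanSpace ℝ (Fin n)) M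
  obtain ⟨τ, hτ, hpτ, K, hK, hτK⟩ := exists_measurable_section
    h.isCoveringMap.isLocalHomeomorph h.surjective
  refine hasCompactNeighborhoods_of_cocompact h.continuous_smul h.riemannianEDist_smul_le hK
    fun y => ?_
  obtain ⟨g, hg⟩ := h.exists_smul_eq y (τ (p y)) (hpτ _).symm
  exact ⟨g, hg ▸ hτK _⟩

end IsRiemannianGaloisCover

/-! ### Points far from a compact set -/

section Far

variable {M : Type*} [TopologicalSpace M]

/-- The points at distance more than `R` from every point of `K`. -/
def farSet (n : ℕ) [ChartedSpace (EuclideanSpace ℝ (Fin n)) M]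
    [RiemannianBundle (fun y : M => TangentSpace (𝓡 n) y)] (R : ENNReal) (K : Set M) : Set M :=
  {y | ∀ k ∈ K, R < Manifold.riemannianEDist (𝓡 n) k y}

variable {n : ℕ} [T2Space M] [ChartedSpace (EuclideanSpace ℝ (Fin n)) M]
  [IsManifold (𝓡 n) ∞ M] [RiemannianBundle (fun y : M => TangentSpace (𝓡 n) y)]
  [IsContMDiffRiemannianBundle (𝓡 n) ∞ (EuclideanSpace ℝ (Fin n))
      (fun y : M => TangentSpace (𝓡 n) y)]

lemma isOpen_farSet (R : ENNReal) {K : Set M} (hK : IsCompact K) : IsOpen (farSet n R K) := by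
  rw [isOpen_iff_eventually]
  intro y hy
  refine hK.eventually_forall_of_forall_eventually
    (P := fun y k => R < Manifold.riemannianEDist (𝓡 n) k y) fun k hk => ?_
  have hc : Continuous fun z : M × M => Manifold.riemannianEDist (𝓡 n) z.2 z.1 :=
    (continuous_riemannianEDist n M).comp continuous_swap
  exact (isOpen_Ioi.preimage hc).mem_nhds (hy k hk)

lemma HasCompactNeighborhoods.isCompact_compl_farSet (hM : HasCompactNeighborhoods n M)
    {R : ENNReal} (hR : R < ⊤) {K : Set M} (hK : IsCompact K) : IsCompact (farSet n R K)ᶜ := by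
  obtain ⟨K', hK', h⟩ := hM R hR K hK
  refine hK'.of_isClosed_subset (isOpen_farSet R hK).isClosed_compl fun y hy => ?_
  simp only [farSet, mem_compl_iff, mem_ofPred_eq, not_forall, not_lt] at hy
  obtain ⟨k, hk, hky⟩ := hy
  exact h k hk y hky

end Far

/-! ### Support, propagation and locality of operators -/

section Support

variable {N : Type*} [TopologicalSpace N]
  {F : Type*} [NormedAddCommGroup F] [NormedSpace ℂ F]
  {E : N → Type*} [TopologicalSpace (TotalSpace F E)] [∀ x, NormedAddCommGroup (E x)]
  [∀ x, InnerProductSpace ℂ (E x)] [FiberBundle F E] [VectorBundle ℂ F E]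
  [FiniteDimensional ℂ F] [ContinuousHermitianBundle F E] [CompactSpace N]
  {M : Type*} [TopologicalSpace M] [MeasurableSpace M] [BorelSpace M] {p : C(M, N)}
  {μ : Measure M}

lemma rep_mulC0 (f : ZeroAtInftyContinuousMap M ℂ) (u : L2 F E p μ) :
    ∀ᵐ y ∂μ, (mulC0 f u).rep y = f y • u.rep y := by
  have hs : MemL2 F E p μ fun y => f y • u.rep y := u.memL2_rep.smul
    (map_continuous f).aestronglyMeasurable fun y => f.toBCF.norm_coe_le_norm y
  have h : mulC0 f u = toL2 fun y => f y • u.rep y := by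
    conv_lhs => rw [← toL2_rep u, toL2_eq_mk u.memL2_rep]
    rw [toL2_eq_mk hs]
    rfl
  rw [h]
  exact rep_toL2 hs

lemma adjoint_mulC0 (f : ZeroAtInftyContinuousMap M ℂ) :
    ContinuousLinearMap.adjoint (mulC0 f : L2 F E p μ →L[ℂ] L2 F E p μ) = mulC0 (star f) := by
  symm
  rw [ContinuousLinearMap.eq_adjoint_iff]
  intro u v
  rw [L2.inner_eq, L2.inner_eq]
  refine integral_congr_ae ?_
  filter_upwards [rep_mulC0 (star f) u, rep_mulC0 f v] with y hy hy'
  rw [hy, hy', inner_smul_left, inner_smul_right]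
  simp

/-- Multiplication by a bounded measurable function. -/
lemma exists_rep_eq_smul {c : M → ℂ} (hc : Measurable c) {C : NNReal} (hC : ∀ y, ‖c y‖ₑ ≤ C)
    (u : L2 F E p μ) : ∃ v : L2 F E p μ, ∀ᵐ y ∂μ, v.rep y = c y • u.rep y :=
  ⟨wcomp (isAdmissible_id hc hC) (fun _ => rfl) u,
    rep_wcomp (isAdmissible_id hc hC) (fun _ => rfl) u⟩

variable (n : ℕ) [T2Space M] [ChartedSpace (EuclideanSpace ℝ (Fin n)) M]
  [IsManifold (𝓡 n) ∞ M] [RiemannianBundle (fun y : M => TangentSpace (𝓡 n) y)]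
  [IsContMDiffRiemannianBundle (𝓡 n) ∞ (EuclideanSpace ℝ (Fin n))
      (fun y : M => TangentSpace (𝓡 n) y)]

/-- `T` maps sections supported in a compact set `K` to sections supported in the closed
`R`-neighbourhood of `K`. -/
def IsLocalBy (R : ENNReal) (T : L2 F E p μ →L[ℂ] L2 F E p μ) : Prop :=
  ∀ K : Set M, IsCompact K → ∀ v : L2 F E p μ, (∀ᵐ y ∂μ, y ∉ K → v.rep y = 0) →
    ∀ᵐ y ∂μ, y ∈ farSet n R K → (T v).rep y = 0

variable {n} {R R' : ENNReal} {S T : L2 F E p μ →L[ℂ] L2 F E p μ}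

-- On the set `s` where `‖f₂‖` exceeds half of `‖f₂ k‖` one can divide by `f₂` boundedly. Thus a
-- section supported in `s` is `f₂ w` for some `w`, and `f₁ T f₂ = 0` makes `T` of it vanish where
-- `f₁` does not.
omit [T2Space M] [IsManifold (𝓡 n) ∞ M] [IsContMDiffRiemannianBundle (𝓡 n) ∞ (EuclideanSpace ℝ (Fin n))
      (fun y : M => TangentSpace (𝓡 n) y)] in
lemma exists_nhds_of_notMem_opSupport {y k : M} (h : (y, k) ∉ opSupport T) :
    ∃ W ∈ 𝓝 y, ∃ s ∈ 𝓝 k, MeasurableSet s ∧ ∀ v : L2 F E p μ, (∀ᵐ y ∂μ, y ∉ s → v.rep y = 0) →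
      ∀ᵐ y ∂μ, y ∈ W → (T v).rep y = 0 := by
  simp only [opSupport, mem_compl_iff, not_not, mem_ofPred_eq] at h
  obtain ⟨f₁, f₂, h₁, h₂, hT⟩ := h
  have hpos : 0 < ‖f₂ k‖ := norm_pos_iff.2 h₂
  have hsopen : IsOpen {y | ‖f₂ k‖ / 2 < ‖f₂ y‖} :=
    isOpen_lt continuous_const (map_continuous f₂).norm
  refine ⟨{y | f₁ y ≠ 0}, (isOpen_ne_fun (map_continuous f₁) continuous_const).mem_nhds h₁,
    _, hsopen.mem_nhds (by simpa using hpos), hsopen.measurableSet, fun v hv => ?_⟩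
  have hc : Measurable ({y | ‖f₂ k‖ / 2 < ‖f₂ y‖}.indicator fun y => (f₂ y)⁻¹) :=
    ((map_continuous f₂).measurable.inv).indicator hsopen.measurableSet
  obtain ⟨w, hw⟩ := exists_rep_eq_smul (C := (‖f₂ k‖ / 2)⁻¹.toNNReal) hc (fun y => by
    by_cases hy : y ∈ {y | ‖f₂ k‖ / 2 < ‖f₂ y‖}
    · rw [indicator_of_mem hy, ← ofReal_norm, norm_inv]
      exact ENNReal.ofReal_le_ofReal (inv_anti₀ (by positivity) (le_of_lt hy))
    · simp [indicator_of_notMem hy]) v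
  have hvw : v = mulC0 f₂ w := L2.ext_rep <| by
    filter_upwards [hv, hw, rep_mulC0 f₂ w] with y h1 h2 h3
    rw [h3, h2]
    by_cases hy : y ∈ {y | ‖f₂ k‖ / 2 < ‖f₂ y‖}
    · have hne : f₂ y ≠ 0 := by
        intro h0
        simp only [mem_ofPred_eq, h0, norm_zero] at hy
        linarith
      rw [indicator_of_mem hy, smul_smul, mul_inv_cancel₀ hne, one_smul]
    · rw [h1 hy, smul_zero, smul_zero]
  have h0 : mulC0 f₁ (T v) = 0 := by
    rw [hvw]
    exact congrArg (fun A : L2 F E p μ →L[ℂ] L2 F E p μ => A w) hT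
  filter_upwards [rep_mulC0 f₁ (T v), L2.rep_congr h0, L2.rep_zero (F := F) (E := E) (p := p)]
    with y h1 h2 h3 hy
  rw [h2, h3] at h1
  exact (smul_eq_zero.1 h1.symm).resolve_left hy

/-- For fixed `y` far from `K`, no pair `(y, k)` with `k` in `K` is in the support. Compactness of
`K` combines the resulting neighbourhoods, cutting `v` by indicator functions; second countability
then turns local vanishing near each `y` into vanishing almost everywhere. -/
lemma isLocalBy_of_propagation_le [SecondCountableTopology M] (h : propagation n T ≤ R) :
    IsLocalBy n R T := by
  intro K hK v hv
  have hloc : ∀ y ∈ farSet n R K, ∃ W ∈ 𝓝 y, ∀ᵐ y' ∂μ, y' ∈ W → (T v).rep y' = 0 := by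
    intro y hy
    -- The measurable superset `s'` is carried along because the sets `s` of the induction are
    -- arbitrary, while cutting `v` needs measurable ones.
    have key := hK.induction_on (p := fun s => ∃ W ∈ 𝓝 y, ∃ s', s ⊆ s' ∧ MeasurableSet s' ∧
      ∀ v : L2 F E p μ, (∀ᵐ y ∂μ, y ∉ s' → v.rep y = 0) →
      ∀ᵐ y ∂μ, y ∈ W → (T v).rep y = 0) ?_ ?_ ?_ ?_
    · obtain ⟨W, hW, s', hs', -, h⟩ := key
      refine ⟨W, hW, h v ?_⟩
      filter_upwards [hv] with y' hy' hys using hy' (mt (fun hk => hs' hk) hys)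
    · refine ⟨univ, univ_mem, ∅, Subset.rfl, MeasurableSet.empty, fun v hv => ?_⟩
      have : v = 0 := L2.ext_rep <| by
        filter_upwards [hv, L2.rep_zero (F := F) (E := E) (p := p)] with y h1 h2
        rw [h1 (notMem_empty y), h2]
      rw [this, map_zero]
      filter_upwards [L2.rep_zero (F := F) (E := E) (p := p)] with y h _ using h
    · rintro s t hst ⟨W, hW, s', hs', h⟩
      exact ⟨W, hW, s', hst.trans hs', h⟩
    · rintro s t ⟨W, hW, s', hs', hsm, h⟩ ⟨W', hW', t', ht', htm, h'⟩
      refine ⟨W ∩ W', inter_mem hW hW', s' ∪ t', union_subset_union hs' ht', hsm.union htm,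
        fun v hv => ?_⟩
      have hb : ∀ (A : Set M) (y : M), ‖A.indicator (fun _ => (1 : ℂ)) y‖ₑ ≤ (1 : NNReal) := by
        intro A y
        by_cases hy : y ∈ A <;> simp [hy]
      obtain ⟨v₁, hv₁⟩ := exists_rep_eq_smul (measurable_const.indicator hsm) (hb s') v
      obtain ⟨v₂, hv₂⟩ := exists_rep_eq_smul (measurable_const.indicator hsm.compl) (hb s'ᶜ) v
      have hsum : v = v₁ + v₂ := L2.ext_rep <| by
        filter_upwards [hv₁, hv₂, L2.rep_add v₁ v₂] with y h1 h2 h3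
        rw [h3, h1, h2, ← add_smul]
        by_cases hy : y ∈ s' <;> simp [hy]
      have e1 := h v₁ (by
        filter_upwards [hv₁] with y h1 hy
        rw [h1, indicator_of_notMem hy, zero_smul])
      have e2 := h' v₂ (by
        filter_upwards [hv₂, hv] with y h2 h3 hy
        rw [h2]
        by_cases hys : y ∈ s'
        · simp [hys]
        · rw [h3 (by simp [hys, hy]), smul_zero])
      have e3 : T v = T v₁ + T v₂ := by rw [hsum, map_add]
      filter_upwards [e1, e2, L2.rep_congr e3, L2.rep_add (T v₁) (T v₂)] with y h1 h2 h3 h4 hy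
      rw [h3, h4, h1 hy.1, h2 hy.2, add_zero]
    · intro k hk
      have hns : (y, k) ∉ opSupport T := fun hmem => by
        have h1 : Manifold.riemannianEDist (𝓡 n) y k ≤ propagation n T :=
          le_iSup₂_of_le (f := fun (z : M × M) (_ : z ∈ opSupport T) =>
            Manifold.riemannianEDist (𝓡 n) z.1 z.2) (y, k) hmem le_rfl
        have h2 := hy k hk
        rw [Manifold.riemannianEDist_comm] at h2
        exact absurd (h1.trans h) (not_le.2 h2)
      obtain ⟨W, hW, s, hs, hsm, h⟩ := exists_nhds_of_notMem_opSupport hns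
      exact ⟨s, mem_nhdsWithin_of_mem_nhds hs, W, hW, s, Subset.rfl, hsm, h⟩
  have hnull : μ {y | ¬(y ∈ farSet n R K → (T v).rep y = 0)} = 0 := by
    refine measure_null_of_locally_null _ fun y hy => ?_
    simp only [mem_ofPred_eq, Classical.not_imp] at hy
    obtain ⟨W, hW, hWT⟩ := hloc y hy.1
    refine ⟨W ∩ {y | ¬(y ∈ farSet n R K → (T v).rep y = 0)},
      inter_mem (mem_nhdsWithin_of_mem_nhds hW) self_mem_nhdsWithin, ?_⟩
    refine measure_mono_null ?_ (ae_iff.1 hWT)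
    rintro y' ⟨h1, h2⟩
    simp only [mem_ofPred_eq, Classical.not_imp] at h2 ⊢
    exact ⟨h1, h2.2⟩
  exact ae_iff.2 hnull

omit [MeasurableSpace M] [BorelSpace M] [IsManifold (𝓡 n) ∞ M] [RiemannianBundle (fun y : M => TangentSpace (𝓡 n) y)]
  [IsContMDiffRiemannianBundle (𝓡 n) ∞ (EuclideanSpace ℝ (Fin n))
      (fun y : M => TangentSpace (𝓡 n) y)] [ChartedSpace (EuclideanSpace ℝ (Fin n)) M] in
lemma exists_zeroAtInfty_bump [LocallyCompactSpace M] {y : M} {U : Set M} (hU : IsOpen U)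
    (hy : y ∈ U) : ∃ (f : ZeroAtInftyContinuousMap M ℂ) (K : Set M), f y ≠ 0 ∧ IsCompact K ∧
      K ⊆ U ∧ ∀ z ∉ K, f z = 0 := by
  obtain ⟨K, hK, hyK, hKU⟩ := exists_compact_subset hU hy
  obtain ⟨f, hf1, hf0, hfc, -⟩ := exists_continuous_one_zero_of_isCompact
    (isCompact_singleton (x := y)) (isOpen_interior (s := K)).isClosed_compl
    (disjoint_singleton_left.2 (by simpa using hyK))
  have hcs : HasCompactSupport fun z => (f z : ℂ) :=
    hfc.comp_left (g := fun r : ℝ => (r : ℂ)) (by simp)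
  refine ⟨⟨⟨fun z => (f z : ℂ), Complex.continuous_ofReal.comp f.continuous⟩,
    hcs.is_zero_at_infty⟩, K, ?_, hK, hKU, fun z hz => ?_⟩
  · have : f y = 1 := hf1 rfl
    change (f y : ℂ) ≠ 0
    simp [this]
  · have : f z = 0 := hf0 (mt (fun h => interior_subset h) hz)
    change (f z : ℂ) = 0
    simp [this]

/-- If the distance of a pair exceeds `R`, so does that of all pairs in a product neighbourhood, and
bump functions supported there show that the pair is not in the support. -/
lemma IsLocalBy.propagation_le (h : IsLocalBy n R T) : propagation n T ≤ R := by
  have : LocallyCompactSpace M := ChartedSpace.locallyCompactSpace (EuclideanSpace ℝ (Fin n)) M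
  refine iSup₂_le fun z hz => ?_
  by_contra hlt
  rw [not_le] at hlt
  refine hz ?_
  have hopen : IsOpen {z : M × M | R < Manifold.riemannianEDist (𝓡 n) z.1 z.2} :=
    isOpen_Ioi.preimage (continuous_riemannianEDist n M)
  obtain ⟨U, V, hU, hV, hyU, hkV, hUV⟩ := isOpen_prod_iff.1 hopen z.1 z.2 hlt
  obtain ⟨f₁, K₁, h₁, hK₁, hKU, hf₁⟩ := exists_zeroAtInfty_bump hU hyU
  obtain ⟨f₂, K₂, h₂, hK₂, hKV, hf₂⟩ := exists_zeroAtInfty_bump hV hkV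
  refine ⟨f₁, f₂, h₁, h₂, ContinuousLinearMap.ext fun v => L2.ext_rep ?_⟩
  have hv := h K₂ hK₂ (mulC0 f₂ v) (by
    filter_upwards [rep_mulC0 f₂ v] with y hy hyK
    rw [hy, hf₂ y hyK, zero_smul])
  filter_upwards [rep_mulC0 f₁ (T (mulC0 f₂ v)), hv, L2.rep_zero (F := F) (E := E) (p := p)]
    with y h1 h2 h3
  change (mulC0 f₁ (T (mulC0 f₂ v))).rep y = (0 : L2 F E p μ).rep y
  rw [h1, h3]
  by_cases hy : y ∈ K₁
  · rw [h2, smul_zero]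
    intro k hk
    have : R < Manifold.riemannianEDist (𝓡 n) y k :=
      hUV (mk_mem_prod (hKU hy) (hKV hk))
    rwa [Manifold.riemannianEDist_comm] at this
  · rw [hf₁ y hy, zero_smul]

omit [T2Space M] [IsManifold (𝓡 n) ∞ M] [IsContMDiffRiemannianBundle (𝓡 n) ∞ (EuclideanSpace ℝ (Fin n))
      (fun y : M => TangentSpace (𝓡 n) y)] in
lemma IsLocalBy.add (hS : IsLocalBy n R S) (hT : IsLocalBy n R T) : IsLocalBy n R (S + T) := by
  intro K hK v hv
  filter_upwards [hS K hK v hv, hT K hK v hv, L2.rep_add (S v) (T v)] with y h1 h2 h3 hy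
  change (S v + T v).rep y = 0
  rw [h3, h1 hy, h2 hy, add_zero]

/-- Locality is tested on compactly supported sections only. The Heine-Borel property keeps `T v`
compactly supported, so that `S` can be applied next. -/
lemma IsLocalBy.mul (hM : HasCompactNeighborhoods n M) (hS : IsLocalBy n R S)
    (hT : IsLocalBy n R' T) (hR' : R' < ⊤) : IsLocalBy n (R' + R) (S * T) := by
  intro K hK v hv
  have h1 := hS _ (hM.isCompact_compl_farSet hR' hK) (T v) (by
    filter_upwards [hT K hK v hv] with y hy hyf using hy (not_not.1 hyf))
  filter_upwards [h1] with y hy hyf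
  refine hy fun a ha => ?_
  simp only [farSet, mem_compl_iff, mem_ofPred_eq, not_forall, not_lt] at ha
  obtain ⟨k, hk, hka⟩ := ha
  by_contra hcon
  exact absurd (hyf k hk) (not_lt.2 (Manifold.riemannianEDist_triangle.trans
    (add_le_add hka (not_lt.1 hcon))))

omit [T2Space M] [IsManifold (𝓡 n) ∞ M] [IsContMDiffRiemannianBundle (𝓡 n) ∞ (EuclideanSpace ℝ (Fin n))
      (fun y : M => TangentSpace (𝓡 n) y)] in
lemma isLocalBy_algebraMap (c : ℂ) :
    IsLocalBy n 0 (algebraMap ℂ (L2 F E p μ →L[ℂ] L2 F E p μ) c) := by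
  intro K hK v hv
  filter_upwards [hv, L2.rep_smul c v] with y h1 h2 hy
  change (c • v).rep y = 0
  rw [h2, h1, smul_zero]
  intro hyK
  have := hy y hyK
  rw [Manifold.riemannianEDist_self] at this
  exact lt_irrefl _ this

-- Taking adjoints of `f₁ T f₂ = 0` shows that the support of the adjoint lies in the support of `T`
-- with coordinates exchanged.
omit [T2Space M] [IsManifold (𝓡 n) ∞ M] [IsContMDiffRiemannianBundle (𝓡 n) ∞ (EuclideanSpace ℝ (Fin n))
      (fun y : M => TangentSpace (𝓡 n) y)] in
lemma propagation_adjoint_le :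
    propagation n (ContinuousLinearMap.adjoint T) ≤ propagation n T := by
  refine iSup₂_le fun z hz => ?_
  have hmem : (z.2, z.1) ∈ opSupport T := by
    rintro ⟨f₁, f₂, h₁, h₂, h⟩
    refine hz ⟨star f₂, star f₁, by simpa using h₂, by simpa using h₁, ?_⟩
    rw [← adjoint_mulC0, ← adjoint_mulC0, ← ContinuousLinearMap.adjoint_comp,
      ← ContinuousLinearMap.adjoint_comp, ContinuousLinearMap.comp_assoc, h, map_zero]
  rw [Manifold.riemannianEDist_comm]
  exact le_iSup₂_of_le (f := fun (z : M × M) (_ : z ∈ opSupport T) =>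
            Manifold.riemannianEDist (𝓡 n) z.1 z.2) (z.2, z.1) hmem le_rfl

end Support

/-! ### Unitarity of the group action -/

section Adjoint

variable {Γ H₀ H : Type*} [Group Γ] [NormedAddCommGroup H₀] [InnerProductSpace ℂ H₀]
  [NormedAddCommGroup H] [InnerProductSpace ℂ H] [CompleteSpace H]
  {U : Γ → H →L[ℂ] H} {i : Γ → H₀ →L[ℂ] H} {κ : Γ → H →L[ℂ] H₀}

lemma IsFrame.adjoint_translate (h : IsFrame U i κ) (g : Γ) :
    ContinuousLinearMap.adjoint (U g) = U g⁻¹ := by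
  refine h.ext_incl fun k f => ext_inner_right ℂ fun w => ?_
  rw [ContinuousLinearMap.adjoint_inner_left, h.translate_incl, h.inner_left, h.inner_left,
    ← h.proj_translate g (g⁻¹ * k) w,
    mul_inv_cancel_left]

lemma CommutesWith.adjoint (h : IsFrame U i κ) {T : H →L[ℂ] H} (hT : CommutesWith U T) :
    CommutesWith U (ContinuousLinearMap.adjoint T) := by
  intro g v
  have h1 : T.comp (U g⁻¹) = (U g⁻¹).comp T := ContinuousLinearMap.ext fun w => hT g⁻¹ w
  have h2 := congrArg ContinuousLinearMap.adjoint h1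
  rw [ContinuousLinearMap.adjoint_comp, ContinuousLinearMap.adjoint_comp, h.adjoint_translate,
    inv_inv] at h2
  exact congrArg (fun A : H →L[ℂ] H => A v) h2.symm

end Adjoint

/-! ### Finite propagation, bandedness and folding -/

section Locality

variable {N : Type*} [TopologicalSpace N]
  {F : Type*} [NormedAddCommGroup F] [NormedSpace ℂ F]
  {E : N → Type*} [TopologicalSpace (TotalSpace F E)] [∀ x, NormedAddCommGroup (E x)]
  [∀ x, InnerProductSpace ℂ (E x)] [FiberBundle F E] [VectorBundle ℂ F E]
  [FiniteDimensional ℂ F] [ContinuousHermitianBundle F E] [CompactSpace N]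

section Algebra

variable {M : Type*} [TopologicalSpace M] [MeasurableSpace M] [BorelSpace M] {p : C(M, N)}
  {μ : Measure M}
  {n : ℕ} [T2Space M] [SecondCountableTopology M] [ChartedSpace (EuclideanSpace ℝ (Fin n)) M]
  [IsManifold (𝓡 n) ∞ M] [RiemannianBundle (fun y : M => TangentSpace (𝓡 n) y)]
  [IsContMDiffRiemannianBundle (𝓡 n) ∞ (EuclideanSpace ℝ (Fin n))
      (fun y : M => TangentSpace (𝓡 n) y)]
  {Γ H₀ : Type*} [Group Γ] [NormedAddCommGroup H₀] [InnerProductSpace ℂ H₀]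
  {U : Γ → L2 F E p μ →L[ℂ] L2 F E p μ} {i : Γ → H₀ →L[ℂ] L2 F E p μ}
  {κ : Γ → L2 F E p μ →L[ℂ] H₀}

/-- The `*`-algebra of operators of finite propagation which commute with a unitary
representation. -/
def finitePropagationAlgebra (hM : HasCompactNeighborhoods n M) (h : IsFrame U i κ) :
    StarSubalgebra ℂ (L2 F E p μ →L[ℂ] L2 F E p μ) where
  carrier := {T | CommutesWith U T ∧ propagation n T < ⊤}
  mul_mem' {S T} hS hT := by
    refine ⟨fun g v => ?_, ?_⟩
    · change S (T (U g v)) = U g (S (T v))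
      rw [hT.1, hS.1]
    · refine ((isLocalBy_of_propagation_le le_rfl).mul hM (isLocalBy_of_propagation_le le_rfl)
        hT.2).propagation_le.trans_lt (ENNReal.add_lt_top.2 ⟨hT.2, hS.2⟩)
  add_mem' {S T} hS hT := by
    refine ⟨fun g v => ?_, ?_⟩
    · change S (U g v) + T (U g v) = U g (S v + T v)
      rw [hT.1, hS.1, map_add]
    · exact ((isLocalBy_of_propagation_le (le_max_left _ _)).add
        (isLocalBy_of_propagation_le (le_max_right _ _))).propagation_le.trans_lt
          (max_lt hS.2 hT.2)
  algebraMap_mem' c := by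
    refine ⟨fun g v => ?_, (isLocalBy_algebraMap c).propagation_le.trans_lt ENNReal.zero_lt_top⟩
    change c • U g v = U g (c • v)
    rw [map_smul]
  star_mem' {T} hT := ⟨hT.1.adjoint h, propagation_adjoint_le.trans_lt hT.2⟩

end Algebra

lemma ae_rep_sum_eq_zero {M : Type*} [TopologicalSpace M] [MeasurableSpace M] [BorelSpace M]
    {p : C(M, N)} {μ : Measure M} {ι : Type*} {A : Finset ι} {w : ι → L2 F E p μ} {s : Set M}
    (h : ∀ i ∈ A, ∀ᵐ y ∂μ, y ∈ s → (w i).rep y = 0) :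
    ∀ᵐ y ∂μ, y ∈ s → (∑ i ∈ A, w i).rep y = 0 := by
  classical
  induction A using Finset.induction_on with
  | empty =>
    filter_upwards [L2.rep_zero (F := F) (E := E) (p := p)] with y hy _
    rwa [Finset.sum_empty]
  | insert a A ha ih =>
    rw [Finset.sum_insert ha]
    filter_upwards [h a (by simp), ih fun i hi => h i (by simp [hi]),
      L2.rep_add (w a) (∑ i ∈ A, w i)] with y h1 h2 h3 hy
    rw [h3, h1 hy, h2 hy, add_zero]

variable [MeasurableSpace N] [BorelSpace N] {ν : Measure N}
  {M₁ : Type*} [TopologicalSpace M₁] [MeasurableSpace M₁] [BorelSpace M₁] {p₁ : C(M₁, N)}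
  {μ₁ : Measure M₁} {Γ₁ : Type*} [Group Γ₁] [MulAction Γ₁ M₁] {σ₁ : Γ₁ → N → M₁}
  (h₁ : IsSectionSystem p₁ ν μ₁ σ₁)
  {M₂ : Type*} [TopologicalSpace M₂] [MeasurableSpace M₂] [BorelSpace M₂] {p₂ : C(M₂, N)}
  {μ₂ : Measure M₂} {Γ₂ : Type*} [Group Γ₂] [MulAction Γ₂ M₂] {σ₂ : Γ₂ → N → M₂}
  (h₂ : IsSectionSystem p₂ ν μ₂ σ₂)

/-- The images of the sections are relatively compact, and locally finite. -/
structure IsLocallyFinite {N M Γ : Type*} [TopologicalSpace M] (σ : Γ → N → M) : Prop where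
  exists_isCompact : ∀ g, ∃ K : Set M, IsCompact K ∧ ∀ x, σ g x ∈ K
  finite : ∀ K : Set M, IsCompact K → {g | ∃ x, σ g x ∈ K}.Finite

lemma IsSectionSystem.ae_baseRep_proj (g : Γ₁) {w : L2 F E p₁ μ₁} {s : Set M₁}
    (hw : ∀ᵐ y ∂μ₁, y ∈ s → w.rep y = 0) :
    ∀ᵐ x ∂ν, σ₁ g x ∈ s → baseRep (h₁.proj g w) x = 0 := by
  filter_upwards [h₁.rep_proj g w, h₁.ae_of_ae_comp g hw] with x h1 h2 hx
  rw [h1, h2 hx, fiberCast_zero]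

lemma IsSectionSystem.proj_eq_zero {g : Γ₁} {w : L2 F E p₁ μ₁} {s : Set M₁}
    (hw : ∀ᵐ y ∂μ₁, y ∈ s → w.rep y = 0) (hg : ∀ x, σ₁ g x ∈ s) : h₁.proj g w = 0 := by
  refine L2.ext_rep ?_
  filter_upwards [h₁.ae_baseRep_proj g hw,
    L2.rep_zero (F := F) (E := E) (p := ContinuousMap.id N)] with x h1 h2
  change baseRep (h₁.proj g w) x = _
  exact (h1 (hg x)).trans h2.symm

lemma IsSectionSystem.ae_rep_incl (g : Γ₁) {f : L2 F E (ContinuousMap.id N) ν} {s : Set N}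
    (hf : ∀ᵐ x ∂ν, x ∈ s → baseRep f x = 0) :
    ∀ᵐ y ∂μ₁, (y ∈ range (σ₁ g) → p₁ y ∈ s) → (h₁.incl g f).rep y = 0 := by
  filter_upwards [h₁.rep_incl g f, h₁.ae_range g hf] with y h1 h2 hy
  rw [h1]
  by_cases hyr : y ∈ range (σ₁ g)
  · rw [h2 hyr (hy hyr), smul_zero]
  · rw [indicator_of_notMem hyr, zero_smul]

variable {n : ℕ} [T2Space M₁] [ChartedSpace (EuclideanSpace ℝ (Fin n)) M₁]
  [IsManifold (𝓡 n) ∞ M₁] [RiemannianBundle (fun y : M₁ => TangentSpace (𝓡 n) y)]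
  [IsContMDiffRiemannianBundle (𝓡 n) ∞ (EuclideanSpace ℝ (Fin n))
      (fun y : M₁ => TangentSpace (𝓡 n) y)]
  [T2Space M₂] [ChartedSpace (EuclideanSpace ℝ (Fin n)) M₂]
  [IsManifold (𝓡 n) ∞ M₂] [RiemannianBundle (fun y : M₂ => TangentSpace (𝓡 n) y)]
  [IsContMDiffRiemannianBundle (𝓡 n) ∞ (EuclideanSpace ℝ (Fin n))
      (fun y : M₂ => TangentSpace (𝓡 n) y)]

/-- The tile of `1` lies in a compact set, `T` spreads sections supported there only into a larger
compact set, and that meets finitely many tiles. -/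
lemma IsLocalBy.isBanded (hM : HasCompactNeighborhoods n M₁) (hσ : IsLocallyFinite σ₁)
    {T : L2 F E p₁ μ₁ →L[ℂ] L2 F E p₁ μ₁} {R : ENNReal} (hT : IsLocalBy n R T) (hR : R < ⊤) :
    IsBanded (H₀ := L2 F E (ContinuousMap.id N) ν) (H := L2 F E p₁ μ₁) h₁.incl h₁.proj T := by
  obtain ⟨K, hK, hσK⟩ := hσ.exists_isCompact 1
  refine (hσ.finite _ (hM.isCompact_compl_farSet hR hK)).subset ?_
  rintro g ⟨f, hf⟩
  by_contra hcon
  simp only [mem_ofPred_eq, not_exists, mem_compl_iff, not_not] at hcon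
  refine hf (h₁.proj_eq_zero (hT K hK _ ?_) hcon)
  filter_upwards [h₁.rep_incl 1 f] with y hy hyK
  rw [hy, indicator_of_notMem, zero_smul]
  rintro ⟨x, rfl⟩
  exact hyK (hσK x)

/-- The push-forward of an operator of finite propagation has finite propagation. -/
lemma IsFold.isLocalBy [Countable Γ₁] [Countable Γ₂] (hp₁ : ∀ (g : Γ₁) (y : M₁), p₁ (g • y) = p₁ y)
    (hp₂ : ∀ (g : Γ₂) (y : M₂), p₂ (g • y) = p₂ y)
    (hM : HasCompactNeighborhoods n M₁) (hσ₁ : IsLocallyFinite σ₁) (hσ₂ : IsLocallyFinite σ₂)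
    {q : Γ₁ →* Γ₂} (hq : Function.Surjective q) {ϖ : C(M₁, M₂)}
    (hσ : ∀ g x, σ₂ (q g) x = ϖ (σ₁ g x))
    (hϖ : ∀ y y', Manifold.riemannianEDist (𝓡 n) (ϖ y) (ϖ y') ≤
      Manifold.riemannianEDist (𝓡 n) y y')
    {T : L2 F E p₁ μ₁ →L[ℂ] L2 F E p₁ μ₁} {X : L2 F E p₂ μ₂ →L[ℂ] L2 F E p₂ μ₂}
    {R : ENNReal} (hT : IsLocalBy n R T) (hR : R < ⊤) (hU : CommutesWith (h₁.action hp₁) T)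
    (hX : IsFold (H₀ := L2 F E (ContinuousMap.id N) ν) q h₁.incl h₁.proj h₂.incl T X) :
    IsLocalBy n R X := by
  have hf₁ := h₁.isFrame (F := F) (E := E) hp₁
  have hf₂ := h₂.isFrame (F := F) (E := E) hp₂
  have hb := hT.isBanded h₁ hM hσ₁ hR
  intro K hK u hu
  choose t ht using hq
  choose C hC hσC using hσ₁.exists_isCompact
  set A := (hσ₂.finite K hK).toFinset with hA
  have hu_sum : u = ∑ γ ∈ A, h₂.incl γ (h₂.proj γ u) := by
    refine hf₂.eq_finset_sum fun γ hγ => h₂.proj_eq_zero (s := Kᶜ) hu fun x hx => hγ ?_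
    exact (hσ₂.finite K hK).mem_toFinset.2 ⟨x, hx⟩
  -- The finitely many tile components of `u` are lifted to `M₁`, the component at `γ` to the tile
  -- of an arbitrary preimage `t γ`. This gives a compactly supported `v` with push-forward `u`.
  set v : L2 F E p₁ μ₁ := ∑ γ ∈ A, h₁.incl (t γ) (h₂.proj γ u) with hv
  have hvfin : FinSupported h₁.proj v := FinSupported.sum fun γ _ => hf₁.finSupported_incl _ _
  have hpush : push q h₁.proj h₂.incl v = u := by
    rw [hv, push_sum q fun γ _ => hf₁.finSupported_incl _ _]
    conv_rhs => rw [hu_sum]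
    refine Finset.sum_congr rfl fun γ _ => ?_
    rw [hf₁.push_incl, ht]
  -- Intersecting with the preimage of `K` preserves the exact constant `R`: a point whose image is
  -- far from `K` is far from `L`, because `ϖ` does not increase distances.
  set L : Set M₁ := (⋃ γ ∈ A, C (t γ)) ∩ ϖ ⁻¹' K with hL
  have hLc : IsCompact L := (A.isCompact_biUnion fun γ _ => hC _).inter_right
    (hK.isClosed.preimage ϖ.continuous)
  have hvL : ∀ᵐ y ∂μ₁, y ∉ L → v.rep y = 0 := by
    refine ae_rep_sum_eq_zero (s := Lᶜ) fun γ hγ => ?_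
    filter_upwards [h₁.ae_rep_incl (t γ) (h₂.ae_baseRep_proj (s := Kᶜ) γ hu)] with y hy hyL
    refine hy fun hyr hyK => hyL ⟨?_, ?_⟩
    · obtain ⟨x, rfl⟩ := hyr
      exact mem_iUnion₂.2 ⟨γ, hγ, hσC _ x⟩
    · rw [← ht γ, hσ, h₁.mem_range_iff.1 hyr] at hyK
      exact hyK
  have hTv := hT L hLc v hvL
  obtain ⟨B, hB⟩ := (hb.finSupported hf₁ hU hvfin).exists_finset
  have hXu : X u = ∑ a ∈ B, h₂.incl (q a) (h₁.proj a (T v)) := by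
    rw [← hpush, hX.apply_push hf₁ hb hU hvfin, push_eq_sum q hB]
  rw [hXu]
  refine ae_rep_sum_eq_zero fun a _ => ?_
  filter_upwards [h₂.ae_rep_incl (q a) (h₁.ae_baseRep_proj a hTv)] with z hz hzK
  refine hz fun hzr k hk => ?_
  refine (hzK (ϖ k) hk.2).trans_le ?_
  rw [← h₂.mem_range_iff.1 hzr, hσ]
  simpa only [← hσ, h₂.right_inv, h₂.mem_range_iff.1 hzr] using hϖ k (σ₁ a (p₂ z))

end Locality

/-- The summands of a partition of unity meet only finitely many of the images of the sections. -/
lemma LiftedPartition.exists_finset {N M Γ : Type*} [TopologicalSpace N] [CompactSpace N]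
    [TopologicalSpace M] [Group Γ] [MulAction Γ M] {p : C(M, N)} (hp : IsLocalHomeomorph p)
    {ι : Type} [Fintype ι] (P : LiftedPartition p ι) {σ : Γ → N → M} (hσ : IsLocallyFinite σ) :
    ∃ A : Finset Γ, ∀ b x i, P.φ₁ (1 : Γ) i (σ b x) ≠ 0 → b ∈ A := by
  classical
  -- On the lift, `p` is a homeomorphism onto `U i`, so this set is a copy of the closed support of
  -- `φ i`, which is compact in `N`; local finiteness of the tiles then applies.
  have hK : ∀ i, IsCompact (P.lift i ∩ p ⁻¹' tsupport (P.φ i)) := fun i => by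
    have hloc : IsLocalHomeomorph fun y : P.lift i => p y :=
      hp.comp (P.isOpen_lift i).isOpenEmbedding_subtypeVal.isLocalHomeomorph
    have hemb := hloc.isOpenEmbedding_of_injective fun y y' h =>
      Subtype.ext ((P.bijOn i).injOn y.2 y'.2 h)
    have hc := (hemb.isInducing.isCompact_preimage' (isClosed_tsupport (P.φ i)).isCompact
      fun x hx => by
        obtain ⟨y, hy, rfl⟩ := (P.bijOn i).surjOn (P.isSubordinate i hx)
        exact ⟨⟨y, hy⟩, rfl⟩).image continuous_subtype_val
    convert hc using 1
    ext y
    simp [and_comm]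
  refine ⟨Finset.univ.biUnion fun i => (hσ.finite _ (hK i)).toFinset, fun b x i hne => ?_⟩
  refine Finset.mem_biUnion.2 ⟨i, Finset.mem_univ i, (Set.Finite.mem_toFinset _).2 ⟨x, ?_⟩⟩
  rw [LiftedPartition.φ₁, inv_one, one_smul, indicator_apply_ne_zero] at hne
  exact ⟨hne.1, subset_tsupport _ hne.2⟩

lemma IsRiemannianGaloisCover.isLocallyFinite {n : ℕ} {N : Type*} [TopologicalSpace N] [T2Space N]
    [ChartedSpace (EuclideanSpace ℝ (Fin n)) N] [RiemannianBundle (fun x : N => TangentSpace (𝓡 n) x)]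
    {M : Type*} [TopologicalSpace M] [ChartedSpace (EuclideanSpace ℝ (Fin n)) M]
    [RiemannianBundle (fun y : M => TangentSpace (𝓡 n) y)] {Γ : Type*} [Group Γ] [MulAction Γ M]
    {p : C(M, N)} (h : IsRiemannianGaloisCover n Γ p) {τ : N → M} {K : Set M} (hK : IsCompact K)
    (hτ : ∀ x, τ x ∈ K) : IsLocallyFinite fun (g : Γ) x => g • τ x where
  exists_isCompact g := ⟨_, hK.image (h.continuous_smul g), fun x => mem_image_of_mem _ (hτ x)⟩
  finite _ hK' := (h.finite_setOf_smul_mem hK hK').subset fun _ ⟨x, hx⟩ => ⟨τ x, hτ x, hx⟩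

lemma _root_.Subgroup.IsComplement.existsUnique_eq {G G' : Type*} [Group G] [Group G']
    {f : G →* G'} (hf : Function.Surjective f) {S : Set G}
    (hS : Subgroup.IsComplement (f.ker : Set G) S) (γ : G') : ∃! s : S, f s = γ := by
  obtain ⟨g, rfl⟩ := hf γ
  obtain ⟨x, hx, -⟩ := Subgroup.isComplement_iff_existsUnique.1 hS g
  have hx1 : f x.1 = 1 := x.1.2
  refine ⟨x.2, by rw [← hx, map_mul, hx1, one_mul], fun s hs => ?_⟩
  have hmem : (s : G) * (x.2 : G)⁻¹ ∈ f.ker := by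
    rw [MonoidHom.mem_ker, map_mul, map_inv, hs, ← hx, map_mul, hx1, one_mul, mul_inv_cancel]
  have := (Subgroup.isComplement_iff_existsUnique.1 hS (s : G)).unique
    (y₁ := (⟨_, hmem⟩, x.2)) (y₂ := (⟨1, f.ker.one_mem⟩, s)) (by simp) (by simp)
  exact (congrArg Prod.snd this).symm

lemma L2.subsingleton_of_isEmpty {N : Type*} [TopologicalSpace N]
    {F : Type*} [NormedAddCommGroup F] [NormedSpace ℂ F]
    {E : N → Type*} [TopologicalSpace (TotalSpace F E)] [∀ x, NormedAddCommGroup (E x)]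
    [∀ x, InnerProductSpace ℂ (E x)] [FiberBundle F E] [VectorBundle ℂ F E]
    [FiniteDimensional ℂ F] [ContinuousHermitianBundle F E] [CompactSpace N]
    {M : Type*} [TopologicalSpace M] [MeasurableSpace M] [BorelSpace M] {p : C(M, N)}
    {μ : Measure M} [IsEmpty M] : Subsingleton (L2 F E p μ) :=
  ⟨fun _ _ => L2.ext_rep (Eventually.of_forall fun y => isEmptyElim y)⟩

end Folding

theorem proposition3p3 {n : ℕ}
    -- the closed Riemannian manifold `N`
    {N : Type*} [TopologicalSpace N] [T2Space N] [CompactSpace N]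
    [ChartedSpace (EuclideanSpace ℝ (Fin n)) N] [IsManifold (𝓡 n) ∞ N]
    [RiemannianBundle (fun x : N => TangentSpace (𝓡 n) x)]
    [IsContMDiffRiemannianBundle (𝓡 n) ∞ (EuclideanSpace ℝ (Fin n))
      (fun x : N => TangentSpace (𝓡 n) x)]
    -- the Hermitian vector bundle `E` on `N`
    {F : Type*} [NormedAddCommGroup F] [NormedSpace ℂ F] [FiniteDimensional ℂ F]
    {E : N → Type*} [TopologicalSpace (TotalSpace F E)] [∀ x, NormedAddCommGroup (E x)]
    [∀ x, InnerProductSpace ℂ (E x)] [FiberBundle F E] [VectorBundle ℂ F E]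
    [ContinuousHermitianBundle F E]
    -- the Riemannian manifolds `M₁` and `M₂`
    {M₁ : Type*} [TopologicalSpace M₁] [T2Space M₁] [SecondCountableTopology M₁]
    [MeasurableSpace M₁] [BorelSpace M₁]
    [ChartedSpace (EuclideanSpace ℝ (Fin n)) M₁] [IsManifold (𝓡 n) ∞ M₁]
    [RiemannianBundle (fun y : M₁ => TangentSpace (𝓡 n) y)]
    [IsContMDiffRiemannianBundle (𝓡 n) ∞ (EuclideanSpace ℝ (Fin n))
      (fun y : M₁ => TangentSpace (𝓡 n) y)]
    {M₂ : Type*} [TopologicalSpace M₂] [T2Space M₂] [SecondCountableTopology M₂]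
    [MeasurableSpace M₂] [BorelSpace M₂]
    [ChartedSpace (EuclideanSpace ℝ (Fin n)) M₂] [IsManifold (𝓡 n) ∞ M₂]
    [RiemannianBundle (fun y : M₂ => TangentSpace (𝓡 n) y)]
    [IsContMDiffRiemannianBundle (𝓡 n) ∞ (EuclideanSpace ℝ (Fin n))
      (fun y : M₂ => TangentSpace (𝓡 n) y)]
    -- the deck transformation groups, with `Γ₂ ≅ Γ₁ ⧸ H`
    {Γ₁ Γ₂ : Type*} [Group Γ₁] [Group Γ₂] [MulAction Γ₁ M₁] [MulAction Γ₂ M₂]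
    (H : Subgroup Γ₁) [H.Normal] (e : Γ₁ ⧸ H ≃* Γ₂)
    -- the Galois covers of `N`, and the projection `ϖ` from `M₁` to `M₂`
    (p₁ : C(M₁, N)) (p₂ : C(M₂, N)) (h₁ : IsRiemannianGaloisCover n Γ₁ p₁)
    (h₂ : IsRiemannianGaloisCover n Γ₂ p₂)
    (ϖ : C(M₁, M₂)) (hϖ : ∀ y, p₂ (ϖ y) = p₁ y)
    (hϖ_smul : ∀ (g : Γ₁) (y : M₁), ϖ (g • y) = e (QuotientGroup.mk g) • ϖ y) :
    -- the `*`-algebras of bounded equivariant operators of finite propagation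
    ∃ (B₁ : StarSubalgebra ℂ (L2 F E p₁ (riemannianVolume n M₁) →L[ℂ]
        L2 F E p₁ (riemannianVolume n M₁)))
      (B₂ : StarSubalgebra ℂ (L2 F E p₂ (riemannianVolume n M₂) →L[ℂ]
        L2 F E p₂ (riemannianVolume n M₂))),
      (∀ T, T ∈ B₁ ↔ IsEquivariant h₁.map_smul T ∧ propagation n T < ⊤) ∧
      (∀ T, T ∈ B₂ ↔ IsEquivariant h₂.map_smul T ∧ propagation n T < ⊤) ∧
      -- the folding map, the same for all partitions of unity and coset representatives
      ∃ Ψ : B₁ →⋆ₐ[ℂ] B₂,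
        ∀ (ι : Type) [Fintype ι] (P : LiftedPartition p₁ ι) (S : Set Γ₁),
          Subgroup.IsComplement (H : Set Γ₁) S →
          (∀ (g : Γ₁) (j : ι) (u : L2 F E p₂ (riemannianVolume n M₂)),
            MemL2 F E p₁ (riemannianVolume n M₁) (pulledPiece hϖ P g j u.rep)) ∧
          (∀ (g : Γ₁) (i : ι) (v : L2 F E p₁ (riemannianVolume n M₁)),
            MemL2 F E p₂ (riemannianVolume n M₂) (pushedPiece hϖ P g i v.rep)) ∧
          ∀ (T : B₁) (u : L2 F E p₂ (riemannianVolume n M₂)),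
            HasSum (fun k : Γ₁ × S => ∑ i, ∑ j,
                foldingTerm (μ₁ := riemannianVolume n M₁) hϖ P T.1 u k.1 k.2 i j)
              ((Ψ T).1 u) := by
  -- Nonemptiness is needed for a Borel section; for empty `M₁` everything is empty and both L²
  -- spaces are trivial.
  rcases isEmpty_or_nonempty M₁ with hM | hM
  · have : IsEmpty N := h₁.surjective.isEmpty
    have : IsEmpty M₂ := p₂.toFun.isEmpty
    have := L2.subsingleton_of_isEmpty (F := F) (E := E) (p := p₁) (μ := riemannianVolume n M₁)
    have := L2.subsingleton_of_isEmpty (F := F) (E := E) (p := p₂) (μ := riemannianVolume n M₂)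
    have hprop₁ : ∀ T : L2 F E p₁ (riemannianVolume n M₁) →L[ℂ]
        L2 F E p₁ (riemannianVolume n M₁), propagation n T < ⊤ := fun T =>
      (iSup₂_le fun z _ => isEmptyElim z.1 : propagation n T ≤ 0).trans_lt ENNReal.zero_lt_top
    have hprop₂ : ∀ T : L2 F E p₂ (riemannianVolume n M₂) →L[ℂ]
        L2 F E p₂ (riemannianVolume n M₂), propagation n T < ⊤ := fun T =>
      (iSup₂_le fun z _ => isEmptyElim z.1 : propagation n T ≤ 0).trans_lt ENNReal.zero_lt_top
    refine ⟨⊤, ⊤, fun T => ⟨fun _ => ⟨fun g u v _ => Eventually.of_forall fun y => isEmptyElim y,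
      hprop₁ T⟩, fun _ => StarSubalgebra.mem_top⟩,
      fun T => ⟨fun _ => ⟨fun g u v _ => Eventually.of_forall fun y => isEmptyElim y,
      hprop₂ T⟩, fun _ => StarSubalgebra.mem_top⟩,
      { toFun := fun _ => 0
        map_one' := Subsingleton.elim _ _
        map_mul' := fun _ _ => Subsingleton.elim _ _
        map_zero' := rfl
        map_add' := fun _ _ => Subsingleton.elim _ _
        commutes' := fun _ => Subsingleton.elim _ _
        map_star' := fun _ => Subsingleton.elim _ _ },
      fun ι _ P S _ => ⟨fun g j u => memL2_zero.congr (Eventually.of_forall fun y => isEmptyElim y),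
        fun g i v => memL2_zero.congr (Eventually.of_forall fun y => isEmptyElim y),
        fun T u => ?_⟩⟩
    convert hasSum_zero using 1
  borelize N
  have : SecondCountableTopology N :=
    ChartedSpace.secondCountable_of_sigmaCompact (EuclideanSpace ℝ (Fin n)) N
  have : LocallyCompactSpace M₁ := ChartedSpace.locallyCompactSpace (EuclideanSpace ℝ (Fin n)) M₁
  have : Nonempty M₂ := hM.map ϖ
  have : Countable Γ₁ := h₁.countable
  have : Countable Γ₂ := h₂.countable
  obtain ⟨τ, hτ, hpτ, K, hK, hτK⟩ := exists_measurable_section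
    h₁.isCoveringMap.isLocalHomeomorph h₁.surjective
  have hs₁ := h₁.isSectionSystem hτ hpτ
  -- Using `ϖ ∘ τ` as the section of `p₂` makes the two tilings compatible, which is the relation
  -- `hσ` below.
  have hs₂ := h₂.isSectionSystem (ϖ.continuous.measurable.comp hτ) fun x => (hϖ _).trans (hpτ x)
  have hl₁ := h₁.isLocallyFinite hK hτK
  have hl₂ := h₂.isLocallyFinite (hK.image ϖ.continuous) fun x => mem_image_of_mem ϖ (hτK x)
  have hf₁ := hs₁.isFrame (F := F) (E := E) h₁.map_smul
  have hf₂ := hs₂.isFrame (F := F) (E := E) h₂.map_smul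
  have hc₁ := h₁.hasCompactNeighborhoods
  have hc₂ := h₂.hasCompactNeighborhoods
  set q : Γ₁ →* Γ₂ := e.toMonoidHom.comp (QuotientGroup.mk' H) with hq_def
  have hq : Function.Surjective q := e.surjective.comp (QuotientGroup.mk'_surjective H)
  have hker : q.ker = H := by
    ext g
    simp [hq_def]
  have hσ : ∀ (g : Γ₁) x, q g • ϖ (τ x) = ϖ (g • τ x) := fun g x => (hϖ_smul g (τ x)).symm
  have hd := (h₁.isRiemannianIsometric_lift h₂ ϖ.continuous hϖ).riemannianEDist_le
  have hb : ∀ T ∈ finitePropagationAlgebra hc₁ hf₁, IsBanded hs₁.incl hs₁.proj T := fun T hT =>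
    (isLocalBy_of_propagation_le le_rfl).isBanded hs₁ hc₁ hl₁ hT.2
  -- The homomorphism is fixed here from the tilings alone, before any partition of unity or set of
  -- representatives is introduced.
  obtain ⟨Ψ, hΨ⟩ := exists_starAlgHom_isFold hf₁ hf₂ hq (finitePropagationAlgebra hc₁ hf₁)
    (finitePropagationAlgebra hc₂ hf₂) hb (fun T hT => hT.1) fun T hT X hX =>
      ⟨hX.commutesWith hf₁ hf₂ hq (hb T hT) hT.1,
        (hX.isLocalBy hs₁ hs₂ h₁.map_smul h₂.map_smul hc₁ hl₁ hl₂ hq hσ hd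
          (isLocalBy_of_propagation_le le_rfl) hT.2 hT.1).propagation_le.trans_lt hT.2⟩
  refine ⟨finitePropagationAlgebra hc₁ hf₁, finitePropagationAlgebra hc₂ hf₂,
    fun T => and_congr_left fun _ => (hs₁.isEquivariant_iff h₁.map_smul T).symm,
    fun T => and_congr_left fun _ => (hs₂.isEquivariant_iff h₂.map_smul T).symm,
    Ψ, fun ι _ P S hS => ?_⟩
  obtain ⟨A, hA⟩ := P.exists_finset h₁.isCoveringMap.isLocalHomeomorph hl₁
  refine ⟨fun g j u => memL2_pulledPiece hs₁ hs₂ P hA hϖ hσ h₁.map_smul g j u.memL2_rep,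
    fun g i v => memL2_pushedPiece hs₁ hs₂ P hA hϖ hσ h₁.map_smul g i v.memL2_rep,
    fun T u => ?_⟩
  simp only [sum_foldingTerm hs₁ hs₂ P hA hϖ hσ h₁.map_smul]
  exact (hΨ T).hasSum_foldPiece (isCutoff_mulφ hs₁ P hA h₁.map_smul) hf₁ hf₂ hq (hb T.1 T.2) T.2.1
    (Subgroup.IsComplement.existsUnique_eq hq (by rwa [hker])) u
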